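/- Let $d\ge 1$, let $\mathcal L\subset\mathbb R^d$ be the lattice generated by a basis $(a_1,\dots,a_d)$ of $\mathbb R^d$, $\mathcal D=\{\sum_i t_ia_i:\ t\in[0,1)^d\}$ its fundamental domain, and $\Lambda_n=\mathcal L\cap[-n,n]^d$. Let $\mathbb Q$ be a probability measure on $\mathbb R^d$ and let $H$ be a measurable function from the finite subsets of $\mathbb R^d$ (with the $\sigma$-algebra generated by the counts $\gamma\mapsto\#(\gamma\cap W)$, $W$ Borel) to $\mathbb R\cup\{\infty\}$. In differences of energies we use the convention $\infty-\infty=0$. For a bounded set $W$ and a locally finite set $\gamma\subset\mathbb R^d$ put $H_W(\gamma)=\lim_{n\to\infty}\big(H(\gamma\cap[-n,n]^d)-H((\gamma\cap[-n,n]^d)\setminus W)\big)$ when the limit exists. Assume: (H1) there is $A\ge0$ with $H(\gamma)\ge -A\,\#\gamma$ for all finite $\gamma$; (H2) there are $\varepsilon>0$ and $B\ge 0$ such that $H(\{i+x_i\}_{i\in\Lambda})\le B\,\#\Lambda$ for all finite $\Lambda\subset\mathcal L$ whenever $|x_i|\le\varepsilon$ for all $i\in\mathcal L$; (H3) $H(\gamma)=\infty$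 implies $H(\gamma\cup\{x\})=\infty$ for all $x\in\mathbb R^d$; (H4) $H(\gamma+v)=H(\gamma)$ for all $v\in\mathbb R^d$ and all finite $\gamma$; and one of the following two pairs of conditions: (a) (H5.1) there is $R>0$ such that for every bounded $W\subset\mathbb R^d$ and every locally finite $\gamma$ with $H((\gamma\cap[-n,n]^d)\setminus W)<\infty$ for all $n$, the limit $H_W(\gamma)$ exists and equals $H_W(\gamma\cap(W\oplus B(0,R)))$; and (Q1[1]) $\int e^{c|x|}\,\mathbb Q(dx)<\infty$ for some $c>0$; (b) (H5.2) there are $\phi:\mathbb R^+\to\mathbb R\cup\{\infty\}$, monotone on some half-line $(r_0,\infty)$, and $\epsilon>0$ with $H(\gamma)=\sum_{\{x,y\}\subset\gamma}\phi(|x-y|)$ for all finite $\gamma$ and $\int_\epsilon^\infty r^{d-1}|\phi(r)|\,dr<\infty$; and (Q2) $\mathbb Q$ has bounded support. For $\mathbf x\in(\mathbb R^d)^{\mathcal L}$ and finite $\Delta\subset\mathcal L$ let $$\tilde H_\Delta(\mathbf x)=\lim_{n\to\infty}\Big(H(\{i+x_i\}_{i\in\Lambda_n})-H(\{i+x_i\}_{i\in\Lambda_n\setminus\Delta})\Big).$$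 Let $\mathcal G_{\mathcal L}(H,\mathbb Q)$ be the set of probability measures $P$ on $(\mathbb R^d)^{\mathcal L}$ that are invariant under the translations by $\mathcal L$ and satisfy the DLR equations: for every finite $\Delta\subset\mathcal L$ and $P$-almost every $\mathbf x_{\Delta^c}$, the limit $\tilde H_\Delta(\mathbf x'_\Delta\cup\mathbf x_{\Delta^c})$ exists for $\mathbb Q^{\otimes\Delta}$-almost every $\mathbf x'_\Delta$ and $$P(d\mathbf x_\Delta'\mid\mathbf x_{\Delta^c})=\frac1{Z_\Delta(\mathbf x_{\Delta^c})}e^{-\tilde H_\Delta(\mathbf x_\Delta'\cup\mathbf x_{\Delta^c})}\,\mathbb Q^{\otimes\Delta}(d\mathbf x'_\Delta),\qquad Z_\Delta(\mathbf x_{\Delta^c})=\int e^{-\tilde H_\Delta(\mathbf x_\Delta'\cup\mathbf x_{\Delta^c})}\,\mathbb Q^{\otimes\Delta}(d\mathbf x'_\Delta)\in(0,\infty).$$ A Gibbs perturbed lattice is a random set $\mathbf\Gamma=\{i+X_i+U:\ i\in\mathcal L\}$, where the law of $\mathbf X=(X_i)_{i\in\mathcal L}$ belongs to $\mathcal G_{\mathcal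 L}(H,\mathbb Q)$, $U$ is uniformly distributed on $\mathcal D$, and $\mathbf X$ and $U$ are independent; $P_{\mathcal L}(H,\mathbb Q)$ denotes the set of (laws of) stationary Gibbs perturbed lattices. Then $\mathcal G_{\mathcal L}(H,\mathbb Q)\ne\emptyset$ and $P_{\mathcal L}(H,\mathbb Q)\neq\emptyset$. Every Gibbs perturbed lattice $\mathbf\Gamma$ is a stationary point process on $\mathbb R^d$: it is almost surely locally finite, and $\mathbf\Gamma+v$ has the law of $\mathbf\Gamma$ for every $v\in\mathbb R^d$. Moreover the laws $\mathbb P_u$ of $\{i+X_i+u:\ i\in\mathcal L\}$, $u\in\mathbb R^d$, form a regular conditional distribution of $\mathbf\Gamma$ given $U=u$, and for every $u\in\mathbb R^d$ the law $\mathbb P_u$ is invariant under all translations by vectors of $\mathcal L$. -/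

import Mathlib

open MeasureTheory ProbabilityTheory Filter Topology
open scoped Pointwise ENNReal

noncomputable section

namespace GibbsLattice

/-- Euclidean space `ℝ^d`. -/
abbrev E (d : ℕ) : Type := EuclideanSpace ℝ (Fin d)

/-- The lattice generated by the basis `b`. -/
abbrev Lat {d : ℕ} (b : Module.Basis (Fin d) ℝ (E d)) : Submodule ℤ (E d) :=
  Submodule.span ℤ (Set.range b)

/-- The configuration space `(ℝ^d)^L` of displacement fields, with the product σ-algebra. -/
abbrev Field {d : ℕ} (b : Module.Basis (Fin d) ℝ (E d)) : Type := Lat b → E d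

/-- The cube `[-n,n]^d`. -/
def cube (d n : ℕ) : Set (E d) := {x | ∀ k, |x k| ≤ n}

theorem cube_bounded (d n : ℕ) : Bornology.IsBounded (cube d n) := by
  refine isBounded_iff_forall_norm_le.2 ⟨Real.sqrt (∑ _k : Fin d, (n : ℝ) ^ 2), fun x hx => ?_⟩
  rw [EuclideanSpace.norm_eq]
  refine Real.sqrt_le_sqrt (Finset.sum_le_sum fun k _ => ?_)
  rw [Real.norm_eq_abs]
  exact pow_le_pow_left₀ (abs_nonneg _) (hx k) 2

/-- `Λ_n = [-n,n]^d ∩ L`, as a finite subset of `L`. -/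
def box {d : ℕ} (b : Module.Basis (Fin d) ℝ (E d)) (n : ℕ) : Finset (Lat b) :=
  Set.Finite.toFinset (s := {i : Lat b | (i : E d) ∈ cube d n})
    (Set.Finite.of_finite_image
      ((ZSpan.setFinite_inter b (cube_bounded d n)).subset (by
        rintro _ ⟨i, hi, rfl⟩
        exact ⟨hi, i.2⟩))
      Subtype.val_injective.injOn)

/-! ### Point configurations -/

/-- A set is locally finite if it has finitely many points in every bounded set. -/
def IsLocallyFinite {d : ℕ} (γ : Set (E d)) : Prop :=
  ∀ W : Set (E d), Bornology.IsBounded W → (γ ∩ W).Finite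

theorem IsLocallyFinite.inter {d : ℕ} {γ : Set (E d)} (h : IsLocallyFinite γ) (V : Set (E d)) :
    IsLocallyFinite (γ ∩ V) :=
  fun W hW => (h W hW).subset (Set.inter_subset_inter_left _ Set.inter_subset_left)

/-- The finite configuration `γ ∩ [-n,n]^d`. -/
def IsLocallyFinite.window {d : ℕ} {γ : Set (E d)} (h : IsLocallyFinite γ) (n : ℕ) :
    Finset (E d) :=
  (h (cube d n) (cube_bounded d n)).toFinset

open scoped Classical in
/-- `γ \ W` for a finite configuration `γ`. -/
def outside {d : ℕ} (γ : Finset (E d)) (W : Set (E d)) : Finset (E d) :=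
  γ.filter (fun x => x ∉ W)

/-- The σ-algebra on finite configurations generated by the counting functions
`γ ↦ #(γ ∩ W)`, for `W` Borel. -/
@[reducible] def finiteConfigSigma (d : ℕ) : MeasurableSpace (Finset (E d)) :=
  ⨆ (W : Set (E d)) (_ : MeasurableSet W),
    MeasurableSpace.comap (fun γ : Finset (E d) => ((γ : Set (E d)) ∩ W).encard) ⊤

/-- Countable subsets of `ℝ^d`. -/
structure CountableSubset (d : ℕ) where
  carrier : Set (E d)
  countable : carrier.Countable

/-- The σ-algebra generated by the counting functions `γ ↦ #(γ ∩ W) ∈ ℕ ∪ {∞}`, `W` Borel. -/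
instance (d : ℕ) : MeasurableSpace (CountableSubset d) :=
  ⨆ (W : Set (E d)) (_ : MeasurableSet W),
    MeasurableSpace.comap (fun γ : CountableSubset d => (γ.carrier ∩ W).encard) ⊤

/-- The translate `γ + v`. -/
def CountableSubset.translate {d : ℕ} (γ : CountableSubset d) (v : E d) : CountableSubset d where
  carrier := (fun x => x + v) '' γ.carrier
  countable := γ.countable.image _

/-- A random countable set is a point process if it is measurable and almost surely locally
finite; it is stationary if moreover its law is invariant under all translations. -/
structure IsStationaryPointProcess {d : ℕ} {S : Type*} [MeasurableSpace S] (μ : Measure S)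
    (Γ : S → CountableSubset d) : Prop where
  measurable : Measurable Γ
  locallyFinite : ∀ᵐ s ∂μ, IsLocallyFinite (Γ s).carrier
  stationary : ∀ v : E d, μ.map (fun s => (Γ s).translate v) = μ.map Γ

/-! ### Hamiltonians -/

/-- The difference `a - b` with the convention `∞ - ∞ = 0`. -/
def energyDiff (a b : EReal) : EReal :=
  open scoped Classical in if a = ⊤ ∧ b = ⊤ then 0 else a - b

/-- A Hamiltonian: a measurable function from finite configurations to `ℝ ∪ {∞}`. -/
structure IsHamiltonian {d : ℕ} (H : Finset (E d) → EReal) : Prop where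
  measurable : Measurable[finiteConfigSigma d] H
  ne_bot : ∀ γ, H γ ≠ ⊥

/-- Stability. -/
def Stable {d : ℕ} (H : Finset (E d) → EReal) : Prop :=
  ∃ A : ℝ, 0 ≤ A ∧ ∀ γ : Finset (E d), ((-(A * γ.card) : ℝ) : EReal) ≤ H γ

open scoped Classical in
/-- The finite set of points `{i + x_i : i ∈ Λ}`. -/
def points {d : ℕ} {b : Module.Basis (Fin d) ℝ (E d)} (Λ : Finset (Lat b)) (x : Field b) :
    Finset (E d) :=
  Λ.image (fun i : Lat b => (i : E d) + x i)

/-- Non-degeneracy. -/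
def NonDegenerate {d : ℕ} (b : Module.Basis (Fin d) ℝ (E d)) (H : Finset (E d) → EReal) : Prop :=
  ∃ ε : ℝ, 0 < ε ∧ ∃ B : ℝ, 0 ≤ B ∧ ∀ x : Field b, (∀ i, ‖x i‖ ≤ ε) →
    ∀ Λ : Finset (Lat b), H (points Λ x) ≤ ((B * Λ.card : ℝ) : EReal)

open scoped Classical in
/-- Heredity. -/
def Hereditary {d : ℕ} (H : Finset (E d) → EReal) : Prop :=
  ∀ γ, H γ = ⊤ → ∀ x : E d, H (insert x γ) = ⊤

open scoped Classical in
/-- Translation invariance. -/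
def TranslationInvariant {d : ℕ} (H : Finset (E d) → EReal) : Prop :=
  ∀ (v : E d) (γ : Finset (E d)), H (γ.image (fun x => x + v)) = H γ

/-- `h` is the local energy `H_W(γ) = lim_n H(γ ∩ [-n,n]^d) - H((γ ∩ [-n,n]^d) \ W)`. -/
def IsLocalEnergy {d : ℕ} (H : Finset (E d) → EReal) (W : Set (E d)) {γ : Set (E d)}
    (hγ : IsLocallyFinite γ) (h : EReal) : Prop :=
  Tendsto (fun n : ℕ => energyDiff (H (hγ.window n)) (H (outside (hγ.window n) W))) atTop (𝓝 h)

/-- Finite range: `H_W(γ) = H_W(γ ∩ (W ⊕ B(0,R)))` for bounded `W` and locally finite `γ`.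
The identity is asked for only when the configuration outside `W` has finite energy: elsewhere
the convention `∞ - ∞ = 0` would make it fail for every hard-core interaction. -/
def FiniteRange {d : ℕ} (H : Finset (E d) → EReal) : Prop :=
  ∃ R : ℝ, 0 < R ∧ ∀ W : Set (E d), Bornology.IsBounded W →
    ∀ (γ : Set (E d)) (hγ : IsLocallyFinite γ), (∀ n, H (outside (hγ.window n) W) ≠ ⊤) →
      ∃ h : EReal, IsLocalEnergy H W hγ h ∧
        IsLocalEnergy H W (hγ.inter (W + Metric.ball (0 : E d) R)) h

/-- The value `φ(|x-y|)` on the unordered pair `{x,y}`. -/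
def pairValue {d : ℕ} (φ : ℝ → EReal) : Sym2 (E d) → EReal :=
  Sym2.lift ⟨fun x y => φ (dist x y), fun x y => congrArg φ (dist_comm x y)⟩

open scoped Classical in
/-- Summable pair interaction: `H(γ) = ∑_{{x,y} ⊂ γ} φ(|x-y|)` with `φ` monotone at infinity
and `∫_{r > ε} r^{d-1} |φ(r)| dr < ∞`. -/
def SummablePairPotential {d : ℕ} (H : Finset (E d) → EReal) : Prop :=
  ∃ φ : ℝ → EReal, (∀ r, φ r ≠ ⊥) ∧
    (∃ r₀ : ℝ, MonotoneOn φ (Set.Ioi r₀) ∨ AntitoneOn φ (Set.Ioi r₀)) ∧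
    (∀ γ : Finset (E d), H γ = ∑ p ∈ γ.sym2.filter (fun p => ¬ p.IsDiag), pairValue φ p) ∧
    ∃ ε : ℝ, 0 < ε ∧ ∫⁻ r in Set.Ioi ε, ENNReal.ofReal (r ^ (d - 1)) * (φ r).abs < ∞

/-! ### Displacement distributions -/

/-- Exponential moment of order `m`: `𝔼 exp(c |X|^m) < ∞` for some `c > 0`. -/
def HasExpMoment {d : ℕ} (Q : Measure (E d)) (m : ℕ) : Prop :=
  ∃ c : ℝ, 0 < c ∧ Integrable (fun x : E d => Real.exp (c * ‖x‖ ^ m)) Q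

/-- Bounded support. -/
def HasBoundedSupport {d : ℕ} (Q : Measure (E d)) : Prop :=
  Bornology.IsBounded Q.support

/-! ### Gibbs measures on the lattice -/

section

variable {d : ℕ} {b : Module.Basis (Fin d) ℝ (E d)}

open scoped Classical in
/-- `H̃(x_{Λ_n}) - H̃(x_{Λ_n \ Δ})`. -/
def energyIncrement (H : Finset (E d) → EReal) (Δ : Finset (Lat b)) (x : Field b) (n : ℕ) :
    EReal :=
  energyDiff (H (points (box b n) x)) (H (points (box b n \ Δ) x))

/-- The local energy `H̃_Δ(x) = lim_n H̃(x_{Λ_n}) - H̃(x_{Λ_n \ Δ})`. It is written as a limit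
superior to be defined everywhere; Gibbs measures are required to make the limit exist. -/
def latticeEnergy (H : Finset (E d) → EReal) (Δ : Finset (Lat b)) (x : Field b) : EReal :=
  limsup (energyIncrement H Δ x) atTop

open scoped Classical in
/-- The field `x'_Δ ∪ x_{Δᶜ}`. -/
def glue (Δ : Finset (Lat b)) (x' : {i // i ∈ Δ} → E d) (y : {i // i ∉ Δ} → E d) : Field b :=
  fun i => if h : i ∈ Δ then x' ⟨i, h⟩ else y ⟨i, h⟩

/-- The Boltzmann weight `exp(-H̃_Δ(x'_Δ ∪ y))`. -/
def weight (H : Finset (E d) → EReal) (Δ : Finset (Lat b)) (y : {i // i ∉ Δ} → E d)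
    (x' : {i // i ∈ Δ} → E d) : ℝ≥0∞ :=
  EReal.exp (-latticeEnergy H Δ (glue Δ x' y))

/-- The partition function `Z_Δ(y) = ∫ exp(-H̃_Δ(x'_Δ ∪ y)) Q^{⊗Δ}(dx')`. -/
def partition (H : Finset (E d) → EReal) (Q : Measure (E d)) (Δ : Finset (Lat b))
    (y : {i // i ∉ Δ} → E d) : ℝ≥0∞ :=
  ∫⁻ x', weight H Δ y x' ∂(Measure.pi fun _ : {i // i ∈ Δ} => Q)

/-- The measure `Z_Δ(y)⁻¹ exp(-H̃_Δ(x'_Δ ∪ y)) Q^{⊗Δ}(dx')`. If `Z_Δ(y)` is `0` or `∞` this is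
the zero measure, so the DLR equations force `0 < Z_Δ < ∞` almost surely. -/
def specification (H : Finset (E d) → EReal) (Q : Measure (E d)) (Δ : Finset (Lat b))
    (y : {i // i ∉ Δ} → E d) : Measure ({i // i ∈ Δ} → E d) :=
  (partition H Q Δ y)⁻¹ • (Measure.pi fun _ : {i // i ∈ Δ} => Q).withDensity (weight H Δ y)

/-- The restriction `x_Δ`. -/
def restrictIn (Δ : Finset (Lat b)) (x : Field b) : {i // i ∈ Δ} → E d := fun i => x i

/-- The restriction `x_{Δᶜ}`. -/
def restrictOut (Δ : Finset (Lat b)) (x : Field b) : {i // i ∉ Δ} → E d := fun i => x i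

/-- The field translated by a lattice vector. -/
def shift (k : Lat b) (x : Field b) : Field b := fun i => x (i + k)

end

/-- Gibbs measures: lattice-translation invariant probability measures on `(ℝ^d)^L` such that, for
each finite `Δ` and almost every `y = x_{Δᶜ}`, the local energy exists as a limit and the
conditional law of `x_Δ` given `x_{Δᶜ} = y` is `Z_Δ(y)⁻¹ exp(-H̃_Δ(x'_Δ ∪ y)) Q^{⊗Δ}(dx')`. -/
structure IsGibbsMeasure {d : ℕ} (b : Module.Basis (Fin d) ℝ (E d)) (H : Finset (E d) → EReal)
    (Q : Measure (E d)) (P : ProbabilityMeasure (Field b)) : Prop where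
  invariant : ∀ k : Lat b, (P : Measure (Field b)).map (shift k) = P
  energy_exists : ∀ Δ : Finset (Lat b), ∀ᵐ y ∂((P : Measure (Field b)).map (restrictOut Δ)),
    ∀ᵐ x' ∂(Measure.pi fun _ : {i // i ∈ Δ} => Q),
      ∃ h : EReal, Tendsto (energyIncrement H Δ (glue Δ x' y)) atTop (𝓝 h)
  dlr : ∀ Δ : Finset (Lat b), ∀ᵐ y ∂((P : Measure (Field b)).map (restrictOut Δ)),
    condDistrib (restrictIn Δ) (restrictOut Δ) (P : Measure (Field b)) y = specification H Q Δ y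

/-- The set of Gibbs measures. -/
def gibbsMeasures {d : ℕ} (b : Module.Basis (Fin d) ℝ (E d)) (H : Finset (E d) → EReal)
    (Q : Measure (E d)) : Set (ProbabilityMeasure (Field b)) :=
  {P | IsGibbsMeasure b H Q P}

/-! ### Gibbs perturbed lattices -/

/-- The perturbed lattice `{i + x_i + u : i ∈ L}`. -/
def perturbedLattice {d : ℕ} {b : Module.Basis (Fin d) ℝ (E d)} (x : Field b) (u : E d) :
    CountableSubset d where
  carrier := Set.range fun i : Lat b => (i : E d) + x i + u
  countable := Set.countable_range _

/-- The uniform distribution on the fundamental domain `{∑ t_i a_i : t ∈ [0,1)^d}`. -/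
def uniformD {d : ℕ} (b : Module.Basis (Fin d) ℝ (E d)) : Measure (E d) :=
  ProbabilityTheory.cond (volume : Measure (E d)) (ZSpan.fundamentalDomain b)

/-- `X` and `U` are independent, `X` is distributed as a Gibbs measure and `U` is uniform on the
fundamental domain: `perturbedLattice X U` is a Gibbs perturbed lattice. -/
structure IsGibbsPerturbation {d : ℕ} (b : Module.Basis (Fin d) ℝ (E d))
    (H : Finset (E d) → EReal) (Q : Measure (E d)) {S : Type*} [MeasurableSpace S]
    (μ : Measure S) (X : S → Field b) (U : S → E d) : Prop where
  measurable_X : Measurable X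
  measurable_U : Measurable U
  gibbs : ∃ P ∈ gibbsMeasures b H Q, μ.map X = (P : Measure (Field b))
  uniform : μ.map U = uniformD b
  indep : IndepFun X U μ

/-- The set of (laws of) stationary Gibbs perturbed lattices. -/
def gibbsPerturbedLattices {d : ℕ} (b : Module.Basis (Fin d) ℝ (E d)) (H : Finset (E d) → EReal)
    (Q : Measure (E d)) : Set (Measure (CountableSubset d)) :=
  {law | ∃ P ∈ gibbsMeasures b H Q,
    IsStationaryPointProcess ((P : Measure (Field b)).prod (uniformD b))
      (fun p => perturbedLattice p.1 p.2) ∧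
    law = ((P : Measure (Field b)).prod (uniformD b)).map (fun p => perturbedLattice p.1 p.2)}

/-- `κ` is a regular conditional distribution of `Γ` given `U`. -/
structure IsCondLaw {d : ℕ} {S : Type*} [MeasurableSpace S] (μ : Measure S)
    (Γ : S → CountableSubset d) (U : S → E d) (κ : E d → Measure (CountableSubset d)) : Prop where
  prob : ∀ u, IsProbabilityMeasure (κ u)
  measurable : ∀ B, MeasurableSet B → Measurable fun u => κ u B
  disintegration : ∀ A B, MeasurableSet A → MeasurableSet B →
    μ {s | U s ∈ A ∧ Γ s ∈ B} = ∫⁻ u in A, κ u B ∂(μ.map U)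

/-- The law `P_u` of `{i + X_i + u : i ∈ L}`. -/
def lawGiven {d : ℕ} {b : Module.Basis (Fin d) ℝ (E d)} {S : Type*} [MeasurableSpace S]
    (μ : Measure S) (X : S → Field b) (u : E d) : Measure (CountableSubset d) :=
  μ.map fun s => perturbedLattice (X s) u

end GibbsLattice

end

/-! A Gibbs measure is obtained as a limit of free-boundary Gibbs measures on the boxes
`Λ_n = 𝓛 ∩ [-n, n]^d`, averaged over the lattice translations in `Λ_n`. By stability and
nondegeneracy the free-boundary measure has density at most `K ^ #Λ_n` with respect to
`Q^{⊗ Λ_n}`. If a local event `A` on a window `Δ` has small reference probability, then its disjoint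
translates inside `Λ_n` are independent under the reference measure, so the number of translates
that occur has a moment generating function close to `1` per block; Jensen's inequality turns the
density bound into a bound on the averaged probability of `A`, uniform in `n`. Hence the local
marginals are uniformly absolutely continuous, a subsequence converges on all local events, and by
the Følner property of the boxes the limit is invariant under the shifts by `𝓛`.

Both interaction classes are quasi-local: points far from the origin have a small influence on the
energy of a window, uniformly over bounded displacements in the window. As the limit measure almost
surely produces locally finite configurations, quasi-locality carries the finite-volume DLR
equations over to the limit.

Stationarity of the perturbed lattice comes from the rotation `u ↦ u + v` of the torus `ℝ^d / 𝓛`: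
it changes the representative of `U` in the fundamental domain by a lattice vector, which is
absorbed into a shift of the displacement field. -/

noncomputable section

namespace GibbsLattice

/-! ### Measurability of point configurations -/

theorem measurable_of_measurableSet_natCast_le {Ω : Type*} [MeasurableSpace Ω] {f : Ω → ℕ∞}
    (hf : ∀ n : ℕ, MeasurableSet {ω | (n : ℕ∞) ≤ f ω}) : Measurable f := by
  refine measurable_to_countable' fun x => ?_
  induction x using ENat.recTopCoe with
  | top =>
    have : f ⁻¹' {⊤} = ⋂ n : ℕ, {ω | (n : ℕ∞) ≤ f ω} := by
      ext ω
      simp only [Set.mem_preimage, Set.mem_singleton_iff, Set.mem_iInter, Set.mem_ofPred_eq]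
      exact ENat.eq_top_iff_forall_ge
    exact this ▸ MeasurableSet.iInter hf
  | coe n =>
    have : f ⁻¹' {(n : ℕ∞)} = {ω | (n : ℕ∞) ≤ f ω} \ {ω | ((n + 1 : ℕ) : ℕ∞) ≤ f ω} := by
      ext ω
      simp only [Set.mem_preimage, Set.mem_singleton_iff, Set.mem_sdiff, Set.mem_ofPred_eq,
        Nat.cast_add, Nat.cast_one, ENat.add_one_le_iff (ENat.natCast_ne_top n), not_lt]
      exact ⟨fun h => ⟨h.ge, h.le⟩, fun h => le_antisymm h.2 h.1⟩
    exact this ▸ (hf n).diff (hf (n + 1))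

theorem natCast_le_encard_range_inter_iff {ι α : Type*} {f : ι → α} {W : Set α} {n : ℕ} :
    (n : ℕ∞) ≤ (Set.range f ∩ W).encard ↔
      ∃ s : Finset ι, s.card = n ∧ Set.InjOn f s ∧ ∀ i ∈ s, f i ∈ W := by
  constructor
  · intro h
    obtain ⟨t, ht, htn⟩ := Set.exists_subset_encard_eq h
    obtain ⟨u, rfl, hinj⟩ := Set.exists_image_eq_injOn_of_subset_range fun x hx => (ht hx).1
    rw [hinj.encard_image] at htn
    lift u to Finset ι using Set.finite_of_encard_eq_coe htn
    rw [Set.encard_coe_eq_coe_finsetCard, Nat.cast_inj] at htn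
    exact ⟨u, htn, hinj, fun i hi => (ht ⟨i, hi, rfl⟩).2⟩
  · rintro ⟨s, rfl, hinj, hs⟩
    rw [← Set.encard_coe_eq_coe_finsetCard, ← hinj.encard_image]
    refine Set.encard_le_encard ?_
    rintro _ ⟨i, hi, rfl⟩
    exact ⟨⟨i, rfl⟩, hs i hi⟩

theorem measurable_encard_range_inter {Ω ι α : Type*} [MeasurableSpace Ω] [Countable ι]
    [MeasurableSpace α] [MeasurableEq α] {p : ι → Ω → α} (hp : ∀ i, Measurable (p i)) {W : Set α}
    (hW : MeasurableSet W) : Measurable fun ω => (Set.range (fun i => p i ω) ∩ W).encard := by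
  refine measurable_of_measurableSet_natCast_le fun n => ?_
  simp only [natCast_le_encard_range_inter_iff, Set.InjOn, Finset.mem_coe]
  have hne : ∀ i j, Measurable fun ω => p i ω = p j ω := fun i j =>
    (measurableSet_eq_fun (hp i) (hp j)).mem
  have hmem : ∀ i, Measurable fun ω => p i ω ∈ W := fun i => (hp i hW).mem
  refine Measurable.setOf (.exists fun s => measurable_const.and (.and ?_ ?_))
  · exact .forall fun i => measurable_const.imp (.forall fun j => measurable_const.imp
      ((hne i j).imp measurable_const))
  · exact .forall fun i => measurable_const.imp (hmem i)

theorem measurable_countableSubset {d : ℕ} {S : Type*} [MeasurableSpace S]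
    {Γ : S → CountableSubset d}
    (h : ∀ W, MeasurableSet W → Measurable fun s => ((Γ s).carrier ∩ W).encard) :
    Measurable Γ := by
  refine Measurable.of_comap_le ?_
  simp only [instMeasurableSpaceCountableSubset, MeasurableSpace.comap_iSup,
    MeasurableSpace.comap_comp]
  exact iSup₂_le fun W hW => Measurable.comap_le (h W hW)

theorem measurable_encard_carrier_inter {d : ℕ} {W : Set (E d)} (hW : MeasurableSet W) :
    Measurable fun γ : CountableSubset d => (γ.carrier ∩ W).encard :=
  Measurable.of_comap_le (le_iSup₂_of_le W hW le_rfl)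

theorem CountableSubset.measurable_translate {d : ℕ} (v : E d) :
    Measurable fun γ : CountableSubset d => γ.translate v := by
  refine measurable_countableSubset fun W hW => ?_
  convert! measurable_encard_carrier_inter (measurable_add_const v hW) using 2 with γ
  rw [CountableSubset.translate, ← Set.image_inter_preimage, (add_left_injective v).encard_image]

section

variable {d : ℕ} {b : Module.Basis (Fin d) ℝ (E d)}

instance : Countable (Lat b) :=
  (b.restrictScalars ℤ).equivFun.toEquiv.countable_iff.2 inferInstance

theorem measurable_points (Λ : Finset (Lat b)) :
    Measurable[_, finiteConfigSigma d] (points Λ : Field b → Finset (E d)) := by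
  refine Measurable.of_comap_le ?_
  simp only [finiteConfigSigma, MeasurableSpace.comap_iSup, MeasurableSpace.comap_comp]
  refine iSup₂_le fun W hW => Measurable.comap_le ?_
  convert! measurable_encard_range_inter (Ω := Field b) (ι := Λ)
    (p := fun i x => ((i : Lat b) : E d) + x i) (fun i => by fun_prop) hW using 2 with x
  simp only [Function.comp, points, Finset.coe_image, Set.image_eq_range]
  rfl

theorem IsHamiltonian.measurable_comp_points {H : Finset (E d) → EReal} (hH : IsHamiltonian H)
    (Λ : Finset (Lat b)) : Measurable fun x : Field b => H (points Λ x) :=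
  @Measurable.comp _ _ _ _ (finiteConfigSigma d) _ _ _ hH.measurable (measurable_points Λ)

theorem measurable_perturbedLattice :
    Measurable fun p : Field b × E d => perturbedLattice p.1 p.2 :=
  measurable_countableSubset fun _ hW => measurable_encard_range_inter
    (p := fun (i : Lat b) (q : Field b × E d) => (i : E d) + q.1 i + q.2)
    (fun i => by fun_prop) hW

theorem measurable_perturbedLattice_left (u : E d) :
    Measurable fun x : Field b => perturbedLattice x u :=
  measurable_perturbedLattice.comp (measurable_id.prodMk measurable_const)

theorem measurable_shift (k : Lat b) : Measurable (shift k) :=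
  measurable_pi_lambda _ fun i => measurable_pi_apply (i + k)

end

/-! ### Stationary perturbed lattices are almost surely locally finite -/

section

variable {d : ℕ} {b : Module.Basis (Fin d) ℝ (E d)}

/-- A displacement field is sparse if only finitely many indices `i` place their point `i + x_i` in
any given ball. This is local finiteness of the perturbed lattice counted with multiplicity. -/
def IsSparse (x : Field b) : Prop :=
  ∀ r : ℝ, {i : Lat b | ‖(i : E d) + x i‖ ≤ r}.Finite

theorem IsSparse.isLocallyFinite {x : Field b} (hx : IsSparse x) (u : E d) :
    IsLocallyFinite (perturbedLattice x u).carrier := by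
  intro W hW
  obtain ⟨r, hr⟩ := hW.exists_norm_le
  refine ((hx (r + ‖u‖)).image fun i : Lat b => (i : E d) + x i + u).subset ?_
  rintro _ ⟨⟨i, rfl⟩, hi⟩
  refine ⟨i, ?_, rfl⟩
  calc ‖(i : E d) + x i‖ = ‖((i : E d) + x i + u) - u‖ := by rw [add_sub_cancel_right]
    _ ≤ ‖(i : E d) + x i + u‖ + ‖u‖ := norm_sub_le _ _
    _ ≤ r + ‖u‖ := by gcongr; exact hr _ hi

theorem finite_lat_norm_le (r : ℝ) : {i : Lat b | ‖(i : E d)‖ ≤ r}.Finite := by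
  refine Set.Finite.of_finite_image ((ZSpan.setFinite_inter b
    (Metric.isBounded_closedBall (x := (0 : E d)) (r := r))).subset ?_)
    Subtype.val_injective.injOn
  rintro _ ⟨i, hi, rfl⟩
  exact ⟨by simpa using hi, i.2⟩

/-- The number of lattice points in the closed ball of radius `r` about the origin. -/
def latCount (b : Module.Basis (Fin d) ℝ (E d)) (r : ℝ) : ℕ :=
  (finite_lat_norm_le (b := b) r).toFinset.card

theorem encard_lat_norm_add_le (v : E d) (r : ℝ) :
    {i : Lat b | ‖(i : E d) + v‖ ≤ r}.encard ≤ latCount b (r + r) := by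
  rcases Set.eq_empty_or_nonempty {i : Lat b | ‖(i : E d) + v‖ ≤ r} with h | ⟨j, hj⟩
  · simp [h]
  · rw [latCount, ← (finite_lat_norm_le (b := b) (r + r)).encard_eq_coe_toFinset_card,
      ← (sub_left_injective (b := j)).encard_image]
    refine Set.encard_le_encard ?_
    rintro _ ⟨i, hi, rfl⟩
    calc ‖((i - j : Lat b) : E d)‖ = ‖((i : E d) + v) - ((j : E d) + v)‖ := by simp
      _ ≤ r + r := (norm_sub_le _ _).trans (add_le_add hi hj)

theorem tsum_measure_norm_lat_add_le {Ω : Type*} [MeasurableSpace Ω] (μ : Measure Ω) {Y : Ω → E d}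
    (hY : Measurable Y) (r : ℝ) :
    ∑' i : Lat b, μ {ω | ‖(i : E d) + Y ω‖ ≤ r} ≤ latCount b (r + r) * μ Set.univ := by
  let s : Lat b → Set Ω := fun i => {ω | ‖(i : E d) + Y ω‖ ≤ r}
  have hs : ∀ i, MeasurableSet (s i) := fun i => measurableSet_le (by fun_prop) measurable_const
  have hcount : ∀ ω, ∑' i, (s i).indicator (1 : Ω → ℝ≥0∞) ω ≤ latCount b (r + r) := by
    intro ω
    have : ∀ i, (s i).indicator (1 : Ω → ℝ≥0∞) ω =
        {i : Lat b | ‖(i : E d) + Y ω‖ ≤ r}.indicator (fun _ => 1) i := fun i => rfl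
    simp_rw [this]
    rw [← tsum_subtype, ENNReal.tsum_const, mul_one]
    exact_mod_cast encard_lat_norm_add_le (Y ω) r
  calc ∑' i : Lat b, μ (s i)
      = ∑' i, ∫⁻ ω, (s i).indicator 1 ω ∂μ := by simp_rw [lintegral_indicator_one (hs _)]
    _ = ∫⁻ ω, ∑' i, (s i).indicator 1 ω ∂μ :=
        (lintegral_tsum fun i => (measurable_one.indicator (hs i)).aemeasurable).symm
    _ ≤ ∫⁻ _, latCount b (r + r) ∂μ := lintegral_mono hcount
    _ = latCount b (r + r) * μ Set.univ := lintegral_const _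

theorem ae_isSparse {P : Measure (Field b)} [IsProbabilityMeasure P]
    (hP : ∀ k : Lat b, P.map (shift k) = P) : ∀ᵐ x ∂P, IsSparse x := by
  have hshift : ∀ (r : ℝ) (i : Lat b),
      P {x | ‖(i : E d) + x i‖ ≤ r} = P {x | ‖(i : E d) + x 0‖ ≤ r} := by
    intro r i
    have hmeas : MeasurableSet {x : Field b | ‖(i : E d) + x 0‖ ≤ r} :=
      measurableSet_le (by fun_prop) measurable_const
    have := (MeasurePreserving.mk (measurable_shift i) (hP i)).measure_preimage
      hmeas.nullMeasurableSet
    simpa only [shift, Set.preimage_ofPred_eq, zero_add] using this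
  have hnat : ∀ n : ℕ, ∀ᵐ x ∂P, {i : Lat b | ‖(i : E d) + x i‖ ≤ n}.Finite := by
    refine fun n => ae_finite_setOfPred_mem (ne_top_of_le_ne_top ?_
      ((tsum_congr (hshift n)).trans_le
        (tsum_measure_norm_lat_add_le P (measurable_pi_apply 0) n)))
    exact ENNReal.mul_ne_top (ENNReal.natCast_ne_top _) (measure_ne_top _ _)
  filter_upwards [ae_all_iff.2 hnat] with x hx r
  obtain ⟨n, hn⟩ := exists_nat_ge r
  exact (hx n).subset fun i hi => le_trans hi hn

end

/-! ### Stationarity of perturbed lattices -/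

section

variable {d : ℕ} {b : Module.Basis (Fin d) ℝ (E d)}

attribute [ext] CountableSubset

theorem perturbedLattice_translate (x : Field b) (u v : E d) :
    (perturbedLattice x u).translate v = perturbedLattice x (u + v) := by
  ext1
  simp only [CountableSubset.translate, perturbedLattice, ← Set.range_comp, Function.comp_def,
    add_assoc]

theorem perturbedLattice_add_lat (x : Field b) (u : E d) (k : Lat b) :
    perturbedLattice x (u + k) = perturbedLattice (shift (-k) x) u := by
  ext1
  simp only [perturbedLattice]
  rw [← (Equiv.addRight k).surjective.range_comp fun i : Lat b => (i : E d) + shift (-k) x i + u]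
  congr 1
  ext1 i
  simp only [shift, Function.comp, Equiv.coe_addRight, Submodule.coe_add, add_neg_cancel_right]
  abel

instance isProbabilityMeasure_uniformD : IsProbabilityMeasure (uniformD b) :=
  cond_isProbabilityMeasure_of_finite (ZSpan.measure_fundamentalDomain_ne_zero b)
    (ZSpan.fundamentalDomain_isBounded b).measure_lt_top.ne

theorem measurable_floor : Measurable fun u : E d => ZSpan.floor b u := by
  refine measurable_to_countable' fun l => ?_
  have : (fun u : E d => ZSpan.floor b u) ⁻¹' {l} =
      (fun u => u - (l : E d)) ⁻¹' ZSpan.fundamentalDomain b := by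
    ext u
    simp only [Set.mem_preimage, Set.mem_singleton_iff]
    constructor
    · rintro rfl
      exact ZSpan.fract_mem_fundamentalDomain b u
    · intro h
      rw [← ZSpan.fract_eq_self, sub_eq_add_neg, ZSpan.fract_add_ZSpan b u (neg_mem l.2),
        ZSpan.fract_apply] at h
      exact Subtype.ext (sub_right_injective (b := u) (by simpa [sub_eq_add_neg] using h))
  rw [this]
  exact (measurable_sub_const _) (ZSpan.fundamentalDomain_measurableSet b)

theorem measurable_fract : Measurable fun u : E d => ZSpan.fract b u :=
  measurable_id.sub (measurable_subtype_coe.comp measurable_floor)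

theorem isAddFundamentalDomain_image_add_right (v : E d) :
    IsAddFundamentalDomain (Lat b) ((fun u => u + v) '' ZSpan.fundamentalDomain b) := by
  have : (fun u => u + v) '' ZSpan.fundamentalDomain b = v +ᵥ ZSpan.fundamentalDomain b :=
    Set.image_congr fun u _ => by rw [vadd_eq_add, add_comm]
  exact this ▸ (ZSpan.isAddFundamentalDomain b volume).vadd_of_comm v

theorem map_fract_add_uniformD (v : E d) :
    (uniformD b).map (fun u => ZSpan.fract b (u + v)) = uniformD b := by
  have hD := ZSpan.fundamentalDomain_measurableSet b
  have : VAddInvariantMeasure (Lat b) (E d) volume :=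
    ⟨fun c s _ => measure_preimage_add volume (c : E d) s⟩
  ext A hA
  have hm : Measurable fun u => ZSpan.fract b (u + v) :=
    measurable_fract.comp (measurable_add_const v)
  rw [Measure.map_apply hm hA, uniformD, ProbabilityTheory.cond_apply hD,
    ProbabilityTheory.cond_apply hD]
  congr 1
  have hshifted : ZSpan.fundamentalDomain b ∩ (fun u => ZSpan.fract b (u + v)) ⁻¹' A =
      (fun u => u + v) ⁻¹'
        (ZSpan.fract b ⁻¹' A ∩ (fun u => u + v) '' ZSpan.fundamentalDomain b) := by
    ext u; simp [and_comm]
  have horiginal : ZSpan.fundamentalDomain b ∩ A =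
      ZSpan.fract b ⁻¹' A ∩ ZSpan.fundamentalDomain b := by
    ext u
    rw [Set.inter_comm, Set.mem_inter_iff, Set.mem_inter_iff, and_congr_left_iff, Set.mem_preimage]
    intro hu
    rw [ZSpan.fract_eq_self.2 hu]
  rw [hshifted, measure_preimage_add_right, horiginal]
  refine (isAddFundamentalDomain_image_add_right v).measure_set_eq
    (ZSpan.isAddFundamentalDomain b volume) (measurable_fract hA) fun g => ?_
  ext u
  simp only [Set.mem_preimage]
  rw [Submodule.vadd_def, vadd_eq_add, ZSpan.fract_zSpan_add b u g.2]

/-- The pair `(X, U)` re-encoding the translate by `v`: the offset `U + v` is folded back into the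
fundamental domain and the field is shifted by the lattice vector removed in doing so. -/
def refold (v : E d) (p : Field b × E d) : Field b × E d :=
  (shift (-ZSpan.floor b (p.2 + v)) p.1, ZSpan.fract b (p.2 + v))

theorem perturbedLattice_refold (v : E d) (p : Field b × E d) :
    perturbedLattice (refold v p).1 (refold v p).2 = (perturbedLattice p.1 p.2).translate v := by
  rw [perturbedLattice_translate, refold, ← perturbedLattice_add_lat, ZSpan.fract_apply,
    sub_add_cancel]

theorem measurable_shift_neg_floor (v : E d) :
    Measurable fun p : Field b × E d => shift (-ZSpan.floor b (p.2 + v)) p.1 :=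
  have h : Measurable fun q : Lat b × Field b => shift (-q.1) q.2 :=
    measurable_from_prod_countable_right fun l => measurable_shift (-l)
  h.comp ((measurable_floor.comp (by fun_prop)).prodMk measurable_fst)

theorem measurePreserving_refold {P : Measure (Field b)} [IsProbabilityMeasure P]
    (hP : ∀ k : Lat b, P.map (shift k) = P) (v : E d) :
    MeasurePreserving (refold v) (P.prod (uniformD b)) (P.prod (uniformD b)) := by
  have hfract : MeasurePreserving (fun u => ZSpan.fract b (u + v)) (uniformD b) (uniformD b) :=
    ⟨measurable_fract.comp (measurable_add_const v), map_fract_add_uniformD v⟩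
  have hshift : Measurable (Function.uncurry
      fun (u : E d) (x : Field b) => shift (-ZSpan.floor b (u + v)) x) := by
    have h := (measurable_shift_neg_floor (b := b) v).comp (measurable_swap (α := E d))
    simp only [Function.comp_def, Prod.fst_swap, Prod.snd_swap] at h
    simpa only [Function.uncurry_def] using h
  have hskew := hfract.skew_product (μc := P) (μd := P) hshift (Eventually.of_forall fun u => hP _)
  exact (Measure.measurePreserving_swap (μ := uniformD b) (ν := P)).comp
    (hskew.comp (Measure.measurePreserving_swap (μ := P) (ν := uniformD b)))

end

section

variable {d : ℕ} {b : Module.Basis (Fin d) ℝ (E d)} {S : Type*} [MeasurableSpace S] {μ : Measure S}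
  {X : S → Field b} {U : S → E d} {P : Measure (Field b)}

theorem isStationaryPointProcess_perturbedLattice [IsProbabilityMeasure P]
    (hP : ∀ k : Lat b, P.map (shift k) = P) (hX : Measurable X) (hU : Measurable U)
    (hXU : μ.map (fun s => (X s, U s)) = P.prod (uniformD b)) :
    IsStationaryPointProcess μ (fun s => perturbedLattice (X s) (U s)) where
  measurable := measurable_perturbedLattice.comp (hX.prodMk hU)
  locallyFinite := by
    have h := (Measure.quasiMeasurePreserving_fst (μ := P) (ν := uniformD b)).ae (ae_isSparse hP)
    rw [← hXU] at h
    filter_upwards [ae_of_ae_map (hX.prodMk hU).aemeasurable h] with s hs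
    exact IsSparse.isLocallyFinite hs _
  stationary v := by
    let Γ : Field b × E d → CountableSubset d := fun p => perturbedLattice p.1 p.2
    have hΓ : Measurable Γ := measurable_perturbedLattice
    have hXUm := hX.prodMk hU
    have hrefold := measurePreserving_refold hP v
    calc μ.map (fun s => (perturbedLattice (X s) (U s)).translate v)
        = μ.map (Γ ∘ refold v ∘ fun s => (X s, U s)) := by
          simp only [Γ, Function.comp_def, perturbedLattice_refold]
      _ = ((P.prod (uniformD b)).map (refold v)).map Γ := by
          rw [← Measure.map_map hΓ (hrefold.measurable.comp hXUm),
            ← Measure.map_map hrefold.measurable hXUm, hXU]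
      _ = (P.prod (uniformD b)).map Γ := by rw [hrefold.map_eq]
      _ = μ.map (fun s => perturbedLattice (X s) (U s)) := by
          rw [← hXU, Measure.map_map hΓ hXUm]; rfl

theorem lawGiven_eq_map (hX : Measurable X) (u : E d) :
    lawGiven μ X u = (μ.map X).map fun x => perturbedLattice x u := by
  rw [lawGiven, Measure.map_map (measurable_perturbedLattice_left u) hX]
  rfl

theorem isCondLaw_lawGiven [IsProbabilityMeasure P] (hX : Measurable X) (hU : Measurable U)
    (hPX : μ.map X = P) (hXU : μ.map (fun s => (X s, U s)) = P.prod (uniformD b)) :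
    IsCondLaw μ (fun s => perturbedLattice (X s) (U s)) U (lawGiven μ X) := by
  have hΓ := measurable_perturbedLattice (b := b)
  have happ : ∀ B, MeasurableSet B → ∀ u, lawGiven μ X u B =
      P ((fun x => (x, u)) ⁻¹' ((fun p : Field b × E d => perturbedLattice p.1 p.2) ⁻¹' B)) := by
    intro B hB u
    rw [lawGiven_eq_map hX, hPX, Measure.map_apply (measurable_perturbedLattice_left u) hB]
    rfl
  refine ⟨fun u => ?_, fun B hB => ?_, fun A B hA hB => ?_⟩
  · rw [lawGiven_eq_map hX, hPX]
    exact Measure.isProbabilityMeasure_map (measurable_perturbedLattice_left u).aemeasurable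
  · simp_rw [happ B hB]
    exact measurable_measure_prodMk_right (hΓ hB)
  · have hUlaw : μ.map U = uniformD b := by
      have : U = Prod.snd ∘ fun s => (X s, U s) := rfl
      rw [this, ← Measure.map_map measurable_snd (hX.prodMk hU), hXU, Measure.map_snd_prod,
        measure_univ, one_smul]
    have hpre : {s | U s ∈ A ∧ perturbedLattice (X s) (U s) ∈ B} = (fun s => (X s, U s)) ⁻¹'
        ((Prod.snd ⁻¹' A) ∩ ((fun p : Field b × E d => perturbedLattice p.1 p.2) ⁻¹' B)) := rfl
    have hm := (measurable_snd hA).inter (hΓ hB)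
    rw [hpre, ← Measure.map_apply (hX.prodMk hU) hm, hXU, Measure.prod_apply_symm hm, hUlaw,
      ← lintegral_indicator hA]
    refine lintegral_congr fun u => ?_
    by_cases hu : u ∈ A <;> simp [hu, happ B hB, Set.preimage_inter, ← Set.preimage_comp,
      Function.comp_def]

theorem lawGiven_map_translate (hX : Measurable X) (hP : ∀ k : Lat b, (μ.map X).map (shift k) =
    μ.map X) (u : E d) {k : E d} (hk : k ∈ Lat b) :
    (lawGiven μ X u).map (fun γ => γ.translate k) = lawGiven μ X u := by
  have hu := measurable_perturbedLattice_left (b := b) u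
  have hcomm : (fun γ : CountableSubset d => γ.translate k) ∘
      (fun x : Field b => perturbedLattice x u) =
      (fun x : Field b => perturbedLattice x u) ∘ shift (-⟨k, hk⟩) := by
    ext1 x
    exact (perturbedLattice_translate x u k).trans (perturbedLattice_add_lat x u ⟨k, hk⟩)
  rw [lawGiven_eq_map hX, Measure.map_map (CountableSubset.measurable_translate k) hu, hcomm,
    ← Measure.map_map hu (measurable_shift _), hP]

end

/-! ### Independent events under a measure with bounded density -/

theorem exp_mul_integral_le_mgf {Ω : Type*} [MeasurableSpace Ω] {μ : Measure Ω}
    [IsProbabilityMeasure μ] {X : Ω → ℝ} {t : ℝ} (hX : Integrable X μ)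
    (hexp : Integrable (fun ω => Real.exp (t * X ω)) μ) :
    Real.exp (t * ∫ ω, X ω ∂μ) ≤ mgf X μ t := by
  rw [← integral_const_mul]
  exact convexOn_exp.map_integral_le Real.continuous_exp.continuousOn isClosed_univ (by simp)
    (hX.const_mul t) hexp

theorem mgf_indicator_one_le {Ω : Type*} [MeasurableSpace Ω] {μ : Measure Ω}
    [IsProbabilityMeasure μ] {A : Set Ω} (hA : MeasurableSet A) (t : ℝ) :
    mgf (A.indicator fun _ => (1 : ℝ)) μ t ≤ Real.exp (Real.exp t * μ.real A) := by
  have hexp : ∀ ω, Real.exp (t * A.indicator (fun _ => (1 : ℝ)) ω) =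
      1 + A.indicator (fun _ => Real.exp t - 1) ω := by
    intro ω
    by_cases h : ω ∈ A <;> simp [h]
  calc mgf (A.indicator fun _ => (1 : ℝ)) μ t
      = 1 + μ.real A * (Real.exp t - 1) := by
        simp only [mgf, hexp]
        rw [integral_add (integrable_const _) ((integrable_const _).indicator hA),
          integral_indicator_const _ hA]
        simp
    _ ≤ Real.exp t * μ.real A + 1 := by nlinarith [measureReal_nonneg (μ := μ) (s := A)]
    _ ≤ Real.exp (Real.exp t * μ.real A) := Real.add_one_le_exp _

theorem sum_measureReal_le_of_le_smul {Ω ι : Type*} [MeasurableSpace Ω] [Fintype ι]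
    {μ ν : Measure Ω} [IsProbabilityMeasure μ] [IsProbabilityMeasure ν] {c : ℝ}
    (hν : ν ≤ ENNReal.ofReal (Real.exp c) • μ) {A : ι → Set Ω} (hA : ∀ i, MeasurableSet (A i))
    (hind : iIndepSet A μ) (t : ℝ) :
    t * ∑ i, ν.real (A i) ≤ c + Real.exp t * ∑ i, μ.real (A i) := by
  set X : ι → Ω → ℝ := fun i => (A i).indicator fun _ => 1
  have hXm : ∀ i, Measurable (X i) := fun i => measurable_const.indicator (hA i)
  have hXint : ∀ i, Integrable (X i) ν := fun i => (integrable_const 1).indicator (hA i)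
  have hexp : ∀ (ρ : Measure Ω) [IsFiniteMeasure ρ],
      Integrable (fun ω => Real.exp (t * (∑ i, X i) ω)) ρ := by
    intro ρ _
    refine integrable_exp_mul_of_mem_Icc (a := ∑ _i : ι, 0) (b := ∑ _i : ι, 1)
      (Finset.aemeasurable_sum _ fun i _ => (hXm i).aemeasurable) (Eventually.of_forall fun ω => ?_)
    rw [Finset.sum_apply]
    exact ⟨Finset.sum_le_sum fun i _ => Set.indicator_nonneg (fun _ _ => zero_le_one) ω,
      Finset.sum_le_sum fun i _ => Set.indicator_le_self' (fun _ _ => zero_le_one) ω⟩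
  have hmean : ∫ ω, (∑ i, X i) ω ∂ν = ∑ i, ν.real (A i) := by
    simp only [Finset.sum_apply]
    rw [integral_finsetSum _ fun i _ => hXint i]
    simp [X, integral_indicator_const _ (hA _)]
  have hchange : mgf (∑ i, X i) ν t ≤ Real.exp c * mgf (∑ i, X i) μ t := by
    have h := integral_mono_measure hν (Eventually.of_forall fun ω => Real.exp_nonneg _)
      ((hexp μ).smul_measure ENNReal.ofReal_ne_top)
    rwa [integral_smul_measure, ENNReal.toReal_ofReal (Real.exp_nonneg _), smul_eq_mul] at h
  rw [← Real.exp_le_exp, ← hmean]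
  calc Real.exp (t * ∫ ω, (∑ i, X i) ω ∂ν)
      ≤ mgf (∑ i, X i) ν t :=
        exp_mul_integral_le_mgf (integrable_finsetSum' _ fun i _ => hXint i) (hexp ν)
    _ ≤ Real.exp c * mgf (∑ i, X i) μ t := hchange
    _ = Real.exp c * ∏ i, mgf (X i) μ t := by rw [hind.iIndepFun_indicator.mgf_sum hXm]
    _ ≤ Real.exp c * ∏ i, Real.exp (Real.exp t * μ.real (A i)) := by
        gcongr with i
        · exact fun i _ => mgf_nonneg
        · exact mgf_indicator_one_le (hA i) t
    _ = Real.exp (c + Real.exp t * ∑ i, μ.real (A i)) := by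
        rw [← Real.exp_sum, ← Finset.mul_sum, ← Real.exp_add]

/-! ### Finite-volume Gibbs measures -/

section

variable {d : ℕ} {b : Module.Basis (Fin d) ℝ (E d)}

/-- The law of independent displacements: the a priori measure of the finite-volume Gibbs
measures. -/
abbrev freeField (b : Module.Basis (Fin d) ℝ (E d)) (Q : Measure (E d)) : Measure (Field b) :=
  Measure.infinitePi fun _ : Lat b => Q

/-- The Boltzmann factor of the points indexed by `Λ`. -/
def boltzmann (H : Finset (E d) → EReal) (Λ : Finset (Lat b)) (x : Field b) : ℝ≥0∞ :=
  EReal.exp (-H (points Λ x))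

/-- The partition function in `Λ` with free boundary condition. -/
def freePartition (H : Finset (E d) → EReal) (Q : Measure (E d)) (Λ : Finset (Lat b)) : ℝ≥0∞ :=
  ∫⁻ x, boltzmann H Λ x ∂freeField b Q

/-- The Gibbs measure in `Λ` with free boundary condition. It is a law of fields on the whole
lattice: the displacements off `Λ` are independent. -/
def freeGibbs (H : Finset (E d) → EReal) (Q : Measure (E d)) (Λ : Finset (Lat b)) :
    Measure (Field b) :=
  (freePartition H Q Λ)⁻¹ • (freeField b Q).withDensity (boltzmann H Λ)

/-- The translate `Λ - k` of an index set. -/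
def translateBox (k : Lat b) (Λ : Finset (Lat b)) : Finset (Lat b) :=
  Λ.map (Equiv.subRight k).toEmbedding

theorem mem_translateBox {k i : Lat b} {Λ : Finset (Lat b)} :
    i ∈ translateBox k Λ ↔ i + k ∈ Λ :=
  Finset.mem_map_equiv

theorem points_mono {Λ Λ' : Finset (Lat b)} (h : Λ ⊆ Λ') (x : Field b) :
    points Λ x ⊆ points Λ' x :=
  Finset.image_subset_image h

open scoped Classical in
theorem points_translateBox (k : Lat b) (Λ : Finset (Lat b)) (x : Field b) :
    points Λ x = (points (translateBox k Λ) (shift k x)).image (fun y => y + (k : E d)) := by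
  simp only [points, translateBox, Finset.map_eq_image, Finset.image_image]
  refine Finset.image_congr fun i _ => ?_
  simp [shift, sub_add_eq_add_sub]

theorem boltzmann_translateBox {H : Finset (E d) → EReal} (h4 : TranslationInvariant H)
    (k : Lat b) (Λ : Finset (Lat b)) (x : Field b) :
    boltzmann H (translateBox k Λ) (shift k x) = boltzmann H Λ x := by
  rw [boltzmann, boltzmann, points_translateBox k Λ x, h4]

theorem measurable_boltzmann {H : Finset (E d) → EReal} (hH : IsHamiltonian H)
    (Λ : Finset (Lat b)) : Measurable (boltzmann H Λ : Field b → ℝ≥0∞) :=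
  EReal.measurable_exp.comp (hH.measurable_comp_points Λ).neg

theorem freeField_map_shift (Q : Measure (E d)) [IsProbabilityMeasure Q] (k : Lat b) :
    (freeField b Q).map (shift k) = freeField b Q :=
  Measure.map_infinitePi_infinitePi_of_inj (f := fun i : Lat b => i + k) (add_left_injective k)

theorem measurePreserving_shift (Q : Measure (E d)) [IsProbabilityMeasure Q] (k : Lat b) :
    MeasurePreserving (shift k) (freeField b Q) (freeField b Q) :=
  ⟨measurable_shift k, freeField_map_shift Q k⟩

variable {H : Finset (E d) → EReal} {Q : Measure (E d)}

theorem freePartition_translateBox [IsProbabilityMeasure Q] (hH : IsHamiltonian H)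
    (h4 : TranslationInvariant H) (k : Lat b) (Λ : Finset (Lat b)) :
    freePartition H Q (translateBox k Λ) = freePartition H Q Λ := by
  rw [freePartition, ← (measurePreserving_shift Q k).lintegral_comp (measurable_boltzmann hH _)]
  simp_rw [boltzmann_translateBox h4, freePartition]

theorem freeGibbs_map_shift [IsProbabilityMeasure Q] (hH : IsHamiltonian H)
    (h4 : TranslationInvariant H) (k : Lat b) (Λ : Finset (Lat b)) :
    (freeGibbs H Q Λ).map (shift k) = freeGibbs H Q (translateBox k Λ) := by
  rw [freeGibbs, freeGibbs, Measure.map_smul, freePartition_translateBox hH h4]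
  congr 1
  ext A hA
  rw [Measure.map_apply (measurable_shift k) hA, withDensity_apply _ (measurable_shift k hA),
    withDensity_apply _ hA, ← (measurePreserving_shift Q k).setLIntegral_comp_preimage hA
      (measurable_boltzmann hH _)]
  simp_rw [boltzmann_translateBox h4]

theorem boltzmann_le {A : ℝ} (hA : 0 ≤ A)
    (h1 : ∀ γ : Finset (E d), ((-(A * γ.card) : ℝ) : EReal) ≤ H γ)
    (Λ : Finset (Lat b)) (x : Field b) :
    boltzmann H Λ x ≤ ENNReal.ofReal (Real.exp (A * Λ.card)) := by
  rw [← EReal.exp_coe, boltzmann, EReal.exp_le_exp_iff, EReal.neg_le, ← EReal.coe_neg]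
  refine le_trans (EReal.coe_le_coe_iff.2 ?_) (h1 _)
  have hcard : (points Λ x).card ≤ Λ.card := Finset.card_image_le
  gcongr

theorem exp_le_boltzmann {ε B : ℝ} (hε : 0 ≤ ε)
    (h2 : ∀ x : Field b, (∀ i, ‖x i‖ ≤ ε) →
      ∀ Λ : Finset (Lat b), H (points Λ x) ≤ ((B * Λ.card : ℝ) : EReal))
    (h4 : TranslationInvariant H) (Λ : Finset (Lat b)) {v : E d} {x : Field b}
    (hx : ∀ i ∈ Λ, x i ∈ Metric.closedBall v ε) :
    ENNReal.ofReal (Real.exp (-(B * Λ.card))) ≤ boltzmann H Λ x := by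
  classical
  rw [← EReal.exp_coe, boltzmann, EReal.exp_le_exp_iff, EReal.coe_neg, EReal.neg_le_neg_iff]
  have hpoints : points Λ x =
      (points Λ fun i => if i ∈ Λ then x i - v else 0).image (fun y => y + v) := by
    simp only [points, Finset.image_image]
    refine Finset.image_congr fun i hi => ?_
    simp only [Function.comp_apply, if_pos (Finset.mem_coe.1 hi), add_assoc, sub_add_cancel]
  rw [hpoints, h4]
  refine h2 _ (fun i => ?_) Λ
  split_ifs with hi
  · exact mem_closedBall_iff_norm.1 (hx i hi)
  · rwa [norm_zero]

theorem exists_le_freePartition [IsProbabilityMeasure Q] (h2 : NonDegenerate b H)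
    (h4 : TranslationInvariant H) :
    ∃ c : ℝ, 0 ≤ c ∧ ∀ Λ : Finset (Lat b),
      ENNReal.ofReal (Real.exp (-(c * Λ.card))) ≤ freePartition H Q Λ := by
  obtain ⟨ε, hε, B, hB, h2⟩ := h2
  obtain ⟨v, hv⟩ : Q.support.Nonempty :=
    Measure.nonempty_support_iff.2 (IsProbabilityMeasure.ne_zero Q)
  set p : ℝ := Q.real (Metric.closedBall v ε)
  have hp0 : 0 < p := ENNReal.toReal_pos
    ((Measure.mem_support_iff_forall v).1 hv _ (Metric.closedBall_mem_nhds v hε)).ne'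
    (measure_ne_top _ _)
  refine ⟨B - Real.log p, by linarith [Real.log_nonpos hp0.le measureReal_le_one], fun Λ => ?_⟩
  have hball : ∀ i ∈ Λ, MeasurableSet (Metric.closedBall v ε) := fun _ _ =>
    Metric.isClosed_closedBall.measurableSet
  set T : Set (Field b) := Set.pi Λ fun _ => Metric.closedBall v ε
  have hT : freeField b Q T = ENNReal.ofReal (p ^ Λ.card) := by
    rw [Measure.infinitePi_pi _ hball, Finset.prod_const, ENNReal.ofReal_pow hp0.le,
      ofReal_measureReal]
  calc ENNReal.ofReal (Real.exp (-((B - Real.log p) * Λ.card)))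
      = ENNReal.ofReal (Real.exp (-(B * Λ.card))) * ENNReal.ofReal (p ^ Λ.card) := by
        rw [← ENNReal.ofReal_mul (Real.exp_nonneg _), ← Real.exp_log (pow_pos hp0 _),
          Real.log_pow, ← Real.exp_add]
        ring_nf
    _ = ∫⁻ _ in T, ENNReal.ofReal (Real.exp (-(B * Λ.card))) ∂freeField b Q := by
        rw [setLIntegral_const, hT]
    _ ≤ ∫⁻ x in T, boltzmann H Λ x ∂freeField b Q :=
        setLIntegral_mono' (MeasurableSet.pi Λ.countable_toSet hball)
          fun x hx => exp_le_boltzmann hε.le h2 h4 Λ hx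
    _ ≤ freePartition H Q Λ := setLIntegral_le_lintegral _ _

theorem freePartition_ne_zero [IsProbabilityMeasure Q] (h2 : NonDegenerate b H)
    (h4 : TranslationInvariant H) (Λ : Finset (Lat b)) : freePartition H Q Λ ≠ 0 := by
  obtain ⟨c, -, hc⟩ := exists_le_freePartition (Q := Q) h2 h4
  exact ((ENNReal.ofReal_pos.2 (Real.exp_pos _)).trans_le (hc Λ)).ne'

theorem freePartition_ne_top [IsProbabilityMeasure Q] (h1 : Stable H) (Λ : Finset (Lat b)) :
    freePartition H Q Λ ≠ ∞ := by
  obtain ⟨A, hA, h1⟩ := h1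
  exact ((lintegral_mono fun x => boltzmann_le hA h1 Λ x).trans_lt (by simp)).ne

theorem isProbabilityMeasure_freeGibbs [IsProbabilityMeasure Q] (h1 : Stable H)
    (h2 : NonDegenerate b H) (h4 : TranslationInvariant H) (Λ : Finset (Lat b)) :
    IsProbabilityMeasure (freeGibbs H Q Λ) := by
  constructor
  rw [freeGibbs, Measure.smul_apply, withDensity_apply _ MeasurableSet.univ, setLIntegral_univ]
  exact ENNReal.inv_mul_cancel (freePartition_ne_zero h2 h4 Λ) (freePartition_ne_top h1 Λ)

theorem exists_freeGibbs_le [IsProbabilityMeasure Q] (h1 : Stable H) (h2 : NonDegenerate b H)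
    (h4 : TranslationInvariant H) :
    ∃ K : ℝ, 0 ≤ K ∧ ∀ Λ : Finset (Lat b),
      freeGibbs H Q Λ ≤ ENNReal.ofReal (Real.exp (K * Λ.card)) • freeField b Q := by
  obtain ⟨A, hA, h1⟩ := h1
  obtain ⟨c, hc, h⟩ := exists_le_freePartition (Q := Q) h2 h4
  refine ⟨c + A, by positivity, fun Λ => ?_⟩
  have hdensity : (freeField b Q).withDensity (boltzmann H Λ) ≤
      ENNReal.ofReal (Real.exp (A * Λ.card)) • freeField b Q := by
    rw [← withDensity_const]
    exact withDensity_mono (Eventually.of_forall fun x => boltzmann_le hA h1 Λ x)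
  have hZ : (freePartition H Q Λ)⁻¹ ≤ ENNReal.ofReal (Real.exp (c * Λ.card)) := by
    rw [ENNReal.inv_le_iff_inv_le, ← ENNReal.ofReal_inv_of_pos (Real.exp_pos _), ← Real.exp_neg]
    exact h Λ
  rw [add_mul, Real.exp_add, ENNReal.ofReal_mul (Real.exp_nonneg _), mul_smul, freeGibbs]
  intro s
  exact mul_le_mul' hZ (hdensity s)

end

/-! ### Uniform absolute continuity of averaged finite-volume measures -/

theorem exists_forall_abs_le {α J : Type*} [Finite J] (s : Finset α) (f : α → J → ℤ) :
    ∃ N : ℕ, ∀ i ∈ s, ∀ j, |f i j| ≤ N := by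
  cases nonempty_fintype J
  refine ⟨(s ×ˢ Finset.univ).sup fun p => (f p.1 p.2).natAbs, fun i hi j => ?_⟩
  rw [Int.abs_eq_natAbs, Nat.cast_le]
  exact Finset.le_sup (f := fun p : α × J => (f p.1 p.2).natAbs)
    (b := (i, j)) (Finset.mem_product.2 ⟨hi, Finset.mem_univ j⟩)

theorem exists_coloring {L : Type*} [AddCommGroup L] [Module.Free ℤ L] [Module.Finite ℤ L]
    (Δ : Finset L) :
    ∃ (n : ℕ) (c : L → Fin n), ∀ k k', c k = c k' →
      ∀ i ∈ Δ, ∀ i' ∈ Δ, i + k = i' + k' → k = k' := by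
  let coords := (Module.Free.chooseBasis ℤ L).equivFun
  obtain ⟨N, hN⟩ := exists_forall_abs_le Δ coords
  let color : L → (Module.Free.ChooseBasisIndex ℤ L → ZMod (2 * N + 1)) := fun k j => coords k j
  refine ⟨_, Fintype.equivFin _ ∘ color, fun k k' hc i hi i' hi' h => ?_⟩
  refine coords.injective (funext fun j => ?_)
  have hcolor : ((2 * N + 1 : ℕ) : ℤ) ∣ coords k' j - coords k j := by
    rw [← ZMod.intCast_eq_intCast_iff_dvd_sub]
    exact congrFun ((Fintype.equivFin _).injective hc) j
  have hsum : coords i j + coords k j = coords i' j + coords k' j := by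
    simpa only [map_add, Pi.add_apply] using congrFun (congrArg coords h) j
  have hdiff : coords k' j - coords k j = 0 := by
    refine Int.eq_zero_of_abs_lt_dvd hcolor ?_
    have := abs_le.1 (hN i hi j)
    have := abs_le.1 (hN i' hi' j)
    rw [abs_lt]
    omega
  omega

section

variable {d : ℕ} {b : Module.Basis (Fin d) ℝ (E d)} {H : Finset (E d) → EReal} {Q : Measure (E d)}

theorem iIndepFun_blocks [IsProbabilityMeasure Q] (Δ : Finset (Lat b)) {ι : Type*} (f : ι → Lat b)
    (hf : ∀ k k', ∀ i ∈ Δ, ∀ i' ∈ Δ, i + f k = i' + f k' → k = k') :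
    iIndepFun (fun k (x : Field b) => Δ.restrict (shift (f k) x)) (freeField b Q) := by
  have hinj : Function.Injective fun p : ι × Δ => (p.2 : Lat b) + f p.1 := by
    rintro ⟨k, i⟩ ⟨k', i'⟩ h
    obtain rfl := hf k k' i i.2 i' i'.2 h
    exact Prod.ext rfl (Subtype.ext (add_right_cancel h))
  have hjoint := Measure.map_infinitePi_infinitePi_of_inj (P := fun _ : Lat b => Q) hinj
  have hblock : ∀ k, (freeField b Q).map (fun x : Field b => Δ.restrict (shift (f k) x)) =
      Measure.infinitePi fun _ : Δ => Q := fun k =>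
    Measure.map_infinitePi_infinitePi_of_inj (P := fun _ : Lat b => Q)
      fun _ _ h => Subtype.ext (add_right_cancel h)
  have hmeas : ∀ k, Measurable fun x : Field b => Δ.restrict (shift (f k) x) := fun k =>
    (Finset.measurable_restrict Δ).comp (measurable_shift (f k))
  rw [iIndepFun_iff_map_fun_eq_infinitePi_map hmeas]
  simp_rw [hblock]
  rw [← Measure.infinitePi_map_curry (fun (_ : ι) (_ : Δ) => Q)]
  change _ = (Measure.infinitePi fun _ : ι × Δ => Q).map _
  rw [← hjoint, Measure.map_map (MeasurableEquiv.measurable _) (by fun_prop)]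
  rfl

theorem sum_measureReal_blocks_le [IsProbabilityMeasure Q] {ν : Measure (Field b)}
    [IsProbabilityMeasure ν] {c : ℝ} (hν : ν ≤ ENNReal.ofReal (Real.exp c) • freeField b Q)
    {Δ s : Finset (Lat b)}
    (hs : ∀ k ∈ s, ∀ k' ∈ s, ∀ i ∈ Δ, ∀ i' ∈ Δ, i + k = i' + k' → k = k')
    {A : Set (Δ → E d)} (hA : MeasurableSet A) (t : ℝ) :
    t * ∑ k ∈ s, ν.real (shift k ⁻¹' (Δ.restrict ⁻¹' A)) ≤
      c + Real.exp t * (s.card * (freeField b Q).real (Δ.restrict ⁻¹' A)) := by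
  have hA' : MeasurableSet (Δ.restrict ⁻¹' A : Set (Field b)) := Finset.measurable_restrict Δ hA
  have hmeas : ∀ k : s, MeasurableSet (shift (k : Lat b) ⁻¹' (Δ.restrict ⁻¹' A)) := fun k =>
    measurable_shift _ hA'
  have hblocks := iIndepFun_blocks (Q := Q) Δ (fun k : s => (k : Lat b))
    fun k k' i hi i' hi' h => Subtype.ext (hs k k.2 k' k'.2 i hi i' hi' h)
  have hind : iIndepSet (fun k : s => shift (k : Lat b) ⁻¹' (Δ.restrict ⁻¹' A))
      (freeField b Q) :=
    (iIndepSet_iff_meas_biInter hmeas).2 fun _ => hblocks.meas_biInter fun _ _ => ⟨A, hA, rfl⟩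
  have hinv : ∀ k : s, (freeField b Q).real (shift (k : Lat b) ⁻¹' (Δ.restrict ⁻¹' A)) =
      (freeField b Q).real (Δ.restrict ⁻¹' A) := fun k =>
    (measurePreserving_shift Q (k : Lat b)).measureReal_preimage hA'.nullMeasurableSet
  have := sum_measureReal_le_of_le_smul hν hmeas hind t
  simp only [hinv, Finset.sum_const, Finset.card_univ, Fintype.card_coe, nsmul_eq_mul] at this
  rwa [← Finset.sum_coe_sort]

theorem exists_sum_measureReal_shift_le [IsProbabilityMeasure Q] (Δ : Finset (Lat b)) :
    ∃ n : ℕ, ∀ (ν : Measure (Field b)) [IsProbabilityMeasure ν] (c : ℝ),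
      ν ≤ ENNReal.ofReal (Real.exp c) • freeField b Q →
        ∀ (Λ : Finset (Lat b)) (A : Set (Δ → E d)), MeasurableSet A → ∀ t : ℝ,
          t * ∑ k ∈ Λ, ν.real (shift k ⁻¹' (Δ.restrict ⁻¹' A)) ≤
            n * c + Real.exp t * (Λ.card * (freeField b Q).real (Δ.restrict ⁻¹' A)) := by
  classical
  obtain ⟨n, color, hcolor⟩ := exists_coloring Δ
  refine ⟨n, fun ν _ c hν Λ A hA t => ?_⟩
  have hclass : ∀ e, t * ∑ k ∈ Λ with color k = e, ν.real (shift k ⁻¹' (Δ.restrict ⁻¹' A)) ≤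
      c + Real.exp t *
        ((Λ.filter (color · = e)).card * (freeField b Q).real (Δ.restrict ⁻¹' A)) := fun e =>
    sum_measureReal_blocks_le hν (fun k hk k' hk' => hcolor k k'
      ((Finset.mem_filter.1 hk).2.trans (Finset.mem_filter.1 hk').2.symm)) hA t
  have hcard : ∑ e, ((Λ.filter (color · = e)).card : ℝ) = Λ.card := by
    exact_mod_cast (Finset.card_eq_sum_card_fiberwise (f := color) (t := Finset.univ)
      (by simp)).symm
  calc t * ∑ k ∈ Λ, ν.real (shift k ⁻¹' (Δ.restrict ⁻¹' A))
      = ∑ e, t * ∑ k ∈ Λ with color k = e, ν.real (shift k ⁻¹' (Δ.restrict ⁻¹' A)) := by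
        rw [← Finset.sum_fiberwise Λ color, Finset.mul_sum]
    _ ≤ ∑ e, (c + Real.exp t *
        ((Λ.filter (color · = e)).card * (freeField b Q).real (Δ.restrict ⁻¹' A))) :=
        Finset.sum_le_sum fun e _ => hclass e
    _ = n * c + Real.exp t * (Λ.card * (freeField b Q).real (Δ.restrict ⁻¹' A)) := by
        rw [Finset.sum_add_distrib, ← Finset.mul_sum, ← Finset.sum_mul, hcard]
        simp

/-- The average over the translations in `Λ` of the Gibbs measure in `Λ`. Local limits of these
measures along growing boxes are invariant under lattice translations. -/
def averagedGibbs (H : Finset (E d) → EReal) (Q : Measure (E d)) (Λ : Finset (Lat b)) :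
    Measure (Field b) :=
  (Λ.card : ℝ≥0∞)⁻¹ • ∑ k ∈ Λ, (freeGibbs H Q Λ).map (shift k)

theorem averagedGibbs_apply {Λ : Finset (Lat b)} {A : Set (Field b)} (hA : MeasurableSet A) :
    averagedGibbs H Q Λ A = (Λ.card : ℝ≥0∞)⁻¹ * ∑ k ∈ Λ, freeGibbs H Q Λ (shift k ⁻¹' A) := by
  simp only [averagedGibbs, Measure.smul_apply, Measure.finsetSum_apply, smul_eq_mul,
    Measure.map_apply (measurable_shift _) hA]

theorem isProbabilityMeasure_averagedGibbs {Λ : Finset (Lat b)} (hΛ : Λ.Nonempty)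
    [IsProbabilityMeasure (freeGibbs H Q Λ)] : IsProbabilityMeasure (averagedGibbs H Q Λ) := by
  constructor
  rw [averagedGibbs_apply MeasurableSet.univ]
  simp only [Set.preimage_univ, measure_univ, Finset.sum_const, nsmul_eq_mul, mul_one]
  exact ENNReal.inv_mul_cancel (by simpa using hΛ.card_pos.ne') (by simp)

theorem freeGibbs_absolutelyContinuous (Λ : Finset (Lat b)) :
    freeGibbs H Q Λ ≪ freeField b Q :=
  (withDensity_absolutelyContinuous _ _).smul_left _

theorem averagedGibbs_absolutelyContinuous [IsProbabilityMeasure Q] {Λ : Finset (Lat b)} :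
    averagedGibbs H Q Λ ≪ freeField b Q := by
  refine Measure.AbsolutelyContinuous.mk fun A hA h => ?_
  rw [averagedGibbs_apply hA, Finset.sum_eq_zero, mul_zero]
  intro k _
  have hk : freeField b Q (shift k ⁻¹' A) = 0 := by
    rwa [(measurePreserving_shift Q k).measure_preimage hA.nullMeasurableSet]
  exact freeGibbs_absolutelyContinuous Λ hk

theorem averagedGibbs_uniform_absolutelyContinuous [IsProbabilityMeasure Q] (h1 : Stable H)
    (h2 : NonDegenerate b H) (h4 : TranslationInvariant H) (Δ : Finset (Lat b)) {ε : ℝ}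
    (hε : 0 < ε) :
    ∃ δ : ℝ, 0 < δ ∧ ∀ A : Set (Δ → E d), MeasurableSet A →
      ((freeField b Q).map Δ.restrict).real A ≤ δ → ∀ Λ : Finset (Lat b), Λ.Nonempty →
        (averagedGibbs H Q Λ).real (Δ.restrict ⁻¹' A) ≤ ε := by
  obtain ⟨K, hK, hG⟩ := exists_freeGibbs_le (b := b) (Q := Q) h1 h2 h4
  obtain ⟨n, hn⟩ := exists_sum_measureReal_shift_le (Q := Q) Δ
  -- `t` and `δ` are chosen so that `n * K ≤ t * ε / 2` and `exp t * δ = t * ε / 2`.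
  set t : ℝ := 2 * (n * K) / ε + 1
  have ht : 0 < t := by positivity
  refine ⟨Real.exp (-t) * (t * ε / 2), by positivity, fun A hA hAδ Λ hΛ => ?_⟩
  have := isProbabilityMeasure_freeGibbs (Q := Q) h1 h2 h4 Λ
  rw [map_measureReal_apply (Finset.measurable_restrict Δ) hA] at hAδ
  have hcard : (0 : ℝ) < Λ.card := by exact_mod_cast hΛ.card_pos
  have hnK : n * K ≤ t * ε / 2 := by
    have : t * ε = 2 * (n * K) + ε := by simp only [t]; field_simp
    linarith
  have hexp : Real.exp t * (freeField b Q).real (Δ.restrict ⁻¹' A) ≤ t * ε / 2 := by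
    calc Real.exp t * (freeField b Q).real (Δ.restrict ⁻¹' A)
        ≤ Real.exp t * (Real.exp (-t) * (t * ε / 2)) := by gcongr
      _ = t * ε / 2 := by rw [← mul_assoc, ← Real.exp_add]; simp
  have hsum : t * ∑ k ∈ Λ, (freeGibbs H Q Λ).real (shift k ⁻¹' (Δ.restrict ⁻¹' A)) ≤
      t * (Λ.card * ε) := by
    refine (hn _ _ (hG Λ) Λ A hA t).trans ?_
    nlinarith
  rw [measureReal_def, averagedGibbs_apply (Finset.measurable_restrict Δ hA), ENNReal.toReal_mul,
    ENNReal.toReal_sum fun k _ => measure_ne_top _ _, ENNReal.toReal_inv, ENNReal.toReal_natCast,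
    inv_mul_le_iff₀ hcard]
  exact le_of_mul_le_mul_left hsum ht

end

/-! ### Følner sequences -/

section

variable {L : Type*} [AddCommGroup L]

open scoped Classical in
/-- The points of `Λ` at which the window `Γ` leaves `Λ`. -/
def exitPoints (Γ Λ : Finset L) : Finset L :=
  Λ.filter fun k => ∃ i ∈ Γ, i + k ∉ Λ

/-- The proportion of the points of `Λ` at which the window `Γ` leaves `Λ`. -/
def exitRatio (Γ Λ : Finset L) : ℝ≥0∞ :=
  (Λ.card : ℝ≥0∞)⁻¹ * (exitPoints Γ Λ).card

/-- A Følner sequence: nonempty finite sets most of whose points are far from the boundary. It is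
stated with windows rather than with symmetric differences. -/
structure IsFolner (Λ : ℕ → Finset L) : Prop where
  nonempty : ∀ n, (Λ n).Nonempty
  tendsto_exitRatio : ∀ Γ, Tendsto (fun n => exitRatio Γ (Λ n)) atTop (𝓝 0)

theorem IsFolner.comp {Λ : ℕ → Finset L} (hΛ : IsFolner Λ) {φ : ℕ → ℕ} (hφ : StrictMono φ) :
    IsFolner (Λ ∘ φ) :=
  ⟨fun n => hΛ.nonempty (φ n), fun Γ => (hΛ.tendsto_exitRatio Γ).comp hφ.tendsto_atTop⟩

theorem card_exitPoints_add_card_le {Γ Λ Λ' : Finset L} (hΛ' : Λ' ⊆ Λ)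
    (h : ∀ k ∈ Λ', ∀ i ∈ Γ, i + k ∈ Λ) : (exitPoints Γ Λ).card + Λ'.card ≤ Λ.card := by
  classical
  have hsub : exitPoints Γ Λ ⊆ Λ \ Λ' := by
    intro k hk
    obtain ⟨hk, i, hi, hik⟩ := Finset.mem_filter.1 hk
    exact Finset.mem_sdiff.2 ⟨hk, fun hk' => hik (h k hk' i hi)⟩
  have := Finset.card_le_card hsub
  rw [Finset.card_sdiff_of_subset hΛ'] at this
  have := Finset.card_le_card hΛ'
  omega

theorem tendsto_sub_const_div_natCast_pow (c : ℝ) (m : ℕ) :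
    Tendsto (fun n : ℕ => ((n - c) / n) ^ m) atTop (𝓝 1) := by
  have h : Tendsto (fun n : ℕ => 1 - c / n) atTop (𝓝 (1 - 0)) :=
    (tendsto_const_div_atTop_nhds_zero_nat c).const_sub 1
  rw [sub_zero] at h
  rw [← one_pow m]
  refine (h.congr' ?_).pow m
  filter_upwards [eventually_gt_atTop 0] with n hn
  field_simp

theorem exitRatio_map_le {L' : Type*} [AddCommGroup L'] (e : L ≃+ L') (Γ : Finset L')
    (Λ : Finset L) :
    exitRatio Γ (Λ.map e.toEquiv.toEmbedding) ≤
      exitRatio (Γ.map e.symm.toEquiv.toEmbedding) Λ := by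
  classical
  have hsub : exitPoints Γ (Λ.map e.toEquiv.toEmbedding) ⊆
      (exitPoints (Γ.map e.symm.toEquiv.toEmbedding) Λ).map e.toEquiv.toEmbedding := by
    intro k hk
    obtain ⟨hk, i, hi, hik⟩ := Finset.mem_filter.1 hk
    rw [Finset.mem_map_equiv] at hk hik ⊢
    refine Finset.mem_filter.2 ⟨hk, e.symm i, Finset.mem_map_of_mem _ hi, ?_⟩
    exact fun h => hik ((map_add e.symm i k).symm ▸ h)
  rw [exitRatio, exitRatio, Finset.card_map]
  gcongr
  exact (Finset.card_le_card hsub).trans (Finset.card_map _).le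

theorem IsFolner.map {L' : Type*} [AddCommGroup L'] (e : L ≃+ L') {Λ : ℕ → Finset L}
    (hΛ : IsFolner Λ) : IsFolner fun n => (Λ n).map e.toEquiv.toEmbedding :=
  ⟨fun n => (hΛ.nonempty n).map, fun _ => tendsto_of_tendsto_of_tendsto_of_le_of_le
    tendsto_const_nhds (hΛ.tendsto_exitRatio _) (fun _ => zero_le) fun _ => exitRatio_map_le e _ _⟩

theorem exitRatio_piFinset_le {J : Type*} [Fintype J] [DecidableEq J] {Γ : Finset (J → ℤ)} {N n : ℕ}
    (hN : ∀ i ∈ Γ, ∀ j, |i j| ≤ N) (hn : 2 * N < n) :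
    exitRatio Γ (Fintype.piFinset fun _ => Finset.Ico 0 (n : ℤ)) ≤
      ENNReal.ofReal (1 - ((n - 2 * N) / n) ^ Fintype.card J) := by
  have hcard := card_exitPoints_add_card_le (Γ := Γ)
    (Λ := Fintype.piFinset fun _ => Finset.Ico 0 (n : ℤ))
    (Λ' := Fintype.piFinset fun _ => Finset.Ico (N : ℤ) (n - N))
    (Fintype.piFinset_subset _ _ fun _ => Finset.Ico_subset_Ico (by omega) (by omega))
    (fun k hk i hi => Fintype.mem_piFinset.2 fun j => by
      have := Finset.mem_Ico.1 (Fintype.mem_piFinset.1 hk j)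
      have := abs_le.1 (hN i hi j)
      rw [Pi.add_apply, Finset.mem_Ico]
      omega)
  have hcube (p q : ℤ) : (Fintype.piFinset fun _ : J => Finset.Ico p q).card =
      (q - p).toNat ^ Fintype.card J := by simp
  rw [hcube, hcube, sub_zero, Int.toNat_natCast,
    show ((n : ℤ) - N - N).toNat = n - 2 * N by omega] at hcard
  have hcard' : ((exitPoints Γ (Fintype.piFinset fun _ => Finset.Ico 0 (n : ℤ))).card : ℝ) +
      (n - 2 * N) ^ Fintype.card J ≤ n ^ Fintype.card J := by
    have : ((n - 2 * N : ℕ) : ℝ) = n - 2 * N := by push_cast [hn.le]; ring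
    rw [← this]
    exact_mod_cast hcard
  have hpow : (0 : ℝ) < n ^ Fintype.card J := by
    have : 0 < n := by omega
    positivity
  rw [exitRatio, hcube, sub_zero, Int.toNat_natCast,
    ← ENNReal.ofReal_natCast, ← ENNReal.ofReal_natCast, Nat.cast_pow,
    ← ENNReal.ofReal_inv_of_pos hpow, ← ENNReal.ofReal_mul (by positivity), div_pow]
  refine ENNReal.ofReal_le_ofReal ?_
  rw [inv_mul_le_iff₀ hpow, mul_sub, mul_one, mul_div_cancel₀ _ hpow.ne']
  linarith

theorem isFolner_piFinset (J : Type*) [Fintype J] [DecidableEq J] :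
    IsFolner fun n : ℕ => Fintype.piFinset fun _ : J => Finset.Ico 0 ((n + 1 : ℕ) : ℤ) := by
  refine ⟨fun n => ⟨0, Fintype.mem_piFinset.2 fun _ => by simp⟩, fun Γ => ?_⟩
  obtain ⟨N, hN⟩ := exists_forall_abs_le Γ id
  refine (tendsto_add_atTop_iff_nat
    (f := fun n : ℕ => exitRatio Γ (Fintype.piFinset fun _ => Finset.Ico 0 (n : ℤ))) 1).2 ?_
  refine tendsto_of_tendsto_of_tendsto_of_le_of_le' tendsto_const_nhds ?_
    (Eventually.of_forall fun _ => zero_le)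
    ((eventually_gt_atTop (2 * N)).mono fun n hn => exitRatio_piFinset_le hN hn)
  simpa using ENNReal.tendsto_ofReal
    ((tendsto_sub_const_div_natCast_pow (2 * N) (Fintype.card J)).const_sub 1)

variable (L) in
theorem exists_isFolner [Module.Free ℤ L] [Module.Finite ℤ L] :
    ∃ Λ : ℕ → Finset L, IsFolner Λ := by
  classical
  exact ⟨_, (isFolner_piFinset _).map (Module.Free.chooseBasis ℤ L).equivFun.symm.toAddEquiv⟩

end

/-! ### Local limits -/

theorem tendsto_lintegral_of_tendsto_preimage {Ω : Type*} [MeasurableSpace Ω]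
    {μs : ℕ → Measure Ω} [∀ n, IsProbabilityMeasure (μs n)] {μ : Measure Ω}
    [IsProbabilityMeasure μ] {f : Ω → ℝ≥0∞} (hf : Measurable f) {C : NNReal} (hfC : ∀ x, f x ≤ C)
    (h : ∀ s, MeasurableSet s → Tendsto (fun n => μs n (f ⁻¹' s)) atTop (𝓝 (μ (f ⁻¹' s)))) :
    Tendsto (fun n => ∫⁻ x, f x ∂μs n) atTop (𝓝 (∫⁻ x, f x ∂μ)) := by
  let law (ν : Measure Ω) [IsProbabilityMeasure ν] : ProbabilityMeasure ℝ≥0∞ :=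
    ⟨ν.map f, Measure.isProbabilityMeasure_map hf.aemeasurable⟩
  have hlaw : Tendsto (fun n => law (μs n)) atTop (𝓝 (law μ)) := by
    refine tendsto_of_forall_isClosed_limsup_le' fun F hF => ?_
    simp only [law, ProbabilityMeasure.coe_mk, Measure.map_apply hf hF.measurableSet]
    exact (h F hF.measurableSet).limsup_eq.le
  let trunc : BoundedContinuousFunction ℝ≥0∞ NNReal :=
    BoundedContinuousFunction.mkOfCompact ⟨fun y => (min y C).toNNReal,
      ENNReal.continuousOn_toNNReal.comp_continuous (by fun_prop)
        fun y => ((min_le_right y _).trans_lt ENNReal.coe_lt_top).ne⟩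
  have hint (ν : Measure Ω) [IsProbabilityMeasure ν] :
      ∫⁻ y, trunc y ∂(law ν : Measure ℝ≥0∞) = ∫⁻ x, f x ∂ν := by
    rw [ProbabilityMeasure.coe_mk, lintegral_map (by fun_prop) hf]
    refine lintegral_congr fun x => ?_
    change (((min (f x) C).toNNReal : NNReal) : ℝ≥0∞) = f x
    rw [min_eq_left (hfC x), ENNReal.coe_toNNReal ((hfC x).trans_lt ENNReal.coe_lt_top).ne]
  simpa only [hint] using
    ProbabilityMeasure.tendsto_iff_forall_lintegral_tendsto.1 hlaw trunc

section

variable {L X : Type*} [MeasurableSpace X]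

/-- Convergence of the probabilities of all events depending on finitely many coordinates. -/
def TendstoLocally (μs : ℕ → Measure (L → X)) (P : Measure (L → X)) : Prop :=
  ∀ (Γ : Finset L) (A : Set (Γ → X)), MeasurableSet A →
    Tendsto (fun n => μs n (Γ.restrict ⁻¹' A)) atTop (𝓝 (P (Γ.restrict ⁻¹' A)))

/-- On each finite set of coordinates, the marginals of the `μs n` are absolutely continuous with
respect to that of `ρ`, uniformly in `n`. -/
def LocallyEquicontinuous (μs : ℕ → Measure (L → X)) (ρ : Measure (L → X)) : Prop :=
  ∀ (Γ : Finset L) (ε : ℝ≥0∞), ε ≠ 0 → ∃ δ, δ ≠ 0 ∧ ∀ A : Set (Γ → X), MeasurableSet A →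
    ρ (Γ.restrict ⁻¹' A) ≤ δ → ∀ n, μs n (Γ.restrict ⁻¹' A) ≤ ε

theorem exists_eq_comp_restrict_of_dependsOn [Nonempty X] {β : Type*} {f : (L → X) → β}
    {Γ : Finset L} (hf : DependsOn f Γ) :
    ∃ e : (Γ → X) → L → X, Measurable e ∧ f = (f ∘ e) ∘ Γ.restrict := by
  classical
  refine ⟨fun y i => if h : i ∈ Γ then y ⟨i, h⟩ else Classical.arbitrary X,
    measurable_pi_lambda _ fun i => ?_, funext fun x => hf fun i hi => ?_⟩
  · by_cases h : i ∈ Γ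
    · simp only [h, dif_pos]
      exact measurable_pi_apply _
    · simp only [h, dif_neg, not_false_eq_true]
      exact measurable_const
  · simp [Finset.mem_coe.1 hi]

variable {μs : ℕ → Measure (L → X)} {P ρ : Measure (L → X)}

theorem TendstoLocally.measure [Nonempty X] (h : TendstoLocally μs P) {A : Set (L → X)}
    (hA : MeasurableSet A) {Γ : Finset L} (hAΓ : DependsOn (· ∈ A) (Γ : Set L)) :
    Tendsto (fun n => μs n A) atTop (𝓝 (P A)) := by
  obtain ⟨e, he, hfe⟩ := exists_eq_comp_restrict_of_dependsOn hAΓ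
  have : A = Γ.restrict ⁻¹' (e ⁻¹' A) := Set.ext fun x => iff_of_eq (congrFun hfe x)
  rw [this]
  exact h Γ _ (he hA)

theorem TendstoLocally.lintegral [Nonempty X] [∀ n, IsProbabilityMeasure (μs n)]
    [IsProbabilityMeasure P] (h : TendstoLocally μs P) {f : (L → X) → ℝ≥0∞} (hf : Measurable f)
    {C : NNReal} (hfC : ∀ x, f x ≤ C) {Γ : Finset L} (hfΓ : DependsOn f Γ) :
    Tendsto (fun n => ∫⁻ x, f x ∂μs n) atTop (𝓝 (∫⁻ x, f x ∂P)) :=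
  tendsto_lintegral_of_tendsto_preimage hf hfC fun s hs =>
    h.measure (hf hs) (Γ := Γ) fun _ _ hxy => by simp only [Set.mem_preimage, hfΓ hxy]

theorem LocallyEquicontinuous.comp (h : LocallyEquicontinuous μs ρ) (φ : ℕ → ℕ) :
    LocallyEquicontinuous (fun n => μs (φ n)) ρ := fun Γ ε hε =>
  (h Γ ε hε).imp fun _ hδ => ⟨hδ.1, fun A hA hAδ n => hδ.2 A hA hAδ (φ n)⟩

variable [TopologicalSpace X] [PolishSpace X] [BorelSpace X]

theorem LocallyEquicontinuous.exists_isCompact [IsFiniteMeasure ρ]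
    (h : LocallyEquicontinuous μs ρ) (i : L) {ε : ℝ≥0∞} (hε : ε ≠ 0) :
    ∃ K, IsCompact K ∧ ∀ n, μs n {x | x i ∉ K} ≤ ε := by
  obtain ⟨δ, hδ, hac⟩ := h {i} ε hε
  obtain ⟨K, hK, hρK⟩ := isTightMeasureSet_iff_exists_isCompact_measure_compl_le.1
    (isTightMeasureSet_singleton (μ := ρ.map fun x => x i)) δ (pos_iff_ne_zero.2 hδ)
  refine ⟨K, hK, hac {y | y ⟨i, Finset.mem_singleton_self i⟩ ∉ K}
    (hK.measurableSet.compl.preimage (measurable_pi_apply _)) ?_⟩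
  have := hρK _ rfl
  rwa [Measure.map_apply (measurable_pi_apply i) hK.measurableSet.compl] at this

variable [Countable L]

theorem LocallyEquicontinuous.exists_isCompact_pi [IsFiniteMeasure ρ]
    (h : LocallyEquicontinuous μs ρ) {ε : ℝ≥0∞} (hε : ε ≠ 0) :
    ∃ K : Set (L → X), IsCompact K ∧ ∀ n, μs n Kᶜ ≤ ε := by
  obtain ⟨ε', hε', hsum⟩ := ENNReal.exists_pos_sum_of_countable' hε L
  choose K hK hμK using fun i => h.exists_isCompact i (hε' i).ne'
  refine ⟨Set.univ.pi K, isCompact_univ_pi hK, fun n => ?_⟩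
  have hcompl : (Set.univ.pi K)ᶜ = ⋃ i, {x | x i ∉ K i} := by
    ext x
    simp [Set.mem_pi]
  calc μs n (Set.univ.pi K)ᶜ ≤ ∑' i, μs n {x | x i ∉ K i} := hcompl ▸ measure_iUnion_le _
    _ ≤ ∑' i, ε' i := ENNReal.tsum_le_tsum fun i => hμK i n
    _ ≤ ε := hsum.le

theorem LocallyEquicontinuous.limsup_le [IsFiniteMeasure ρ] (h : LocallyEquicontinuous μs ρ)
    (hP : ∀ F, IsClosed F → limsup (fun n => μs n F) atTop ≤ P F) (Γ : Finset L) {A : Set (Γ → X)}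
    (hA : MeasurableSet A) :
    limsup (fun n => μs n (Γ.restrict ⁻¹' A)) atTop ≤ P (Γ.restrict ⁻¹' A) := by
  refine ENNReal.le_of_forall_pos_le_add fun ε hε _ => ?_
  obtain ⟨δ, hδ, hac⟩ := h Γ ε (by simpa using hε.ne')
  obtain ⟨F, hFA, hF, hdiff⟩ := hA.exists_isClosed_sdiff_lt (μ := ρ.map Γ.restrict)
    (measure_ne_top _ _) hδ
  have hrestrict : Measurable (Γ.restrict : (L → X) → _) := Finset.measurable_restrict Γ
  have hAF := hA.diff hF.measurableSet
  have hsmall := hac (A \ F) hAF (Measure.map_apply hrestrict hAF ▸ hdiff.le)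
  calc limsup (fun n => μs n (Γ.restrict ⁻¹' A)) atTop
      ≤ limsup (fun n => μs n (Γ.restrict ⁻¹' F) + ε) atTop := by
        refine limsup_le_limsup (Eventually.of_forall fun n => ?_)
        rw [← Set.union_sdiff_cancel hFA, Set.preimage_union]
        exact (measure_union_le _ _).trans (add_le_add le_rfl (hsmall n))
    _ ≤ limsup (fun n => μs n (Γ.restrict ⁻¹' F)) atTop + ε :=
        (limsup_add_const atTop _ (ε : ℝ≥0∞) (by isBoundedDefault) (by isBoundedDefault)).le
    _ ≤ P (Γ.restrict ⁻¹' A) + ε := by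
        gcongr
        exact (hP _ (hF.preimage (by fun_prop))).trans (measure_mono (Set.preimage_mono hFA))

theorem LocallyEquicontinuous.tendstoLocally [IsFiniteMeasure ρ]
    [∀ n, IsProbabilityMeasure (μs n)] [IsProbabilityMeasure P] (h : LocallyEquicontinuous μs ρ)
    (hP : ∀ F, IsClosed F → limsup (fun n => μs n F) atTop ≤ P F) : TendstoLocally μs P := by
  intro Γ A hA
  have hΓA : MeasurableSet (Γ.restrict ⁻¹' A : Set (L → X)) := Finset.measurable_restrict Γ hA
  have hcompl := h.limsup_le hP Γ hA.compl
  rw [Set.preimage_compl] at hcompl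
  have hliminf := le_measure_liminf_of_limsup_measure_compl_le hΓA hcompl
  exact tendsto_of_le_liminf_of_limsup_le hliminf (h.limsup_le hP Γ hA)

theorem LocallyEquicontinuous.exists_tendstoLocally {νs : ℕ → ProbabilityMeasure (L → X)}
    [IsFiniteMeasure ρ] (h : LocallyEquicontinuous (fun n => (νs n : Measure (L → X))) ρ) :
    ∃ P : ProbabilityMeasure (L → X), ∃ φ : ℕ → ℕ, StrictMono φ ∧
      TendstoLocally (fun n => (νs (φ n) : Measure (L → X))) P := by
  have htight : IsTightMeasureSet {ν | ∃ ν' ∈ Set.range νs, (ν' : Measure (L → X)) = ν} := by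
    refine isTightMeasureSet_iff_exists_isCompact_measure_compl_le.2 fun ε hε => ?_
    obtain ⟨K, hK, hμK⟩ := h.exists_isCompact_pi hε.ne'
    refine ⟨K, hK, ?_⟩
    rintro _ ⟨_, ⟨n, rfl⟩, rfl⟩
    exact hμK n
  obtain ⟨P, -, φ, hφ, hP⟩ := (isCompact_closure_of_isTightMeasureSet htight).tendsto_subseq
    fun n => subset_closure (Set.mem_range_self n)
  exact ⟨P, φ, hφ, (h.comp φ).tendstoLocally fun F hF =>
    ProbabilityMeasure.limsup_measure_closed_le_of_tendsto hP hF⟩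

end

theorem LocallyEquicontinuous.exists_norm_gt_le {L X : Type*} [NormedAddCommGroup X]
    [SecondCountableTopology X] [CompleteSpace X] [MeasurableSpace X] [BorelSpace X]
    {μs : ℕ → Measure (L → X)} {ρ : Measure (L → X)} [IsFiniteMeasure ρ]
    (h : LocallyEquicontinuous μs ρ) (i : L) {ε : ℝ≥0∞} (hε : ε ≠ 0) :
    ∃ r : ℝ, ∀ n, μs n {x | r < ‖x i‖} ≤ ε := by
  obtain ⟨K, hK, hμK⟩ := h.exists_isCompact i hε
  obtain ⟨r, hr⟩ := hK.isBounded.exists_norm_le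
  exact ⟨r, fun n => (measure_mono fun x hx hxK => (hr _ hxK).not_gt hx).trans (hμK n)⟩

/-! ### Local limits of averaged Gibbs measures -/

section

variable {d : ℕ} {b : Module.Basis (Fin d) ℝ (E d)} {H : Finset (E d) → EReal} {Q : Measure (E d)}

theorem average_le_exitRatio_add_average {L : Type*} [AddCommGroup L] (Γ Λ : Finset L)
    {f g : L → ℝ≥0∞} (hf : ∀ k ∈ Λ, f k ≤ 1) (hfg : ∀ k ∈ Λ, (∀ i ∈ Γ, i + k ∈ Λ) → f k ≤ g k) :
    (Λ.card : ℝ≥0∞)⁻¹ * ∑ k ∈ Λ, f k ≤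
      exitRatio Γ Λ + (Λ.card : ℝ≥0∞)⁻¹ * ∑ k ∈ Λ, g k := by
  classical
  rw [exitRatio, ← mul_add]
  gcongr
  have hle : ∀ k ∈ Λ, f k ≤ (if k ∈ exitPoints Γ Λ then 1 else 0) + g k := by
    intro k hk
    split_ifs with hexit
    · exact (hf k hk).trans le_self_add
    · rw [zero_add]
      refine hfg k hk fun i hi => ?_
      by_contra h
      exact hexit (Finset.mem_filter.2 ⟨hk, i, hi, h⟩)
  have hcard : ∑ k ∈ Λ, (if k ∈ exitPoints Γ Λ then 1 else 0 : ℝ≥0∞) = (exitPoints Γ Λ).card := by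
    have hsub : exitPoints Γ Λ ⊆ Λ := Finset.filter_subset _ _
    rw [Finset.sum_boole, Finset.filter_mem_eq_inter, Finset.inter_eq_right.2 hsub]
  calc ∑ k ∈ Λ, f k ≤ ∑ k ∈ Λ, ((if k ∈ exitPoints Γ Λ then 1 else 0) + g k) :=
        Finset.sum_le_sum hle
    _ = (exitPoints Γ Λ).card + ∑ k ∈ Λ, g k := by rw [Finset.sum_add_distrib, hcard]

theorem locallyEquicontinuous_averagedGibbs [IsProbabilityMeasure Q] (h1 : Stable H)
    (h2 : NonDegenerate b H) (h4 : TranslationInvariant H) {Λ : ℕ → Finset (Lat b)}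
    (hΛ : ∀ n, (Λ n).Nonempty) :
    LocallyEquicontinuous (fun n => averagedGibbs H Q (Λ n)) (freeField b Q) := by
  intro Γ ε hε
  have hε1 : min ε 1 ≠ ⊤ := ne_top_of_le_ne_top ENNReal.one_ne_top (min_le_right ε 1)
  have hε0 : 0 < (min ε 1).toReal :=
    ENNReal.toReal_pos (lt_min hε.bot_lt one_pos).ne' hε1
  obtain ⟨δ, hδ, hac⟩ := averagedGibbs_uniform_absolutelyContinuous (Q := Q) h1 h2 h4 Γ hε0
  refine ⟨ENNReal.ofReal δ, by simpa using hδ, fun A hA hAδ n => ?_⟩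
  have := isProbabilityMeasure_freeGibbs (Q := Q) h1 h2 h4 (Λ n)
  have := isProbabilityMeasure_averagedGibbs (H := H) (Q := Q) (hΛ n)
  refine le_trans ?_ (min_le_left ε 1)
  rw [← ENNReal.toReal_le_toReal (measure_ne_top _ _) hε1]
  refine hac A hA ?_ (Λ n) (hΛ n)
  rw [map_measureReal_apply (Finset.measurable_restrict Γ) hA]
  exact ENNReal.toReal_le_of_le_ofReal hδ.le hAδ

theorem shift_shift (j k : Lat b) (x : Field b) : shift j (shift k x) = shift (j + k) x := by
  ext1 i
  simp only [shift, add_assoc]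

theorem averagedGibbs_shift_le {Λ : Finset (Lat b)} [IsProbabilityMeasure (freeGibbs H Q Λ)]
    (j : Lat b) {A : Set (Field b)} (hA : MeasurableSet A) :
    averagedGibbs H Q Λ (shift j ⁻¹' A) ≤ exitRatio {j} Λ + averagedGibbs H Q Λ A := by
  classical
  have hcomp : ∀ k : Lat b, shift k ⁻¹' (shift j ⁻¹' A) = shift (j + k) ⁻¹' A := fun k =>
    Set.ext fun x => by simp only [Set.mem_preimage, shift_shift]
  rw [averagedGibbs_apply (measurable_shift j hA), averagedGibbs_apply hA]
  simp only [hcomp]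
  refine (average_le_exitRatio_add_average {j} Λ (g := fun k =>
    if j + k ∈ Λ then freeGibbs H Q Λ (shift (j + k) ⁻¹' A) else 0)
    (fun k _ => prob_le_one) fun k _ hjk => ?_).trans ?_
  · rw [if_pos (hjk j (Finset.mem_singleton_self j))]
  · refine add_le_add le_rfl (mul_le_mul' le_rfl ?_)
    rw [← Finset.sum_filter]
    refine (Finset.sum_map (Λ.filter fun k => j + k ∈ Λ) (Equiv.addLeft j).toEmbedding
      fun k => freeGibbs H Q Λ (shift k ⁻¹' A)).ge.trans ?_
    refine Finset.sum_le_sum_of_subset fun k hk => ?_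
    obtain ⟨k', hk', rfl⟩ := Finset.mem_map.1 hk
    exact (Finset.mem_filter.1 hk').2

theorem measure_ext_of_cylinders {ι : Type*} {X : ι → Type*} [∀ i, MeasurableSpace (X i)]
    {μ ν : Measure (∀ i, X i)} [IsFiniteMeasure μ]
    (h : ∀ B ∈ measurableCylinders X, μ B = ν B) : μ = ν :=
  ext_of_generate_finite _ generateFrom_measurableCylinders.symm isPiSystem_measurableCylinders h
    (h _ (univ_mem_measurableCylinders X))

theorem TendstoLocally.ae_mem {L X : Type*} [MeasurableSpace X] [Nonempty X] [Countable L]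
    {μs : ℕ → Measure (L → X)} {P : Measure (L → X)} (hP : TendstoLocally μs P) {S : Set X}
    (hS : MeasurableSet S) (h : ∀ n i, ∀ᵐ x ∂μs n, x i ∈ S) : ∀ᵐ x ∂P, ∀ i, x i ∈ S := by
  refine ae_all_iff.2 fun i => ?_
  have hlim := hP.measure (A := {x | x i ∉ S}) (hS.compl.preimage (measurable_pi_apply i))
    (Γ := {i}) fun x y hxy => by simp only [Set.mem_ofPred_eq, hxy i (by simp)]
  simp only [ae_iff] at h ⊢
  simp only [h] at hlim
  exact tendsto_nhds_unique hlim tendsto_const_nhds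

variable {Λ : ℕ → Finset (Lat b)} {P : Measure (Field b)}

theorem TendstoLocally.measure_shift_preimage_le
    [∀ n, IsProbabilityMeasure (freeGibbs H Q (Λ n))] (hΛ : IsFolner Λ)
    (hP : TendstoLocally (fun n => averagedGibbs H Q (Λ n)) P) (j : Lat b) (Γ : Finset (Lat b))
    {A : Set (Γ → E d)} (hA : MeasurableSet A) :
    P (shift j ⁻¹' (Γ.restrict ⁻¹' A)) ≤ P (Γ.restrict ⁻¹' A) := by
  have hΓA : MeasurableSet (Γ.restrict ⁻¹' A : Set (Field b)) := Finset.measurable_restrict Γ hA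
  have hshift := hP.measure (Γ := Γ.map (Equiv.addRight j).toEmbedding)
    (measurable_shift j hΓA) fun x y hxy => by
      have : Γ.restrict (shift j x) = Γ.restrict (shift j y) := by
        ext1 i
        exact hxy _ (by simp)
      simp only [Set.mem_preimage, this]
  have hbound := (hΛ.tendsto_exitRatio {j}).add (hP Γ A hA)
  rw [zero_add] at hbound
  exact le_of_tendsto_of_tendsto' hshift hbound fun n => averagedGibbs_shift_le j hΓA

theorem TendstoLocally.map_shift [IsProbabilityMeasure P]
    [∀ n, IsProbabilityMeasure (freeGibbs H Q (Λ n))] (hΛ : IsFolner Λ)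
    (hP : TendstoLocally (fun n => averagedGibbs H Q (Λ n)) P) (j : Lat b) :
    P.map (shift j) = P := by
  have := Measure.isProbabilityMeasure_map (μ := P) (measurable_shift j).aemeasurable
  refine measure_ext_of_cylinders fun B hB => ?_
  obtain ⟨Γ, A, hA, rfl⟩ := (mem_measurableCylinders _).1 hB
  have hΓA : MeasurableSet (Γ.restrict ⁻¹' A : Set (Field b)) := Finset.measurable_restrict Γ hA
  rw [Measure.map_apply (measurable_shift j) hA.cylinder]
  refine le_antisymm (hP.measure_shift_preimage_le hΛ j Γ hA) ?_
  have hcompl := hP.measure_shift_preimage_le hΛ j Γ hA.compl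
  rw [Set.preimage_compl, Set.preimage_compl, prob_compl_eq_one_sub hΓA,
    prob_compl_eq_one_sub (measurable_shift j hΓA)] at hcompl
  exact (ENNReal.sub_le_sub_iff_left prob_le_one ENNReal.one_ne_top).1 hcompl

theorem Hereditary.mono (h3 : Hereditary H) {γ γ' : Finset (E d)} (h : γ ⊆ γ') (hγ : H γ = ⊤) :
    H γ' = ⊤ := by
  classical
  rw [← Finset.union_sdiff_of_subset h]
  induction γ' \ γ using Finset.induction_on with
  | empty => rwa [Finset.union_empty]
  | insert x s _ ih =>
    rw [Finset.union_insert]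
    convert h3 _ ih x

theorem ae_freeGibbs_energy_ne_top (hH : IsHamiltonian H) (h3 : Hereditary H)
    {Γ Λ : Finset (Lat b)} (h : Γ ⊆ Λ) : ∀ᵐ x ∂freeGibbs H Q Λ, H (points Γ x) ≠ ⊤ := by
  refine Measure.ae_smul_measure ?_ _
  rw [ae_withDensity_iff (measurable_boltzmann hH Λ)]
  refine Eventually.of_forall fun x hx htop => hx ?_
  rw [boltzmann, h3.mono (points_mono h x) htop]
  simp

theorem averagedGibbs_energy_eq_top_le (hH : IsHamiltonian H) (h3 : Hereditary H)
    (h4 : TranslationInvariant H) [IsProbabilityMeasure Q] (Γ Λ : Finset (Lat b))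
    [IsProbabilityMeasure (freeGibbs H Q Λ)] :
    averagedGibbs H Q Λ {x | H (points Γ x) = ⊤} ≤ exitRatio Γ Λ := by
  have hm : MeasurableSet {x : Field b | H (points Γ x) = ⊤} :=
    hH.measurable_comp_points Γ (measurableSet_singleton ⊤)
  rw [averagedGibbs_apply hm]
  refine (average_le_exitRatio_add_average Γ Λ (g := fun _ => 0) (fun k _ => prob_le_one)
    fun k _ hΓk => ?_).trans (by simp)
  rw [← Measure.map_apply (measurable_shift k) hm, freeGibbs_map_shift hH h4]
  have := ae_freeGibbs_energy_ne_top (Q := Q) hH h3 fun i hi => mem_translateBox.2 (hΓk i hi)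
  simpa [ae_iff] using this

theorem TendstoLocally.ae_energy_ne_top (hH : IsHamiltonian H) (h3 : Hereditary H)
    (h4 : TranslationInvariant H) [IsProbabilityMeasure Q]
    [∀ n, IsProbabilityMeasure (freeGibbs H Q (Λ n))] (hΛ : IsFolner Λ)
    (hP : TendstoLocally (fun n => averagedGibbs H Q (Λ n)) P) :
    ∀ᵐ x ∂P, ∀ Γ : Finset (Lat b), H (points Γ x) ≠ ⊤ := by
  refine ae_all_iff.2 fun Γ => ?_
  have hlim := hP.measure (A := {x | H (points Γ x) = ⊤})
    (hH.measurable_comp_points Γ (measurableSet_singleton ⊤)) (Γ := Γ) fun x y hxy => by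
      have : points Γ x = points Γ y := Finset.image_congr fun i hi => by rw [hxy i hi]
      simp only [Set.mem_ofPred_eq, this]
  have hzero := le_of_tendsto_of_tendsto' hlim (hΛ.tendsto_exitRatio Γ) fun n =>
    averagedGibbs_energy_eq_top_le hH h3 h4 Γ (Λ n)
  simpa [ae_iff] using hzero

theorem ae_freeField_mem [IsProbabilityMeasure Q] {S : Set (E d)} (hQS : ∀ᵐ v ∂Q, v ∈ S)
    (i : Lat b) : ∀ᵐ x ∂freeField b Q, x i ∈ S :=
  (measurePreserving_eval_infinitePi (fun _ : Lat b => Q) i).quasiMeasurePreserving.ae hQS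

theorem measurableSet_norm_add_apply_le (v : E d) (i : Lat b) (R : ℝ) :
    MeasurableSet {x : Field b | ‖v + x i‖ ≤ R} :=
  measurableSet_le (by fun_prop) measurable_const

theorem freeGibbs_far_le (hH : IsHamiltonian H) (h4 : TranslationInvariant H)
    [IsProbabilityMeasure Q] (Λ : Finset (Lat b)) {Λ' : Finset (Lat b)} {r R : ℝ}
    (hΛ' : ∀ i : Lat b, ‖(i : E d)‖ ≤ r + R → i ∈ Λ') (k : Lat b) :
    freeGibbs H Q (translateBox k Λ)
        {x | ∃ i ∈ translateBox k Λ, i ∉ Λ' ∧ ‖(i : E d) + x i‖ ≤ R} ≤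
      ∑ j ∈ Λ, freeGibbs H Q Λ {x | r < ‖x j‖ ∧ ‖((j - k : Lat b) : E d) + x j‖ ≤ R} := by
  classical
  have hm : MeasurableSet {x : Field b | ∃ i ∈ translateBox k Λ, i ∉ Λ' ∧
      ‖(i : E d) + x i‖ ≤ R} := by
    have : {x : Field b | ∃ i ∈ translateBox k Λ, i ∉ Λ' ∧ ‖(i : E d) + x i‖ ≤ R} =
        ⋃ i ∈ (translateBox k Λ).filter (· ∉ Λ'), {x | ‖(i : E d) + x i‖ ≤ R} := by
      ext x
      simp [and_assoc]
    exact this ▸ Finset.measurableSet_biUnion _ fun i _ => measurableSet_norm_add_apply_le _ _ _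
  rw [← freeGibbs_map_shift hH h4, Measure.map_apply (measurable_shift k) hm]
  refine (measure_mono ?_).trans (measure_biUnion_finset_le Λ _)
  rintro x ⟨i, hi, hiΛ', hx⟩
  refine Set.mem_biUnion (mem_translateBox.1 hi) ⟨?_, ?_⟩
  · have hfar : r + R < ‖(i : E d)‖ := not_le.1 fun h => hiΛ' (hΛ' i h)
    have htri : ‖(i : E d)‖ ≤ ‖(i : E d) + x (i + k)‖ + ‖x (i + k)‖ := by
      simpa using norm_sub_le ((i : E d) + x (i + k)) (x (i + k))
    have hx : ‖(i : E d) + x (i + k)‖ ≤ R := hx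
    linarith
  · rw [add_sub_cancel_right]
    exact hx

theorem sum_measure_norm_sub_add_le (μ : Measure (Field b)) (Λ : Finset (Lat b)) (j : Lat b)
    (r R : ℝ) :
    ∑ k ∈ Λ, μ {x | r < ‖x j‖ ∧ ‖((j - k : Lat b) : E d) + x j‖ ≤ R} ≤
      latCount b (R + R) * μ {x | r < ‖x j‖} := by
  calc ∑ k ∈ Λ, μ {x | r < ‖x j‖ ∧ ‖((j - k : Lat b) : E d) + x j‖ ≤ R}
      = ∑ k ∈ Λ, μ.restrict {x | r < ‖x j‖} {x | ‖((j - k : Lat b) : E d) + x j‖ ≤ R} :=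
        Finset.sum_congr rfl fun k _ => by
          rw [Measure.restrict_apply (measurableSet_norm_add_apply_le _ j R), Set.inter_comm]
          rfl
    _ ≤ ∑' k : Lat b,
          μ.restrict {x | r < ‖x j‖} {x | ‖((j - k : Lat b) : E d) + x j‖ ≤ R} :=
        ENNReal.sum_le_tsum _
    _ = ∑' i : Lat b, μ.restrict {x | r < ‖x j‖} {x | ‖(i : E d) + x j‖ ≤ R} :=
        (Equiv.subLeft j).tsum_eq fun i : Lat b =>
          μ.restrict {x | r < ‖x j‖} {x | ‖(i : E d) + x j‖ ≤ R}
    _ ≤ latCount b (R + R) * μ.restrict {x | r < ‖x j‖} Set.univ :=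
        tsum_measure_norm_lat_add_le _ (measurable_pi_apply j) R
    _ = latCount b (R + R) * μ {x | r < ‖x j‖} := by rw [Measure.restrict_apply_univ]

theorem average_freeGibbs_far_le (hH : IsHamiltonian H) (h4 : TranslationInvariant H)
    [IsProbabilityMeasure Q] {Λ Λ' : Finset (Lat b)} {r R : ℝ}
    (hΛ' : ∀ i : Lat b, ‖(i : E d)‖ ≤ r + R → i ∈ Λ') :
    (Λ.card : ℝ≥0∞)⁻¹ * ∑ k ∈ Λ, freeGibbs H Q (translateBox k Λ)
        {x | ∃ i ∈ translateBox k Λ, i ∉ Λ' ∧ ‖(i : E d) + x i‖ ≤ R} ≤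
      latCount b (R + R) * averagedGibbs H Q Λ {x | r < ‖x 0‖} := by
  have hm : MeasurableSet {x : Field b | r < ‖x 0‖} :=
    measurableSet_lt measurable_const (by fun_prop)
  have hshift : ∀ j : Lat b, shift j ⁻¹' {x | r < ‖x 0‖} = {x : Field b | r < ‖x j‖} := fun j => by
    ext x
    simp [shift]
  rw [averagedGibbs_apply hm, mul_left_comm]
  simp only [hshift]
  refine mul_le_mul' le_rfl ?_
  calc ∑ k ∈ Λ, freeGibbs H Q (translateBox k Λ)
        {x | ∃ i ∈ translateBox k Λ, i ∉ Λ' ∧ ‖(i : E d) + x i‖ ≤ R}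
      ≤ ∑ k ∈ Λ, ∑ j ∈ Λ,
          freeGibbs H Q Λ {x | r < ‖x j‖ ∧ ‖((j - k : Lat b) : E d) + x j‖ ≤ R} :=
        Finset.sum_le_sum fun k _ => freeGibbs_far_le hH h4 Λ hΛ' k
    _ = ∑ j ∈ Λ, ∑ k ∈ Λ,
          freeGibbs H Q Λ {x | r < ‖x j‖ ∧ ‖((j - k : Lat b) : E d) + x j‖ ≤ R} :=
        Finset.sum_comm
    _ ≤ ∑ j ∈ Λ, latCount b (R + R) * freeGibbs H Q Λ {x | r < ‖x j‖} :=
        Finset.sum_le_sum fun j _ => sum_measure_norm_sub_add_le _ Λ j r R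
    _ = latCount b (R + R) * ∑ j ∈ Λ, freeGibbs H Q Λ {x | r < ‖x j‖} := by rw [Finset.mul_sum]

end

/-! ### Local weights and the finite-volume DLR equations -/

section

variable {d : ℕ} {b : Module.Basis (Fin d) ℝ (E d)} {Δ : Finset (Lat b)}

theorem glue_of_mem (x' : {i // i ∈ Δ} → E d) (y : {i // i ∉ Δ} → E d) {i : Lat b} (h : i ∈ Δ) :
    glue Δ x' y i = x' ⟨i, h⟩ := dif_pos h

theorem glue_of_notMem (x' : {i // i ∈ Δ} → E d) (y : {i // i ∉ Δ} → E d) {i : Lat b}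
    (h : i ∉ Δ) : glue Δ x' y i = y ⟨i, h⟩ := dif_neg h

theorem glue_mem {S : Set (E d)} {x' : {i // i ∈ Δ} → E d} {y : {i // i ∉ Δ} → E d}
    (hx' : ∀ i, x' i ∈ S) (hy : ∀ i, y i ∈ S) (i : Lat b) : glue Δ x' y i ∈ S := by
  unfold glue
  split
  exacts [hx' _, hy _]

theorem restrictIn_glue (x' : {i // i ∈ Δ} → E d) (y : {i // i ∉ Δ} → E d) :
    restrictIn Δ (glue Δ x' y) = x' := by
  ext1 i
  exact glue_of_mem x' y i.2

theorem restrictOut_glue (x' : {i // i ∈ Δ} → E d) (y : {i // i ∉ Δ} → E d) :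
    restrictOut Δ (glue Δ x' y) = y := by
  ext1 i
  exact glue_of_notMem x' y i.2

theorem glue_restrictIn_restrictOut (x : Field b) :
    glue Δ (restrictIn Δ x) (restrictOut Δ x) = x := by
  ext1 i
  by_cases h : i ∈ Δ
  · exact glue_of_mem _ _ h
  · exact glue_of_notMem _ _ h

theorem measurable_restrictIn : Measurable (restrictIn Δ : Field b → {i // i ∈ Δ} → E d) :=
  measurable_pi_lambda _ fun i => measurable_pi_apply (i : Lat b)

theorem measurable_restrictOut : Measurable (restrictOut Δ : Field b → {i // i ∉ Δ} → E d) :=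
  measurable_pi_lambda _ fun i => measurable_pi_apply (i : Lat b)

theorem measurable_glue :
    Measurable fun p : ({i // i ∈ Δ} → E d) × ({i // i ∉ Δ} → E d) => glue Δ p.1 p.2 := by
  refine measurable_pi_lambda _ fun i => ?_
  by_cases h : i ∈ Δ
  · simp only [glue_of_mem _ _ h]
    exact (measurable_pi_apply _).comp measurable_fst
  · simp only [glue_of_notMem _ _ h]
    exact (measurable_pi_apply _).comp measurable_snd

theorem measurable_comp_glue {F : Field b → ℝ≥0∞} (hF : Measurable F) (y : {i // i ∉ Δ} → E d) :
    Measurable fun x' : {i // i ∈ Δ} → E d => F (glue Δ x' y) :=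
  hF.comp (measurable_glue.comp (measurable_id.prodMk measurable_const))

theorem indepFun_restrictIn_restrictOut (Q : Measure (E d)) [IsProbabilityMeasure Q] :
    IndepFun (restrictIn Δ) (restrictOut Δ) (freeField b Q) := by
  have hindep : iIndepFun (fun (i : Lat b) (x : Field b) => x i) (freeField b Q) :=
    iIndepFun_infinitePi (P := fun _ : Lat b => Q) (X := fun _ => id) fun _ => measurable_id
  have hcoord : ∀ (S : Set (Lat b)) (i : S),
      Measurable[⨆ i ∈ S, MeasurableSpace.comap (fun x : Field b => x i) inferInstance]
        fun x : Field b => x i :=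
    fun S i => (comap_measurable _).mono (le_iSup₂_of_le (i : Lat b) i.2 le_rfl) le_rfl
  have hsup := indep_iSup_of_disjoint (fun i => (measurable_pi_apply i).comap_le) hindep
    (disjoint_compl_right (a := (Δ : Set (Lat b))))
  refine indep_of_indep_of_le_left (indep_of_indep_of_le_right hsup ?_) ?_
  · exact (@measurable_pi_lambda _ _ _ (_) _ _ fun i => hcoord (Δ : Set (Lat b))ᶜ i).comap_le
  · exact (@measurable_pi_lambda _ _ _ (_) _ _ fun i => hcoord (Δ : Set (Lat b)) i).comap_le

theorem freeField_eq_map_glue (Q : Measure (E d)) [IsProbabilityMeasure Q] :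
    ((Measure.pi fun _ : {i // i ∈ Δ} => Q).prod
      (Measure.infinitePi fun _ : {i // i ∉ Δ} => Q)).map (fun p => glue Δ p.1 p.2) =
      freeField b Q := by
  have hIn : (freeField b Q).map (restrictIn Δ) = Measure.pi fun _ => Q :=
    Measure.infinitePi_map_restrict _
  have hOut : (freeField b Q).map (restrictOut Δ) = Measure.infinitePi fun _ => Q :=
    Measure.infinitePi_map_restrict' (I := {i | i ∉ Δ}) _
  have hprod := (indepFun_iff_map_prod_eq_prod_map_map measurable_restrictIn.aemeasurable
    measurable_restrictOut.aemeasurable).1 (indepFun_restrictIn_restrictOut (Δ := Δ) (b := b) Q)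
  rw [hIn, hOut] at hprod
  rw [← hprod, Measure.map_map measurable_glue
    (measurable_restrictIn.prodMk measurable_restrictOut)]
  simp only [Function.comp_def, glue_restrictIn_restrictOut, Measure.map_id']

variable {H : Finset (E d) → EReal} {Q : Measure (E d)}

open scoped Classical in
/-- The energy of the points indexed by `Δ` given the other points indexed by `Λ`. -/
def increment (H : Finset (E d) → EReal) (Δ Λ : Finset (Lat b)) (x : Field b) : EReal :=
  energyDiff (H (points Λ x)) (H (points (Λ \ Δ) x))

/-- The Boltzmann weight of the points indexed by `Δ` given the other points indexed by `Λ`. -/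
def localWeight (H : Finset (E d) → EReal) (Δ Λ : Finset (Lat b)) (x : Field b) : ℝ≥0∞ :=
  EReal.exp (-increment H Δ Λ x)

/-- The Boltzmann weight of the points indexed by `Δ` given all other points. -/
def limitWeight (H : Finset (E d) → EReal) (Δ : Finset (Lat b)) (x : Field b) : ℝ≥0∞ :=
  EReal.exp (-latticeEnergy H Δ x)

theorem measurable_increment (hH : IsHamiltonian H) (Λ : Finset (Lat b)) :
    Measurable (increment H Δ Λ) := by
  classical
  have hΛ := hH.measurable_comp_points Λ
  have hΛΔ := hH.measurable_comp_points (Λ \ Δ)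
  change Measurable fun x => increment H Δ Λ x
  simp only [increment, energyDiff, sub_eq_add_neg]
  exact Measurable.ite ((hΛ (measurableSet_singleton ⊤)).inter (hΛΔ (measurableSet_singleton ⊤)))
    measurable_const (hΛ.add hΛΔ.neg)

theorem measurable_localWeight (hH : IsHamiltonian H) (Λ : Finset (Lat b)) :
    Measurable (localWeight H Δ Λ) :=
  EReal.measurable_exp.comp (measurable_increment hH Λ).neg

theorem measurable_limitWeight (hH : IsHamiltonian H) :
    Measurable (limitWeight H Δ : Field b → ℝ≥0∞) :=
  EReal.measurable_exp.comp (Measurable.limsup fun n => measurable_increment hH (box b n)).neg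

open scoped Classical in
theorem boltzmann_eq_mul_localWeight (hH : IsHamiltonian H) (h3 : Hereditary H)
    (Δ Λ : Finset (Lat b)) (x : Field b) :
    boltzmann H Λ x = boltzmann H (Λ \ Δ) x * localWeight H Δ Λ x := by
  simp only [boltzmann, localWeight, increment, energyDiff]
  have hbot := hH.ne_bot (points (Λ \ Δ) x)
  by_cases htop : H (points (Λ \ Δ) x) = ⊤
  · rw [h3.mono (points_mono Finset.sdiff_subset x) htop, htop]
    simp
  · rw [if_neg fun h => htop h.2]
    lift H (points (Λ \ Δ) x) to ℝ using ⟨htop, hbot⟩ with c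
    rw [← EReal.exp_add]
    congr 1
    induction H (points Λ x) using EReal.rec with
    | bot => simp
    | top => simp
    | coe a =>
      norm_cast
      ring

theorem points_congr {Λ : Finset (Lat b)} {x y : Field b} (h : ∀ i ∈ Λ, x i = y i) :
    points Λ x = points Λ y :=
  Finset.image_congr fun i hi => by rw [h i hi]

open scoped Classical in
theorem points_sdiff_glue (Λ : Finset (Lat b)) (x' x'' : {i // i ∈ Δ} → E d)
    (y : {i // i ∉ Δ} → E d) :
    points (Λ \ Δ) (glue Δ x' y) = points (Λ \ Δ) (glue Δ x'' y) :=
  points_congr fun i hi => by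
    have hi := (Finset.mem_sdiff.1 hi).2
    rw [glue_of_notMem _ _ hi, glue_of_notMem _ _ hi]

open scoped Classical in
theorem boltzmann_glue (hH : IsHamiltonian H) (h3 : Hereditary H) (Λ : Finset (Lat b))
    (x' : {i // i ∈ Δ} → E d) (y : {i // i ∉ Δ} → E d) :
    boltzmann H Λ (glue Δ x' y) =
      boltzmann H (Λ \ Δ) (glue Δ 0 y) * localWeight H Δ Λ (glue Δ x' y) := by
  rw [boltzmann_eq_mul_localWeight hH h3 Δ, boltzmann, boltzmann, points_sdiff_glue Λ x' 0]

open scoped Classical in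
theorem lintegral_freeGibbs [IsProbabilityMeasure Q] (hH : IsHamiltonian H) (h3 : Hereditary H)
    (Λ : Finset (Lat b)) {F : Field b → ℝ≥0∞} (hF : Measurable F) :
    ∫⁻ x, F x ∂freeGibbs H Q Λ = (freePartition H Q Λ)⁻¹ *
      ∫⁻ y, boltzmann H (Λ \ Δ) (glue Δ 0 y) *
        ∫⁻ x', localWeight H Δ Λ (glue Δ x' y) * F (glue Δ x' y)
          ∂(Measure.pi fun _ : {i // i ∈ Δ} => Q)
        ∂(Measure.infinitePi fun _ : {i // i ∉ Δ} => Q) := by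
  have hb := measurable_boltzmann hH Λ
  have hw := measurable_localWeight (Δ := Δ) hH Λ
  rw [freeGibbs, lintegral_smul_measure, smul_eq_mul,
    lintegral_withDensity_eq_lintegral_mul _ hb hF, ← freeField_eq_map_glue (Δ := Δ) Q,
    lintegral_map (hb.mul hF) measurable_glue,
    lintegral_prod_symm (fun p => (boltzmann H Λ * F) (glue Δ p.1 p.2))
      ((hb.mul hF).comp measurable_glue).aemeasurable]
  congr 1
  refine lintegral_congr fun y => ?_
  have hy := measurable_comp_glue (hw.mul hF) y
  simp only [Pi.mul_apply] at hy
  rw [← lintegral_const_mul _ hy]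
  exact lintegral_congr fun x' => by rw [Pi.mul_apply, boltzmann_glue hH h3, mul_assoc]

/-- The mass of the configurations `x' ∈ A` in `Δ`, for the weight `W` and the configuration `y`
off `Δ`. -/
def windowMass (Q : Measure (E d)) (W : Field b → ℝ≥0∞) (A : Set ({i // i ∈ Δ} → E d))
    (y : {i // i ∉ Δ} → E d) : ℝ≥0∞ :=
  ∫⁻ x' in A, W (glue Δ x' y) ∂(Measure.pi fun _ : {i // i ∈ Δ} => Q)

/-- The probability of `A` given `T`, for the weight `W` and the configuration `y` off `Δ`. It is
meant for `T` of positive finite mass, and is `0` for `T` of mass `0` or `∞`. -/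
def windowProb (Q : Measure (E d)) (W : Field b → ℝ≥0∞) (T A : Set ({i // i ∈ Δ} → E d))
    (y : {i // i ∉ Δ} → E d) : ℝ≥0∞ :=
  (windowMass Q W T y)⁻¹ * windowMass Q W (A ∩ T) y

theorem measurable_windowMass [IsProbabilityMeasure Q] {W : Field b → ℝ≥0∞} (hW : Measurable W)
    (A : Set ({i // i ∈ Δ} → E d)) : Measurable (windowMass Q W A) :=
  (hW.comp measurable_glue).lintegral_prod_left'

theorem measurable_windowProb [IsProbabilityMeasure Q] {W : Field b → ℝ≥0∞} (hW : Measurable W)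
    (T A : Set ({i // i ∈ Δ} → E d)) : Measurable (windowProb Q W T A) :=
  (measurable_windowMass hW T).inv.mul (measurable_windowMass hW (A ∩ T))

theorem windowMass_mono {W : Field b → ℝ≥0∞} {A A' : Set ({i // i ∈ Δ} → E d)} (h : A ⊆ A')
    (y : {i // i ∉ Δ} → E d) : windowMass Q W A y ≤ windowMass Q W A' y :=
  lintegral_mono_set h

theorem windowProb_le_one (W : Field b → ℝ≥0∞) (T A : Set ({i // i ∈ Δ} → E d))
    (y : {i // i ∉ Δ} → E d) : windowProb Q W T A y ≤ 1 := by
  rw [windowProb, mul_comm, ← div_eq_mul_inv]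
  exact ENNReal.div_le_of_le_mul
    ((windowMass_mono Set.inter_subset_right y).trans_eq (one_mul _).symm)

theorem windowMass_mul_windowProb {W : Field b → ℝ≥0∞} {T A : Set ({i // i ∈ Δ} → E d)}
    {y : {i // i ∉ Δ} → E d} (h : windowMass Q W T y ≠ ∞) :
    windowMass Q W T y * windowProb Q W T A y = windowMass Q W (A ∩ T) y := by
  by_cases h0 : windowMass Q W T y = 0
  · have : windowMass Q W (A ∩ T) y = 0 :=
      le_antisymm ((windowMass_mono Set.inter_subset_right y).trans h0.le) bot_le
    rw [h0, zero_mul, this]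
  · rw [windowProb, ← mul_assoc, ENNReal.mul_inv_cancel h0 h, one_mul]

theorem windowMass_le_mul {W W' : Field b → ℝ≥0∞} {A : Set ({i // i ∈ Δ} → E d)}
    (hA : MeasurableSet A) {y : {i // i ∉ Δ} → E d} {κ : ℝ≥0∞} (hκ : κ ≠ ∞)
    (h : ∀ x' ∈ A, W (glue Δ x' y) ≤ κ * W' (glue Δ x' y)) :
    windowMass Q W A y ≤ κ * windowMass Q W' A y := by
  rw [windowMass, windowMass, ← lintegral_const_mul' _ _ hκ]
  exact setLIntegral_mono' hA h

theorem windowProb_le_of_comparable {W W' : Field b → ℝ≥0∞} {T A : Set ({i // i ∈ Δ} → E d)}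
    (hT : MeasurableSet T) (hA : MeasurableSet A) {y : {i // i ∉ Δ} → E d} {κ : ℝ≥0∞}
    (hκ0 : κ ≠ 0) (hκ : κ ≠ ∞)
    (hW : ∀ x' ∈ T, W (glue Δ x' y) ≤ κ * W' (glue Δ x' y))
    (hW' : ∀ x' ∈ T, W' (glue Δ x' y) ≤ κ * W (glue Δ x' y)) :
    windowProb Q W T A y ≤ κ ^ 2 * windowProb Q W' T A y := by
  have hmass : (windowMass Q W T y)⁻¹ ≤ κ * (windowMass Q W' T y)⁻¹ := by
    rw [ENNReal.inv_le_iff_inv_le, ENNReal.mul_inv (Or.inl hκ0) (Or.inl hκ), inv_inv, mul_comm,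
      ← div_eq_mul_inv]
    exact ENNReal.div_le_of_le_mul' (windowMass_le_mul hT hκ hW')
  calc windowProb Q W T A y
      ≤ (κ * (windowMass Q W' T y)⁻¹) * (κ * windowMass Q W' (A ∩ T) y) :=
        mul_le_mul' hmass (windowMass_le_mul (hA.inter hT) hκ fun x' hx' => hW x' hx'.2)
    _ = κ ^ 2 * windowProb Q W' T A y := by rw [windowProb]; ring

theorem lintegral_mul_indicator_glue {W : Field b → ℝ≥0∞} (hW : Measurable W)
    {A : Set ({i // i ∈ Δ} → E d)} (hA : MeasurableSet A) (B : Set ({i // i ∉ Δ} → E d))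
    (g : ({i // i ∉ Δ} → E d) → ℝ≥0∞) (y : {i // i ∉ Δ} → E d) :
    ∫⁻ x', W (glue Δ x' y) * (restrictIn Δ ⁻¹' A ∩ restrictOut Δ ⁻¹' B).indicator
        (fun x => g (restrictOut Δ x)) (glue Δ x' y) ∂(Measure.pi fun _ : {i // i ∈ Δ} => Q) =
      windowMass Q W A y * B.indicator g y := by
  rw [windowMass, ← lintegral_mul_const _ (measurable_comp_glue hW y),
    ← lintegral_indicator hA]
  refine lintegral_congr fun x' => ?_
  by_cases hx' : x' ∈ A <;> by_cases hy : y ∈ B <;>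
    simp [Set.indicator, restrictIn_glue, restrictOut_glue, hx', hy]

open scoped Classical in
theorem setLIntegral_freeGibbs [IsProbabilityMeasure Q] (hH : IsHamiltonian H)
    (h3 : Hereditary H) (Λ : Finset (Lat b)) {A : Set ({i // i ∈ Δ} → E d)}
    {B : Set ({i // i ∉ Δ} → E d)} (hA : MeasurableSet A) (hB : MeasurableSet B)
    {g : ({i // i ∉ Δ} → E d) → ℝ≥0∞} (hg : Measurable g) :
    ∫⁻ x in restrictIn Δ ⁻¹' A ∩ restrictOut Δ ⁻¹' B, g (restrictOut Δ x) ∂freeGibbs H Q Λ =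
      (freePartition H Q Λ)⁻¹ * ∫⁻ y, boltzmann H (Λ \ Δ) (glue Δ 0 y) *
        (windowMass Q (localWeight H Δ Λ) A y * B.indicator g y)
        ∂(Measure.infinitePi fun _ : {i // i ∉ Δ} => Q) := by
  have hS := (measurable_restrictIn hA).inter (measurable_restrictOut hB)
  have hgS := (hg.comp measurable_restrictOut).indicator hS
  simp only [Function.comp_def] at hgS
  rw [← lintegral_indicator hS, lintegral_freeGibbs (Δ := Δ) hH h3 Λ hgS]
  simp only [lintegral_mul_indicator_glue (measurable_localWeight hH Λ) hA]

open scoped Classical in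
theorem boltzmann_mul_windowMass_ne_top [IsProbabilityMeasure Q] (hH : IsHamiltonian H)
    (h1 : Stable H) (h3 : Hereditary H) (Λ : Finset (Lat b)) (A : Set ({i // i ∈ Δ} → E d))
    (y : {i // i ∉ Δ} → E d) :
    boltzmann H (Λ \ Δ) (glue Δ 0 y) * windowMass Q (localWeight H Δ Λ) A y ≠ ∞ := by
  obtain ⟨K, hK, h1⟩ := h1
  rw [windowMass, ← lintegral_const_mul _
    (measurable_comp_glue (measurable_localWeight hH Λ) y)]
  simp only [← boltzmann_glue hH h3]
  exact ((lintegral_mono fun x' => boltzmann_le hK h1 Λ _).trans_lt (by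
    rw [setLIntegral_const]
    exact ENNReal.mul_lt_top ENNReal.ofReal_lt_top (measure_lt_top _ _))).ne

open scoped Classical in
theorem freeGibbs_eq_lintegral_windowProb [IsProbabilityMeasure Q] (hH : IsHamiltonian H)
    (h1 : Stable H) (h3 : Hereditary H) (Λ : Finset (Lat b)) {T A : Set ({i // i ∈ Δ} → E d)}
    {B : Set ({i // i ∉ Δ} → E d)} (hT : MeasurableSet T) (hA : MeasurableSet A)
    (hB : MeasurableSet B) :
    freeGibbs H Q Λ (restrictIn Δ ⁻¹' (A ∩ T) ∩ restrictOut Δ ⁻¹' B) =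
      ∫⁻ x in restrictIn Δ ⁻¹' T ∩ restrictOut Δ ⁻¹' B,
        windowProb Q (localWeight H Δ Λ) T A (restrictOut Δ x) ∂freeGibbs H Q Λ := by
  rw [← setLIntegral_one, setLIntegral_freeGibbs hH h3 Λ (hA.inter hT) hB measurable_const,
    setLIntegral_freeGibbs hH h3 Λ hT hB (measurable_windowProb (measurable_localWeight hH Λ) T A)]
  congr 1
  refine lintegral_congr fun y => ?_
  by_cases hy : y ∈ B
  · rw [Set.indicator_of_mem hy, Set.indicator_of_mem hy, mul_one]
    have hfin := boltzmann_mul_windowMass_ne_top (Q := Q) hH h1 h3 Λ T y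
    rcases eq_or_ne (windowMass Q (localWeight H Δ Λ) T y) ∞ with htop | htop
    · have h0 : boltzmann H (Λ \ Δ) (glue Δ 0 y) = 0 := by
        by_contra h0
        exact hfin (by rw [htop, ENNReal.mul_top h0])
      simp only [h0, zero_mul]
    · rw [windowMass_mul_windowProb htop]
  · rw [Set.indicator_of_notMem hy, Set.indicator_of_notMem hy]
    simp only [mul_zero]

end

/-! ### Quasi-local interactions -/

section

variable {d : ℕ} {b : Module.Basis (Fin d) ℝ (E d)} {Δ : Finset (Lat b)}
  {H : Finset (E d) → EReal} {Q : Measure (E d)} {S : Set (E d)}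

open scoped Classical in
/-- For displacements in `S`, bounded by `M` on `Δ`, indices whose points are farther than `R` from
the origin contribute at most `η` to the energy of `Δ`. -/
def IsRange (H : Finset (E d) → EReal) (S : Set (E d)) (Δ : Finset (Lat b)) (M η R : ℝ) : Prop :=
  ∀ x : Field b, (∀ i, x i ∈ S) → (∀ i ∈ Δ, ‖x i‖ ≤ M) →
    ∀ Λ' Λ : Finset (Lat b), Δ ⊆ Λ' → Λ' ⊆ Λ → H (points (Λ \ Δ) x) ≠ ⊤ →
      (∀ i ∈ Λ, i ∉ Λ' → R < ‖(i : E d) + x i‖) →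
        increment H Δ Λ x ≤ increment H Δ Λ' x + (η : EReal) ∧
          increment H Δ Λ' x ≤ increment H Δ Λ x + (η : EReal)

/-- The energy of a window depends little on indices whose points are far away, for displacements
in `S`. Both (H5.1) and (H5.2) imply it, and it suffices for passing to the limit in the DLR
equations. -/
def QuasiLocal (b : Module.Basis (Fin d) ℝ (E d)) (H : Finset (E d) → EReal) (S : Set (E d)) :
    Prop :=
  ∀ (Δ : Finset (Lat b)) (M η : ℝ), 0 < η → ∃ R : ℝ, IsRange H S Δ M η R

theorem exp_neg_le_mul_exp_neg {u v : EReal} {η : ℝ} (h : u ≤ v + (η : EReal)) :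
    EReal.exp (-v) ≤ ENNReal.ofReal (Real.exp η) * EReal.exp (-u) := by
  rw [← EReal.exp_coe, ← EReal.exp_add, EReal.exp_le_exp_iff]
  have hη := EReal.sub_le_of_le_add h
  rwa [← EReal.neg_le_neg_iff, EReal.neg_sub (Or.inr (EReal.coe_ne_bot η))
    (Or.inr (EReal.coe_ne_top η)), add_comm] at hη

/-- The window configurations with displacements in `S` and bounded by `M`. -/
def window (Δ : Finset (Lat b)) (S : Set (E d)) (M : ℝ) : Set ({i // i ∈ Δ} → E d) :=
  {x' | ∀ i, x' i ∈ S ∧ ‖x' i‖ ≤ M}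

theorem measurableSet_window (hS : MeasurableSet S) (M : ℝ) : MeasurableSet (window Δ S M) := by
  rw [window, Set.ofPred_forall]
  exact MeasurableSet.iInter fun i => (measurable_pi_apply i hS).inter
    (measurableSet_le (measurable_pi_apply i).norm measurable_const)

open scoped Classical in
/-- The configurations off `Δ` with displacements in `S` and finite energy in `Λ`, such that the
points indexed by `Λ` and not by `Λ'` are farther than `R` from the origin. -/
def tameOutside (H : Finset (E d) → EReal) (S : Set (E d)) (Δ Λ' Λ : Finset (Lat b)) (R : ℝ) :
    Set ({i // i ∉ Δ} → E d) :=
  {y | (∀ i, y i ∈ S) ∧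
    (∀ i : {i // i ∉ Δ}, (i : Lat b) ∈ Λ → (i : Lat b) ∉ Λ' → R < ‖((i : Lat b) : E d) + y i‖) ∧
    H (points (Λ \ Δ) (glue Δ 0 y)) ≠ ⊤}

theorem measurableSet_tameOutside (hH : IsHamiltonian H) (hS : MeasurableSet S)
    (Λ' Λ : Finset (Lat b)) (R : ℝ) : MeasurableSet (tameOutside H S Δ Λ' Λ R) := by
  have hglue : Measurable fun y : {i // i ∉ Δ} → E d => glue Δ 0 y :=
    measurable_glue.comp (measurable_const.prodMk measurable_id)
  have hyS : MeasurableSet {y : {i // i ∉ Δ} → E d | ∀ i, y i ∈ S} := by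
    rw [Set.ofPred_forall]
    exact MeasurableSet.iInter fun i => measurable_pi_apply i hS
  have hfar : MeasurableSet {y : {i // i ∉ Δ} → E d | ∀ i : {i // i ∉ Δ},
      (i : Lat b) ∈ Λ → (i : Lat b) ∉ Λ' → R < ‖((i : Lat b) : E d) + y i‖} := by
    simp only [Set.ofPred_forall]
    exact MeasurableSet.iInter fun i => MeasurableSet.iInter fun _ => MeasurableSet.iInter
      fun _ => measurableSet_lt measurable_const (by fun_prop)
  exact hyS.inter (hfar.inter
    (((hH.measurable_comp_points _).comp hglue) (measurableSet_singleton ⊤)).compl)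

theorem ae_restrictOut_mem_tameOutside [IsProbabilityMeasure Q] (hH : IsHamiltonian H)
    (h3 : Hereditary H) (hQS : ∀ᵐ v ∂Q, v ∈ S) (Λ' Λ : Finset (Lat b)) (R : ℝ) :
    ∀ᵐ x ∂freeGibbs H Q Λ, (∀ i ∈ Λ, i ∉ Λ' → R < ‖(i : E d) + x i‖) →
      restrictOut Δ x ∈ tameOutside H S Δ Λ' Λ R := by
  classical
  have hxS : ∀ᵐ x ∂freeGibbs H Q Λ, ∀ i, x i ∈ S :=
    ae_all_iff.2 fun i => (freeGibbs_absolutelyContinuous Λ).ae_le (ae_freeField_mem hQS i)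
  filter_upwards [hxS, ae_freeGibbs_energy_ne_top (Q := Q) hH h3 (Λ.sdiff_subset (t := Δ))]
    with x hxS hxE hfar
  refine ⟨fun i => hxS i, fun i hi hi' => hfar i hi hi', ?_⟩
  rwa [points_sdiff_glue Λ 0 (restrictIn Δ x), glue_restrictIn_restrictOut]

theorem IsRange.windowProb_le {M η R : ℝ} (hR : IsRange H S Δ M η R) (hS : MeasurableSet S)
    {Λ Λ' : Finset (Lat b)} (hΔ : Δ ⊆ Λ') (hΛ : Λ' ⊆ Λ) {A : Set ({i // i ∈ Δ} → E d)}
    (hA : MeasurableSet A) {y : {i // i ∉ Δ} → E d} (hy : y ∈ tameOutside H S Δ Λ' Λ R) :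
    windowProb Q (localWeight H Δ Λ) (window Δ S M) A y ≤
      ENNReal.ofReal (Real.exp η) ^ 2 *
        windowProb Q (localWeight H Δ Λ') (window Δ S M) A y := by
  classical
  obtain ⟨hyS, hfar, hE⟩ := hy
  have hcmp : ∀ x' ∈ window Δ S M,
      increment H Δ Λ (glue Δ x' y) ≤ increment H Δ Λ' (glue Δ x' y) + (η : EReal) ∧
        increment H Δ Λ' (glue Δ x' y) ≤ increment H Δ Λ (glue Δ x' y) + (η : EReal) := by
    intro x' hx'
    refine hR _ (glue_mem (fun i => (hx' i).1) hyS) (fun i hi => ?_) Λ' Λ hΔ hΛ ?_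
      fun i hi hi' => ?_
    · rw [glue_of_mem _ _ hi]
      exact (hx' ⟨i, hi⟩).2
    · rwa [points_sdiff_glue Λ x' 0]
    · have hiΔ : i ∉ Δ := fun h => hi' (hΔ h)
      rw [glue_of_notMem _ _ hiΔ]
      exact hfar ⟨i, hiΔ⟩ hi hi'
  exact windowProb_le_of_comparable (measurableSet_window hS M) hA (by simp [Real.exp_pos])
    ENNReal.ofReal_ne_top (fun x' hx' => exp_neg_le_mul_exp_neg (hcmp x' hx').2)
    fun x' hx' => exp_neg_le_mul_exp_neg (hcmp x' hx').1

theorem freeGibbs_le_add_windowProb [IsProbabilityMeasure Q] (hH : IsHamiltonian H)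
    (h1 : Stable H) (h3 : Hereditary H) (hS : MeasurableSet S) (hQS : ∀ᵐ v ∂Q, v ∈ S)
    {M η R : ℝ} (hR : IsRange H S Δ M η R) {Λ Λ' : Finset (Lat b)} (hΔ : Δ ⊆ Λ') (hΛ : Λ' ⊆ Λ)
    {A : Set ({i // i ∈ Δ} → E d)} {B : Set ({i // i ∉ Δ} → E d)} (hA : MeasurableSet A)
    (hB : MeasurableSet B) :
    freeGibbs H Q Λ (restrictIn Δ ⁻¹' (A ∩ window Δ S M) ∩ restrictOut Δ ⁻¹' B) ≤
      freeGibbs H Q Λ {x | ∃ i ∈ Λ, i ∉ Λ' ∧ ‖(i : E d) + x i‖ ≤ R} +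
      ENNReal.ofReal (Real.exp η) ^ 2 *
        ∫⁻ x in restrictIn Δ ⁻¹' (window Δ S M) ∩ restrictOut Δ ⁻¹' B,
          windowProb Q (localWeight H Δ Λ') (window Δ S M) A (restrictOut Δ x)
            ∂freeGibbs H Q Λ := by
  set T := window Δ S M
  set G := tameOutside H S Δ Λ' Λ R
  have hT : MeasurableSet T := measurableSet_window hS M
  have hBG : MeasurableSet (B ∩ G) := hB.inter (measurableSet_tameOutside hH hS Λ' Λ R)
  have htame : freeGibbs H Q Λ (restrictIn Δ ⁻¹' (A ∩ T) ∩ restrictOut Δ ⁻¹' B) ≤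
      freeGibbs H Q Λ ({x | ∃ i ∈ Λ, i ∉ Λ' ∧ ‖(i : E d) + x i‖ ≤ R} ∪
        (restrictIn Δ ⁻¹' (A ∩ T) ∩ restrictOut Δ ⁻¹' (B ∩ G))) := by
    refine measure_mono_ae ?_
    filter_upwards [ae_restrictOut_mem_tameOutside (Δ := Δ) hH h3 hQS Λ' Λ R] with x hxG hx
    by_cases hnear : ∃ i ∈ Λ, i ∉ Λ' ∧ ‖(i : E d) + x i‖ ≤ R
    · exact Or.inl hnear
    · push Not at hnear
      exact Or.inr ⟨hx.1, hx.2, hxG hnear⟩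
  refine (htame.trans (measure_union_le _ _)).trans (add_le_add le_rfl ?_)
  calc freeGibbs H Q Λ (restrictIn Δ ⁻¹' (A ∩ T) ∩ restrictOut Δ ⁻¹' (B ∩ G))
      = ∫⁻ x in restrictIn Δ ⁻¹' T ∩ restrictOut Δ ⁻¹' (B ∩ G),
          windowProb Q (localWeight H Δ Λ) T A (restrictOut Δ x) ∂freeGibbs H Q Λ :=
        freeGibbs_eq_lintegral_windowProb hH h1 h3 Λ hT hA hBG
    _ ≤ ∫⁻ x in restrictIn Δ ⁻¹' T ∩ restrictOut Δ ⁻¹' (B ∩ G), ENNReal.ofReal (Real.exp η) ^ 2 *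
          windowProb Q (localWeight H Δ Λ') T A (restrictOut Δ x) ∂freeGibbs H Q Λ :=
        setLIntegral_mono' ((measurable_restrictIn hT).inter (measurable_restrictOut hBG))
          fun x hx => hR.windowProb_le hS hΔ hΛ hA hx.2.2
    _ ≤ ∫⁻ x in restrictIn Δ ⁻¹' T ∩ restrictOut Δ ⁻¹' B, ENNReal.ofReal (Real.exp η) ^ 2 *
          windowProb Q (localWeight H Δ Λ') T A (restrictOut Δ x) ∂freeGibbs H Q Λ :=
        lintegral_mono_set fun x hx => ⟨hx.1, hx.2.1⟩
    _ = _ := lintegral_const_mul' _ _ (ENNReal.pow_ne_top ENNReal.ofReal_ne_top)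

theorem lintegral_averagedGibbs [IsProbabilityMeasure Q] (hH : IsHamiltonian H)
    (h4 : TranslationInvariant H) (Λ : Finset (Lat b)) (f : Field b → ℝ≥0∞) :
    ∫⁻ x, f x ∂averagedGibbs H Q Λ =
      (Λ.card : ℝ≥0∞)⁻¹ * ∑ k ∈ Λ, ∫⁻ x, f x ∂freeGibbs H Q (translateBox k Λ) := by
  rw [averagedGibbs, lintegral_smul_measure, smul_eq_mul, lintegral_finsetSum_measure]
  simp_rw [freeGibbs_map_shift hH h4]

theorem averagedGibbs_le_add_windowProb [IsProbabilityMeasure Q] (hH : IsHamiltonian H)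
    (h1 : Stable H) (h3 : Hereditary H) (h4 : TranslationInvariant H) (hS : MeasurableSet S)
    (hQS : ∀ᵐ v ∂Q, v ∈ S) {M η r R : ℝ} (hR : IsRange H S Δ M η R) {Λ Λ' : Finset (Lat b)}
    [IsProbabilityMeasure (freeGibbs H Q Λ)] (hΔ : Δ ⊆ Λ')
    (hΛ' : ∀ i : Lat b, ‖(i : E d)‖ ≤ r + R → i ∈ Λ') {A : Set ({i // i ∈ Δ} → E d)}
    {B : Set ({i // i ∉ Δ} → E d)} (hA : MeasurableSet A) (hB : MeasurableSet B) :
    averagedGibbs H Q Λ (restrictIn Δ ⁻¹' (A ∩ window Δ S M) ∩ restrictOut Δ ⁻¹' B) ≤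
      exitRatio Λ' Λ + (latCount b (R + R) * averagedGibbs H Q Λ {x | r < ‖x 0‖} +
      ENNReal.ofReal (Real.exp η) ^ 2 *
        ∫⁻ x in restrictIn Δ ⁻¹' (window Δ S M) ∩ restrictOut Δ ⁻¹' B,
          windowProb Q (localWeight H Δ Λ') (window Δ S M) A (restrictOut Δ x)
            ∂averagedGibbs H Q Λ) := by
  have hT : MeasurableSet (window Δ S M) := measurableSet_window hS M
  have hmL := (measurable_restrictIn (hA.inter hT)).inter (measurable_restrictOut hB)
  have hmR := (measurable_restrictIn hT).inter (measurable_restrictOut hB)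
  rw [averagedGibbs_apply hmL, ← lintegral_indicator hmR, lintegral_averagedGibbs hH h4]
  refine (average_le_exitRatio_add_average (g := fun k => freeGibbs H Q (translateBox k Λ)
        {x | ∃ i ∈ translateBox k Λ, i ∉ Λ' ∧ ‖(i : E d) + x i‖ ≤ R} +
      ENNReal.ofReal (Real.exp η) ^ 2 *
        ∫⁻ x, (restrictIn Δ ⁻¹' window Δ S M ∩ restrictOut Δ ⁻¹' B).indicator
          (fun x => windowProb Q (localWeight H Δ Λ') (window Δ S M) A (restrictOut Δ x)) x
            ∂freeGibbs H Q (translateBox k Λ))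
    Λ' Λ (fun k _ => prob_le_one) fun k _ hΛ'k => ?_).trans (add_le_add le_rfl ?_)
  · rw [← Measure.map_apply (measurable_shift k) hmL, freeGibbs_map_shift hH h4,
      lintegral_indicator hmR]
    exact freeGibbs_le_add_windowProb hH h1 h3 hS hQS hR hΔ
      (fun i hi => mem_translateBox.2 (hΛ'k i hi)) hA hB
  · rw [Finset.sum_add_distrib, mul_add, ← Finset.mul_sum, mul_left_comm _ (_ ^ 2)]
    exact add_le_add (average_freeGibbs_far_le hH h4 hΛ') le_rfl

theorem dependsOn_windowProb_localWeight (Λ : Finset (Lat b)) (T A : Set ({i // i ∈ Δ} → E d)) :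
    DependsOn (fun x : Field b => windowProb Q (localWeight H Δ Λ) T A (restrictOut Δ x))
      (Λ : Set (Lat b)) := by
  classical
  intro x y hxy
  have hglue : ∀ x', ∀ i ∈ Λ,
      glue Δ x' (restrictOut Δ x) i = glue Δ x' (restrictOut Δ y) i := by
    intro x' i hi
    by_cases h : i ∈ Δ
    · rw [glue_of_mem _ _ h, glue_of_mem _ _ h]
    · rw [glue_of_notMem _ _ h, glue_of_notMem _ _ h]
      exact hxy i hi
  have hweight : ∀ x', localWeight H Δ Λ (glue Δ x' (restrictOut Δ x)) =
      localWeight H Δ Λ (glue Δ x' (restrictOut Δ y)) := fun x' => by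
    rw [localWeight, localWeight, increment, increment, points_congr (hglue x'),
      points_congr fun i hi => hglue x' i (Finset.mem_sdiff.1 hi).1]
  simp only [windowProb, windowMass, hweight]

theorem exists_dependsOn_mem_inter (A : Set ({i // i ∈ Δ} → E d)) {B : Set ({i // i ∉ Δ} → E d)}
    (hB : B ∈ measurableCylinders fun _ : {i // i ∉ Δ} => E d) :
    ∃ Γ : Finset (Lat b),
      DependsOn (· ∈ restrictIn Δ ⁻¹' A ∩ restrictOut Δ ⁻¹' B) (Γ : Set (Lat b)) := by
  classical
  obtain ⟨I, C, -, rfl⟩ := (mem_measurableCylinders _).1 hB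
  refine ⟨Δ ∪ I.map (Function.Embedding.subtype _), fun x y hxy => ?_⟩
  have hIn : restrictIn Δ x = restrictIn Δ y :=
    funext fun i => hxy i (Finset.mem_union_left _ i.2)
  have hOut : I.restrict (restrictOut Δ x) = I.restrict (restrictOut Δ y) :=
    funext fun i => hxy i.1.1 (Finset.mem_union_right _ (Finset.mem_map_of_mem _ i.2))
  simp only [Set.mem_inter_iff, Set.mem_preimage, mem_cylinder, hIn, hOut]

theorem dependsOn_indicator {L X M : Type*} [Zero M] {f : (L → X) → M} {A : Set (L → X)}
    {s : Set L} (hf : DependsOn f s) (hA : DependsOn (· ∈ A) s) : DependsOn (A.indicator f) s := by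
  classical
  intro x y hxy
  have hmem : x ∈ A ↔ y ∈ A := iff_of_eq (hA hxy)
  simp only [Set.indicator_apply, hmem, hf hxy]

variable {μs : ℕ → Measure (Field b)} {P : Measure (Field b)}

theorem TendstoLocally.measure_inter (hP : TendstoLocally μs P) {A : Set ({i // i ∈ Δ} → E d)}
    (hA : MeasurableSet A) {B : Set ({i // i ∉ Δ} → E d)}
    (hB : B ∈ measurableCylinders fun _ : {i // i ∉ Δ} => E d) :
    Tendsto (fun n => μs n (restrictIn Δ ⁻¹' A ∩ restrictOut Δ ⁻¹' B)) atTop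
      (𝓝 (P (restrictIn Δ ⁻¹' A ∩ restrictOut Δ ⁻¹' B))) := by
  obtain ⟨Γ, hΓ⟩ := exists_dependsOn_mem_inter A hB
  exact hP.measure ((measurable_restrictIn hA).inter
    (measurable_restrictOut (MeasurableSet.of_mem_measurableCylinders hB))) hΓ

theorem TendstoLocally.setLIntegral_windowProb [IsProbabilityMeasure Q]
    [∀ n, IsProbabilityMeasure (μs n)] [IsProbabilityMeasure P] (hH : IsHamiltonian H)
    (hP : TendstoLocally μs P) (Λ : Finset (Lat b)) {T : Set ({i // i ∈ Δ} → E d)}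
    (hT : MeasurableSet T) (A : Set ({i // i ∈ Δ} → E d)) {B : Set ({i // i ∉ Δ} → E d)}
    (hB : B ∈ measurableCylinders fun _ : {i // i ∉ Δ} => E d) :
    Tendsto (fun n => ∫⁻ x in restrictIn Δ ⁻¹' T ∩ restrictOut Δ ⁻¹' B,
        windowProb Q (localWeight H Δ Λ) T A (restrictOut Δ x) ∂μs n) atTop
      (𝓝 (∫⁻ x in restrictIn Δ ⁻¹' T ∩ restrictOut Δ ⁻¹' B,
        windowProb Q (localWeight H Δ Λ) T A (restrictOut Δ x) ∂P)) := by
  classical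
  obtain ⟨Γ, hΓ⟩ := exists_dependsOn_mem_inter T hB
  have hTB := (measurable_restrictIn hT).inter
    (measurable_restrictOut (MeasurableSet.of_mem_measurableCylinders hB))
  have hprob : Measurable fun x : Field b =>
      windowProb Q (localWeight H Δ Λ) T A (restrictOut Δ x) :=
    (measurable_windowProb (measurable_localWeight hH Λ) T A).comp measurable_restrictOut
  simp only [← lintegral_indicator hTB]
  refine hP.lintegral (hprob.indicator hTB) (C := 1) (Γ := Λ ∪ Γ)
    (Set.indicator_le' (fun x _ => windowProb_le_one _ _ _ _) fun _ _ => zero_le) ?_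
  rw [Finset.coe_union]
  exact dependsOn_indicator
    ((dependsOn_windowProb_localWeight Λ T A).mono Set.subset_union_left)
    (hΓ.mono Set.subset_union_right)

theorem TendstoLocally.le_add_windowProb [IsProbabilityMeasure Q] (hH : IsHamiltonian H)
    (h1 : Stable H) (h2 : NonDegenerate b H) (h3 : Hereditary H) (h4 : TranslationInvariant H)
    (hS : MeasurableSet S) (hQS : ∀ᵐ v ∂Q, v ∈ S) [IsProbabilityMeasure P]
    {Λs : ℕ → Finset (Lat b)} (hΛs : IsFolner Λs)
    (hP : TendstoLocally (fun n => averagedGibbs H Q (Λs n)) P)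
    {M η R : ℝ} (hR : IsRange H S Δ M η R) {ε : ℝ≥0∞} (hε : ε ≠ 0) :
    ∃ Λ₀ : Finset (Lat b), ∀ Λ', Λ₀ ⊆ Λ' → ∀ A : Set ({i // i ∈ Δ} → E d), MeasurableSet A →
      ∀ B ∈ measurableCylinders fun _ : {i // i ∉ Δ} => E d,
        P (restrictIn Δ ⁻¹' (A ∩ window Δ S M) ∩ restrictOut Δ ⁻¹' B) ≤
          ε + ENNReal.ofReal (Real.exp η) ^ 2 *
            ∫⁻ x in restrictIn Δ ⁻¹' (window Δ S M) ∩ restrictOut Δ ⁻¹' B,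
              windowProb Q (localWeight H Δ Λ') (window Δ S M) A (restrictOut Δ x) ∂P := by
  classical
  have hfree := fun n => isProbabilityMeasure_freeGibbs (Q := Q) h1 h2 h4 (Λs n)
  have hav := fun n => isProbabilityMeasure_averagedGibbs (H := H) (Q := Q) (hΛs.nonempty n)
  obtain ⟨r, hr⟩ := (locallyEquicontinuous_averagedGibbs (Q := Q) h1 h2 h4
    hΛs.nonempty).exists_norm_gt_le 0 (ENNReal.div_ne_zero.2
      ⟨hε, ENNReal.natCast_ne_top (latCount b (R + R))⟩)
  have hfar : ∀ n, latCount b (R + R) * averagedGibbs H Q (Λs n) {x | r < ‖x 0‖} ≤ ε := fun n =>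
    (mul_le_mul' le_rfl (hr n)).trans ENNReal.mul_div_le
  have hT : MeasurableSet (window Δ S M) := measurableSet_window hS M
  refine ⟨Δ ∪ (finite_lat_norm_le (b := b) (r + R)).toFinset, fun Λ' hΛ₀ A hA B hB => ?_⟩
  have hlim := (hΛs.tendsto_exitRatio Λ').add ((ENNReal.Tendsto.const_mul
    (hP.setLIntegral_windowProb (Q := Q) hH Λ' hT A hB)
    (Or.inr (ENNReal.pow_ne_top (ENNReal.ofReal_ne_top (r := Real.exp η)) (n := 2)))).const_add ε)
  rw [zero_add] at hlim
  refine le_of_tendsto_of_tendsto' (hP.measure_inter (hA.inter hT) hB) hlim fun n => ?_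
  refine (averagedGibbs_le_add_windowProb hH h1 h3 h4 hS hQS hR
    (fun i hi => hΛ₀ (Finset.mem_union_left _ hi))
    (fun i hi => hΛ₀ (Finset.mem_union_right _ (by simpa using hi))) hA
    (MeasurableSet.of_mem_measurableCylinders hB)).trans ?_
  gcongr
  exact hfar n

end

/-! ### Convergence of the local energies -/

theorem limsup_le_add_and_le_liminf_add {ι : Type*} {l : Filter ι} {u : ι → EReal} {a : EReal}
    {η : ℝ} (h : ∀ᶠ n in l, u n ≤ a + (η : EReal) ∧ a ≤ u n + (η : EReal)) :
    limsup u l ≤ a + (η : EReal) ∧ a ≤ liminf u l + (η : EReal) := by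
  refine ⟨limsup_le_of_le (h := h.mono fun n hn => hn.1), ?_⟩
  rw [← EReal.sub_le_iff_le_add (by simp) (by simp)]
  refine le_liminf_of_le (h := h.mono fun n hn => ?_)
  exact (EReal.sub_le_iff_le_add (by simp) (by simp)).2 hn.2

theorem ereal_le_of_forall_pos_le_add {a c : EReal}
    (h : ∀ η : ℝ, 0 < η → a ≤ c + (η : EReal)) : a ≤ c := by
  induction c using EReal.rec with
  | bot => simpa using h 1 one_pos
  | top => exact le_top
  | coe c =>
    refine EReal.le_of_forall_lt_iff_le.1 fun z hz => ?_
    have := h (z - c) (sub_pos.2 (EReal.coe_lt_coe_iff.1 hz))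
    rwa [← EReal.coe_add, add_sub_cancel] at this

theorem tendsto_limsup_of_forall_pos {ι : Type*} {l : Filter ι} {u : ι → EReal}
    (h : ∀ η : ℝ, 0 < η → ∃ a : EReal, ∀ᶠ n in l, u n ≤ a + (η : EReal) ∧ a ≤ u n + (η : EReal)) :
    Tendsto u l (𝓝 (limsup u l)) := by
  refine tendsto_of_le_liminf_of_limsup_le (ereal_le_of_forall_pos_le_add fun η hη => ?_) le_rfl
  obtain ⟨a, ha⟩ := h (η / 2) (half_pos hη)
  obtain ⟨hsup, hinf⟩ := limsup_le_add_and_le_liminf_add ha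
  calc limsup u l ≤ liminf u l + ((η / 2 : ℝ) : EReal) + ((η / 2 : ℝ) : EReal) :=
        hsup.trans (add_le_add hinf le_rfl)
    _ = liminf u l + (η : EReal) := by rw [add_assoc, ← EReal.coe_add, add_halves]

section

variable {d : ℕ} {b : Module.Basis (Fin d) ℝ (E d)} {Δ : Finset (Lat b)}
  {H : Finset (E d) → EReal} {Q : Measure (E d)} {S : Set (E d)}

theorem mem_box {n : ℕ} {i : Lat b} : i ∈ box b n ↔ ∀ k, |(i : E d) k| ≤ n := by
  simp [box, cube]

theorem box_mono : Monotone (box b) := fun _ _ h _ hi =>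
  mem_box.2 fun k => (mem_box.1 hi k).trans (Nat.cast_le.2 h)

theorem eventually_subset_box (Γ : Finset (Lat b)) : ∀ᶠ n in atTop, Γ ⊆ box b n := by
  refine (eventually_all_finset Γ).2 fun i _ => ?_
  have hcoord : ∀ k, ∀ᶠ n : ℕ in atTop, |(i : E d) k| ≤ n := fun k =>
    tendsto_natCast_atTop_atTop.eventually (eventually_ge_atTop _)
  exact (eventually_all.2 hcoord).mono fun n hn => mem_box.2 hn

open scoped Classical in
theorem IsRange.eventually_energyIncrement_le {M η R : ℝ} (hR : IsRange H S Δ M η R)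
    {x : Field b} (hxS : ∀ i, x i ∈ S) (hM : ∀ i ∈ Δ, ‖x i‖ ≤ M)
    (hx : ∀ n, H (points (box b n \ Δ) x) ≠ ⊤) {m : ℕ} (hm : Δ ⊆ box b m)
    (hfar : ∀ i, i ∉ box b m → R < ‖(i : E d) + x i‖) :
    ∀ᶠ n in atTop, energyIncrement H Δ x n ≤ increment H Δ (box b m) x + (η : EReal) ∧
      increment H Δ (box b m) x ≤ energyIncrement H Δ x n + (η : EReal) :=
  (eventually_ge_atTop m).mono fun n hn =>
    hR x hxS hM _ _ hm (box_mono hn) (hx n) fun i _ hi => hfar i hi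

/-- The points indexed off `Δ` which lie in a given ball have indices in some box. -/
def IsTight (Δ : Finset (Lat b)) (y : {i // i ∉ Δ} → E d) : Prop :=
  ∀ R : ℕ, ∃ m : ℕ, ∀ i : {i // i ∉ Δ}, (i : Lat b) ∉ box b m →
    (R : ℝ) < ‖((i : Lat b) : E d) + y i‖

theorem measurableSet_isTight : MeasurableSet {y : {i // i ∉ Δ} → E d | IsTight Δ y} := by
  simp only [IsTight, Set.ofPred_forall, Set.ofPred_exists]
  exact MeasurableSet.iInter fun R => MeasurableSet.iUnion fun m => MeasurableSet.iInter fun i =>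
    MeasurableSet.iInter fun _ => measurableSet_lt measurable_const (by fun_prop)

theorem IsSparse.isTight {x : Field b} (hx : IsSparse x) : IsTight Δ (restrictOut Δ x) := by
  intro R
  obtain ⟨m, hm⟩ := (eventually_subset_box (hx R).toFinset).exists
  refine ⟨m, fun i hi => ?_⟩
  by_contra hle
  exact hi (hm (by simpa [restrictOut] using hle))

theorem IsTight.eventually_far {y : {i // i ∉ Δ} → E d} (hy : IsTight Δ y) (R : ℝ) :
    ∀ᶠ m in atTop, Δ ⊆ box b m ∧ ∀ x' : {i // i ∈ Δ} → E d,
      ∀ i, i ∉ box b m → R < ‖(i : E d) + glue Δ x' y i‖ := by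
  obtain ⟨N, hN⟩ := exists_nat_ge R
  obtain ⟨m₀, hm₀⟩ := hy N
  filter_upwards [eventually_subset_box Δ, eventually_ge_atTop m₀] with m hm hmm
  refine ⟨hm, fun x' i hi => ?_⟩
  have hiΔ : i ∉ Δ := fun h => hi (hm h)
  rw [glue_of_notMem _ _ hiΔ]
  exact hN.trans_lt (hm₀ ⟨i, hiΔ⟩ fun h => hi (box_mono hmm h))

open scoped Classical in
theorem Hereditary.increment_eq_zero (h3 : Hereditary H) {Λ : Finset (Lat b)} {x : Field b}
    (h : H (points (Λ \ Δ) x) = ⊤) : increment H Δ Λ x = 0 :=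
  if_pos ⟨h3.mono (points_mono Finset.sdiff_subset x) h, h⟩

theorem QuasiLocal.exists_tendsto (hq : QuasiLocal b H S) (h3 : Hereditary H)
    {y : {i // i ∉ Δ} → E d} (hyS : ∀ i, y i ∈ S) (hy : IsTight Δ y) {x' : {i // i ∈ Δ} → E d}
    (hx' : ∀ i, x' i ∈ S) :
    ∃ h : EReal, Tendsto (energyIncrement H Δ (glue Δ x' y)) atTop (𝓝 h) := by
  classical
  set x := glue Δ x' y
  by_cases htop : ∃ n, H (points (box b n \ Δ) x) = ⊤
  · obtain ⟨n, hn⟩ := htop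
    refine ⟨0, tendsto_const_nhds.congr' ?_⟩
    filter_upwards [eventually_ge_atTop n] with m hm
    exact (h3.increment_eq_zero
      (h3.mono (points_mono (Finset.sdiff_subset_sdiff (box_mono hm) le_rfl) x) hn)).symm
  · push Not at htop
    refine ⟨_, tendsto_limsup_of_forall_pos fun η hη => ?_⟩
    have hM : ∀ i ∈ Δ, ‖x i‖ ≤ ∑ i ∈ Δ, ‖x i‖ := fun i hi =>
      Finset.single_le_sum (f := fun i => ‖x i‖) (fun _ _ => norm_nonneg _) hi
    obtain ⟨R, hR⟩ := hq Δ _ η hη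
    obtain ⟨m, hm, hfar⟩ := (hy.eventually_far R).exists
    exact ⟨_, hR.eventually_energyIncrement_le (glue_mem hx' hyS) hM htop hm (hfar x')⟩

theorem IsRange.eventually_windowProb_le {M η R : ℝ} (hR : IsRange H S Δ M η R)
    (hS : MeasurableSet S) {x : Field b} (hxS : ∀ i, x i ∈ S) (hx : IsSparse x)
    (hE : ∀ Γ : Finset (Lat b), H (points Γ x) ≠ ⊤) {A : Set ({i // i ∈ Δ} → E d)}
    (hA : MeasurableSet A) :
    ∀ᶠ m in atTop,
      windowProb Q (localWeight H Δ (box b m)) (window Δ S M) A (restrictOut Δ x) ≤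
        ENNReal.ofReal (Real.exp η) ^ 2 *
          windowProb Q (limitWeight H Δ) (window Δ S M) A (restrictOut Δ x) := by
  classical
  filter_upwards [(hx.isTight (Δ := Δ)).eventually_far R] with m hm
  have hcmp : ∀ x' ∈ window Δ S M,
      latticeEnergy H Δ (glue Δ x' (restrictOut Δ x)) ≤
        increment H Δ (box b m) (glue Δ x' (restrictOut Δ x)) + (η : EReal) ∧
      increment H Δ (box b m) (glue Δ x' (restrictOut Δ x)) ≤
        latticeEnergy H Δ (glue Δ x' (restrictOut Δ x)) + (η : EReal) := by
    intro x' hx'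
    refine (limsup_le_add_and_le_liminf_add (hR.eventually_energyIncrement_le
      (glue_mem (y := restrictOut Δ x) (fun i => (hx' i).1) fun i => hxS i) (fun i hi => ?_)
      (fun n => ?_) hm.1 (hm.2 x'))).imp_right fun h => h.trans (add_le_add liminf_le_limsup le_rfl)
    · rw [glue_of_mem _ _ hi]
      exact (hx' ⟨i, hi⟩).2
    · rw [points_sdiff_glue _ x' (restrictIn Δ x), glue_restrictIn_restrictOut]
      exact hE _
  exact windowProb_le_of_comparable (measurableSet_window hS M) hA (by simp [Real.exp_pos])
    ENNReal.ofReal_ne_top (fun x' hx' => exp_neg_le_mul_exp_neg (hcmp x' hx').1)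
    fun x' hx' => exp_neg_le_mul_exp_neg (hcmp x' hx').2

end

/-! ### The DLR equations for local limits -/

section

variable {d : ℕ} {b : Module.Basis (Fin d) ℝ (E d)} {Δ : Finset (Lat b)}
  {H : Finset (E d) → EReal} {Q : Measure (E d)} {S : Set (E d)} {Λs : ℕ → Finset (Lat b)}
  {P : Measure (Field b)}

theorem IsRange.limsup_setLIntegral_windowProb_le [IsProbabilityMeasure Q]
    [IsProbabilityMeasure P] {M η R : ℝ} (hR : IsRange H S Δ M η R) (hH : IsHamiltonian H)
    (hS : MeasurableSet S) (hsparse : ∀ᵐ x ∂P, IsSparse x) (hmem : ∀ᵐ x ∂P, ∀ i, x i ∈ S)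
    (hE : ∀ᵐ x ∂P, ∀ Γ : Finset (Lat b), H (points Γ x) ≠ ⊤) {A : Set ({i // i ∈ Δ} → E d)}
    (hA : MeasurableSet A) (D : Set (Field b)) :
    limsup (fun m => ∫⁻ x in D,
        windowProb Q (localWeight H Δ (box b m)) (window Δ S M) A (restrictOut Δ x) ∂P) atTop ≤
      ENNReal.ofReal (Real.exp η) ^ 2 * ∫⁻ x in D,
        windowProb Q (limitWeight H Δ) (window Δ S M) A (restrictOut Δ x) ∂P := by
  rw [← lintegral_const_mul' _ _ (ENNReal.pow_ne_top ENNReal.ofReal_ne_top)]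
  refine (limsup_lintegral_le (fun _ => 1)
    (fun m => (measurable_windowProb (measurable_localWeight hH _) _ A).comp
      measurable_restrictOut)
    (fun m => Eventually.of_forall fun x => windowProb_le_one _ _ _ _) (by simp)).trans
    (lintegral_mono_ae (ae_restrict_of_ae ?_))
  filter_upwards [hsparse, hmem, hE] with x hx hxS hxE
  exact limsup_le_of_le (h := hR.eventually_windowProb_le hS hxS hx hxE hA)

theorem TendstoLocally.ae_forall_mem [IsProbabilityMeasure Q] (hS : MeasurableSet S)
    (hQS : ∀ᵐ v ∂Q, v ∈ S) (hP : TendstoLocally (fun n => averagedGibbs H Q (Λs n)) P) :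
    ∀ᵐ x ∂P, ∀ i, x i ∈ S :=
  hP.ae_mem hS fun _ i => averagedGibbs_absolutelyContinuous.ae_le (ae_freeField_mem hQS i)

theorem TendstoLocally.le_mul_windowProb [IsProbabilityMeasure Q] (hH : IsHamiltonian H)
    (h1 : Stable H) (h2 : NonDegenerate b H) (h3 : Hereditary H) (h4 : TranslationInvariant H)
    (hS : MeasurableSet S) (hQS : ∀ᵐ v ∂Q, v ∈ S) [IsProbabilityMeasure P] (hΛs : IsFolner Λs)
    (hP : TendstoLocally (fun n => averagedGibbs H Q (Λs n)) P) {M η R : ℝ}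
    (hR : IsRange H S Δ M η R) {A : Set ({i // i ∈ Δ} → E d)} (hA : MeasurableSet A)
    {B : Set ({i // i ∉ Δ} → E d)} (hB : B ∈ measurableCylinders fun _ : {i // i ∉ Δ} => E d) :
    P (restrictIn Δ ⁻¹' (A ∩ window Δ S M) ∩ restrictOut Δ ⁻¹' B) ≤
      ENNReal.ofReal (Real.exp η) ^ 4 *
        ∫⁻ x in restrictIn Δ ⁻¹' (window Δ S M) ∩ restrictOut Δ ⁻¹' B,
          windowProb Q (limitWeight H Δ) (window Δ S M) A (restrictOut Δ x) ∂P := by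
  have hfree := fun n => isProbabilityMeasure_freeGibbs (Q := Q) h1 h2 h4 (Λs n)
  have hlimsup := hR.limsup_setLIntegral_windowProb_le (Q := Q) hH hS
    (ae_isSparse (hP.map_shift hΛs)) (hP.ae_forall_mem hS hQS) (hP.ae_energy_ne_top hH h3 h4 hΛs)
    hA (restrictIn Δ ⁻¹' (window Δ S M) ∩ restrictOut Δ ⁻¹' B)
  set κ := ENNReal.ofReal (Real.exp η)
  refine ENNReal.le_of_forall_pos_le_add fun ε hε _ => tsub_le_iff_right.1 ?_
  obtain ⟨Λ₀, hΛ₀⟩ := hP.le_add_windowProb hH h1 h2 h3 h4 hS hQS hΛs hR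
    (ENNReal.coe_ne_zero.2 hε.ne')
  calc P (restrictIn Δ ⁻¹' (A ∩ window Δ S M) ∩ restrictOut Δ ⁻¹' B) - ε
      ≤ limsup (fun m => κ ^ 2 * ∫⁻ x in restrictIn Δ ⁻¹' (window Δ S M) ∩ restrictOut Δ ⁻¹' B,
          windowProb Q (localWeight H Δ (box b m)) (window Δ S M) A (restrictOut Δ x) ∂P)
            atTop :=
        le_limsup_of_frequently_le ((eventually_subset_box Λ₀).mono fun m hm =>
          tsub_le_iff_left.2 (hΛ₀ _ hm A hA B hB)).frequently
    _ ≤ κ ^ 2 * (κ ^ 2 * _) := by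
        rw [ENNReal.limsup_const_mul_of_ne_top (ENNReal.pow_ne_top ENNReal.ofReal_ne_top)]
        exact mul_le_mul' le_rfl hlimsup
    _ = κ ^ 4 * _ := by rw [← mul_assoc, ← pow_add]

theorem le_of_forall_pos_le_exp_pow_mul {a c : ℝ≥0∞} (n : ℕ)
    (h : ∀ η : ℝ, 0 < η → a ≤ ENNReal.ofReal (Real.exp η) ^ n * c) : a ≤ c := by
  have hexp : Tendsto (fun η : ℝ => ENNReal.ofReal (Real.exp η ^ n)) (𝓝[>] 0)
      (𝓝 (ENNReal.ofReal (Real.exp 0 ^ n))) :=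
    ((ENNReal.continuous_ofReal.comp (Real.continuous_exp.pow n)).tendsto 0).mono_left
      nhdsWithin_le_nhds
  have hlim := ENNReal.Tendsto.mul_const (b := c) hexp (Or.inl (by simp))
  simp only [Real.exp_zero, one_pow, ENNReal.ofReal_one, one_mul] at hlim
  refine ge_of_tendsto hlim (eventually_nhdsWithin_of_forall fun η hη => ?_)
  rw [ENNReal.ofReal_pow (Real.exp_nonneg η)]
  exact h η hη

theorem TendstoLocally.le_windowProb [IsProbabilityMeasure Q] (hH : IsHamiltonian H)
    (h1 : Stable H) (h2 : NonDegenerate b H) (h3 : Hereditary H) (h4 : TranslationInvariant H)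
    (hS : MeasurableSet S) (hQS : ∀ᵐ v ∂Q, v ∈ S) (hq : QuasiLocal b H S)
    [IsProbabilityMeasure P] (hΛs : IsFolner Λs)
    (hP : TendstoLocally (fun n => averagedGibbs H Q (Λs n)) P) (M : ℝ)
    {A : Set ({i // i ∈ Δ} → E d)} (hA : MeasurableSet A) {B : Set ({i // i ∉ Δ} → E d)}
    (hB : B ∈ measurableCylinders fun _ : {i // i ∉ Δ} => E d) :
    P (restrictIn Δ ⁻¹' (A ∩ window Δ S M) ∩ restrictOut Δ ⁻¹' B) ≤
      ∫⁻ x in restrictIn Δ ⁻¹' (window Δ S M) ∩ restrictOut Δ ⁻¹' B,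
        windowProb Q (limitWeight H Δ) (window Δ S M) A (restrictOut Δ x) ∂P :=
  le_of_forall_pos_le_exp_pow_mul 4 fun η hη =>
    have ⟨_, hR⟩ := hq Δ M η hη
    hP.le_mul_windowProb hH h1 h2 h3 h4 hS hQS hΛs hR hA hB

theorem windowProb_add_compl_le_one (W : Field b → ℝ≥0∞) (T : Set ({i // i ∈ Δ} → E d))
    {A : Set ({i // i ∈ Δ} → E d)} (hA : MeasurableSet A) (y : {i // i ∉ Δ} → E d) :
    windowProb Q W T A y + windowProb Q W T Aᶜ y ≤ 1 := by
  have hadd : windowMass Q W (A ∩ T) y + windowMass Q W (Aᶜ ∩ T) y = windowMass Q W T y := by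
    simp only [windowMass]
    rw [← lintegral_inter_add_sdiff (μ := Measure.pi fun _ : {i // i ∈ Δ} => Q) _ T hA,
      Set.inter_comm A T, Set.sdiff_eq, Set.inter_comm Aᶜ T]
  rw [windowProb, windowProb, ← mul_add, hadd, mul_comm]
  exact ENNReal.mul_inv_le_one _

theorem measure_eq_of_le_of_compl_le {X : Type*} [MeasurableSpace X] {μ : Measure X}
    [IsFiniteMeasure μ] {A D : Set X} (hA : MeasurableSet A) {f g : X → ℝ≥0∞}
    (hf : Measurable f) (hfg : ∀ x, f x + g x ≤ 1) (hAf : μ (A ∩ D) ≤ ∫⁻ x in D, f x ∂μ)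
    (hAg : μ (Aᶜ ∩ D) ≤ ∫⁻ x in D, g x ∂μ) : μ (A ∩ D) = ∫⁻ x in D, f x ∂μ := by
  refine le_antisymm hAf
    ((ENNReal.add_le_add_iff_right (measure_ne_top μ (Aᶜ ∩ D))).1 ?_)
  calc ∫⁻ x in D, f x ∂μ + μ (Aᶜ ∩ D) ≤ ∫⁻ x in D, f x ∂μ + ∫⁻ x in D, g x ∂μ :=
        add_le_add le_rfl hAg
    _ = ∫⁻ x in D, f x + g x ∂μ := (lintegral_add_left hf g).symm
    _ ≤ ∫⁻ _ in D, 1 ∂μ := lintegral_mono hfg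
    _ = μ (A ∩ D) + μ (Aᶜ ∩ D) := by
        rw [setLIntegral_one, Set.inter_comm A, Set.inter_comm Aᶜ, ← Set.sdiff_eq,
          measure_inter_add_sdiff D hA]

theorem measure_inter_eq_setLIntegral_of_cylinders {X : Type*} [MeasurableSpace X] {μ : Measure X}
    [IsFiniteMeasure μ] {ι : Type*} {Y : ι → Type*} [∀ i, MeasurableSpace (Y i)]
    {p : X → ∀ i, Y i} (hp : Measurable p) {C D : Set X} {f : X → ℝ≥0∞}
    (h : ∀ B ∈ measurableCylinders Y, μ (C ∩ p ⁻¹' B) = ∫⁻ x in D ∩ p ⁻¹' B, f x ∂μ)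
    {B : Set (∀ i, Y i)} (hB : MeasurableSet B) :
    μ (C ∩ p ⁻¹' B) = ∫⁻ x in D ∩ p ⁻¹' B, f x ∂μ := by
  have hC : ∀ B, MeasurableSet B → (μ.restrict C).map p B = μ (C ∩ p ⁻¹' B) := fun B hB => by
    rw [Measure.map_apply hp hB, Measure.restrict_apply (hp hB), Set.inter_comm]
  have hD : ∀ B, MeasurableSet B →
      ((μ.restrict D).withDensity f).map p B = ∫⁻ x in D ∩ p ⁻¹' B, f x ∂μ := fun B hB => by
    rw [Measure.map_apply hp hB, withDensity_apply _ (hp hB), Measure.restrict_restrict (hp hB),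
      Set.inter_comm]
  have heq : (μ.restrict C).map p = ((μ.restrict D).withDensity f).map p :=
    measure_ext_of_cylinders fun B hB => by
      rw [hC B (.of_mem_measurableCylinders hB), hD B (.of_mem_measurableCylinders hB), h B hB]
  rw [← hC B hB, ← hD B hB, heq]

theorem TendstoLocally.eq_windowProb [IsProbabilityMeasure Q] (hH : IsHamiltonian H)
    (h1 : Stable H) (h2 : NonDegenerate b H) (h3 : Hereditary H) (h4 : TranslationInvariant H)
    (hS : MeasurableSet S) (hQS : ∀ᵐ v ∂Q, v ∈ S) (hq : QuasiLocal b H S)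
    [IsProbabilityMeasure P] (hΛs : IsFolner Λs)
    (hP : TendstoLocally (fun n => averagedGibbs H Q (Λs n)) P) (M : ℝ)
    {A : Set ({i // i ∈ Δ} → E d)} (hA : MeasurableSet A) {B : Set ({i // i ∉ Δ} → E d)}
    (hB : MeasurableSet B) :
    P (restrictIn Δ ⁻¹' (A ∩ window Δ S M) ∩ restrictOut Δ ⁻¹' B) =
      ∫⁻ x in restrictIn Δ ⁻¹' (window Δ S M) ∩ restrictOut Δ ⁻¹' B,
        windowProb Q (limitWeight H Δ) (window Δ S M) A (restrictOut Δ x) ∂P := by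
  refine measure_inter_eq_setLIntegral_of_cylinders measurable_restrictOut (fun B hB => ?_) hB
  have hle := fun A hA => hP.le_windowProb hH h1 h2 h3 h4 hS hQS hq hΛs M (A := A) hA hB
  simp only [Set.preimage_inter, Set.inter_assoc] at hle ⊢
  exact measure_eq_of_le_of_compl_le (measurable_restrictIn hA)
    ((measurable_windowProb (measurable_limitWeight hH) _ A).comp measurable_restrictOut)
    (fun x => windowProb_add_compl_le_one _ _ hA _) (hle A hA) (hle Aᶜ hA.compl)

end

/-! ### Exhaustion by windows -/

section

theorem tendsto_measure_inter_of_ae_mem_iUnion {X : Type*} [MeasurableSpace X] {μ : Measure X}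
    {T : ℕ → Set X} (hT : Monotone T) (hμT : ∀ᵐ x ∂μ, x ∈ ⋃ n, T n) (A : Set X) :
    Tendsto (fun n => μ (A ∩ T n)) atTop (𝓝 (μ A)) := by
  have h := tendsto_measure_iUnion_atTop (μ := μ) (s := fun n => A ∩ T n)
    fun m n hmn => Set.inter_subset_inter_right A (hT hmn)
  have hA : (A ∩ ⋃ n, T n : Set X) =ᵐ[μ] A :=
    inter_ae_eq_left_of_ae_eq_univ (eventuallyEq_univ.2 hμT)
  rwa [← Set.inter_iUnion, measure_congr hA] at h

theorem tendsto_setLIntegral_inter_of_ae_mem_iUnion {X : Type*} [MeasurableSpace X]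
    {μ : Measure X} [IsFiniteMeasure μ] {T : ℕ → Set X} (hT : Monotone T)
    (hTm : ∀ n, MeasurableSet (T n)) (hμT : ∀ᵐ x ∂μ, x ∈ ⋃ n, T n) {D : Set X}
    (hD : MeasurableSet D) {f : ℕ → X → ℝ≥0∞} (hf : ∀ n, Measurable (f n))
    (hf1 : ∀ n x, f n x ≤ 1) {g : X → ℝ≥0∞}
    (hfg : ∀ᵐ x ∂μ, x ∈ D → Tendsto (fun n => f n x) atTop (𝓝 (g x))) :
    Tendsto (fun n => ∫⁻ x in T n ∩ D, f n x ∂μ) atTop (𝓝 (∫⁻ x in D, g x ∂μ)) := by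
  have hlim : Tendsto (fun n => ∫⁻ x in D, (T n).indicator (f n) x ∂μ) atTop
      (𝓝 (∫⁻ x in D, g x ∂μ)) := by
    refine tendsto_lintegral_of_dominated_convergence (fun _ => 1)
      (fun n => (hf n).indicator (hTm n))
      (fun n => .of_forall (Set.indicator_le' (fun x _ => hf1 n x) fun _ _ => bot_le))
      (by simp) ((ae_restrict_iff' hD).2 ?_)
    filter_upwards [hfg, hμT] with x hx hxT hxD
    obtain ⟨m, hm⟩ := Set.mem_iUnion.1 hxT
    refine (hx hxD).congr' ?_
    filter_upwards [eventually_ge_atTop m] with n hn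
    rw [Set.indicator_of_mem (hT hn hm)]
  refine hlim.congr fun n => ?_
  rw [lintegral_indicator (hTm n), Measure.restrict_restrict (hTm n)]

variable {d : ℕ} {b : Module.Basis (Fin d) ℝ (E d)} {Δ : Finset (Lat b)} {Q : Measure (E d)}
  {S : Set (E d)}

theorem monotone_window : Monotone (window Δ S) :=
  fun _ _ h _ hx i => ⟨(hx i).1, (hx i).2.trans h⟩

theorem mem_iUnion_window {x' : {i // i ∈ Δ} → E d} (hx' : ∀ i, x' i ∈ S) :
    x' ∈ ⋃ M : ℕ, window Δ S M := by
  obtain ⟨M, hM⟩ := exists_nat_ge (∑ i, ‖x' i‖)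
  exact Set.mem_iUnion.2 ⟨M, fun i => ⟨hx' i, (Finset.single_le_sum (f := fun i => ‖x' i‖)
    (fun _ _ => norm_nonneg _) (Finset.mem_univ i)).trans hM⟩⟩

theorem ae_pi_mem {ι X : Type*} [Fintype ι] [MeasurableSpace X] {μ : Measure X}
    [IsProbabilityMeasure μ] {S : Set X} (hμS : ∀ᵐ v ∂μ, v ∈ S) :
    ∀ᵐ x ∂(Measure.pi fun _ : ι => μ), ∀ i, x i ∈ S :=
  ae_all_iff.2 fun i =>
    (measurePreserving_eval (fun _ : ι => μ) i).quasiMeasurePreserving.ae hμS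

variable [IsProbabilityMeasure Q]

theorem tendsto_windowMass (hS : MeasurableSet S) (hQS : ∀ᵐ v ∂Q, v ∈ S) (W : Field b → ℝ≥0∞)
    {A : Set ({i // i ∈ Δ} → E d)} (hA : MeasurableSet A) (y : {i // i ∉ Δ} → E d) :
    Tendsto (fun M : ℕ => windowMass Q W (A ∩ window Δ S M) y) atTop
      (𝓝 (windowMass Q W A y)) := by
  set ν := (Measure.pi fun _ : {i // i ∈ Δ} => Q).withDensity fun x' => W (glue Δ x' y)
  have hν : ∀ A, MeasurableSet A → ν A = windowMass Q W A y := fun A => withDensity_apply _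
  have hνT : ∀ᵐ x' ∂ν, x' ∈ ⋃ M : ℕ, window Δ S M :=
    (withDensity_absolutelyContinuous _ _).ae_le
      ((ae_pi_mem hQS).mono fun _ => mem_iUnion_window)
  have h := tendsto_measure_inter_of_ae_mem_iUnion (monotone_window.comp Nat.mono_cast) hνT A
  rw [hν A hA] at h
  exact h.congr fun M => hν _ (hA.inter (measurableSet_window hS M))

theorem tendsto_windowMass_univ (hS : MeasurableSet S) (hQS : ∀ᵐ v ∂Q, v ∈ S)
    (W : Field b → ℝ≥0∞) (y : {i // i ∉ Δ} → E d) :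
    Tendsto (fun M : ℕ => windowMass Q W (window Δ S M) y) atTop
      (𝓝 (windowMass Q W Set.univ y)) := by
  simpa only [Set.univ_inter] using tendsto_windowMass hS hQS W MeasurableSet.univ y

theorem tendsto_windowProb (hS : MeasurableSet S) (hQS : ∀ᵐ v ∂Q, v ∈ S) (W : Field b → ℝ≥0∞)
    {A : Set ({i // i ∈ Δ} → E d)} (hA : MeasurableSet A) {y : {i // i ∉ Δ} → E d}
    (hy : windowMass Q W Set.univ y ≠ ∞) :
    Tendsto (fun M : ℕ => windowProb Q W (window Δ S M) A y) atTop
      (𝓝 (windowProb Q W Set.univ A y)) := by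
  by_cases h0 : windowMass Q W Set.univ y = 0
  · have hzero : ∀ A, windowMass Q W A y = 0 := fun A =>
      le_antisymm ((windowMass_mono (Set.subset_univ A) y).trans h0.le) bot_le
    simp only [windowProb, hzero, mul_zero]
    exact tendsto_const_nhds
  · simp only [windowProb, Set.inter_univ]
    exact ENNReal.Tendsto.mul (tendsto_windowMass_univ hS hQS W y).inv
      (Or.inl (ENNReal.inv_ne_zero.2 hy)) (tendsto_windowMass hS hQS W hA y)
      (Or.inr (ENNReal.inv_ne_top.2 h0))

theorem tendsto_windowProb_window_zero (hS : MeasurableSet S) (hQS : ∀ᵐ v ∂Q, v ∈ S)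
    (W : Field b → ℝ≥0∞) {y : {i // i ∉ Δ} → E d} (hy : windowMass Q W Set.univ y = ∞) (N : ℕ) :
    Tendsto (fun M : ℕ => windowProb Q W (window Δ S M) (window Δ S N) y) atTop (𝓝 0) := by
  by_cases hN : windowMass Q W (window Δ S N) y = ∞
  · refine tendsto_const_nhds.congr' ?_
    filter_upwards [eventually_ge_atTop N] with M hM
    have hMtop : windowMass Q W (window Δ S M) y = ∞ :=
      top_le_iff.1 (hN.ge.trans (windowMass_mono (monotone_window (Nat.cast_le.2 hM)) y))
    rw [windowProb, hMtop, ENNReal.inv_top, zero_mul]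
  · have hlim := ENNReal.Tendsto.mul_const (tendsto_windowMass_univ hS hQS W y).inv (Or.inr hN)
    rw [hy, ENNReal.inv_top, zero_mul] at hlim
    exact tendsto_of_tendsto_of_tendsto_of_le_of_le tendsto_const_nhds hlim
      (fun _ => bot_le) fun M => mul_le_mul' le_rfl (windowMass_mono Set.inter_subset_left y)

end

/-! ### Existence of Gibbs measures for quasi-local interactions -/

section

variable {d : ℕ} {b : Module.Basis (Fin d) ℝ (E d)} {Δ : Finset (Lat b)}
  {H : Finset (E d) → EReal} {Q : Measure (E d)} {S : Set (E d)}

/-- The DLR equations of `P` in `Δ`, conditionally on the bounded windows `window Δ S M`. They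
avoid the finiteness of the partition function, which is a consequence. -/
def HasWindowProb (H : Finset (E d) → EReal) (Q : Measure (E d)) (S : Set (E d))
    (Δ : Finset (Lat b)) (P : Measure (Field b)) : Prop :=
  ∀ (M : ℕ) (A : Set ({i // i ∈ Δ} → E d)) (B : Set ({i // i ∉ Δ} → E d)), MeasurableSet A →
    MeasurableSet B → P (restrictIn Δ ⁻¹' (A ∩ window Δ S M) ∩ restrictOut Δ ⁻¹' B) =
      ∫⁻ x in restrictIn Δ ⁻¹' (window Δ S M) ∩ restrictOut Δ ⁻¹' B,
        windowProb Q (limitWeight H Δ) (window Δ S M) A (restrictOut Δ x) ∂P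

theorem specification_apply (y : {i // i ∉ Δ} → E d) {A : Set ({i // i ∈ Δ} → E d)}
    (hA : MeasurableSet A) :
    specification H Q Δ y A = windowProb Q (limitWeight H Δ) Set.univ A y := by
  rw [specification, Measure.smul_apply, smul_eq_mul, withDensity_apply _ hA, windowProb,
    windowMass, windowMass, setLIntegral_univ, Set.inter_univ]
  rfl

variable {P : Measure (Field b)} [IsProbabilityMeasure Q]

theorem QuasiLocal.ae_exists_tendsto (hq : QuasiLocal b H S) (h3 : Hereditary H)
    (hS : MeasurableSet S) (hQS : ∀ᵐ v ∂Q, v ∈ S) (hPS : ∀ᵐ x ∂P, ∀ i, x i ∈ S)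
    (hPs : ∀ᵐ x ∂P, IsSparse x) (Δ : Finset (Lat b)) :
    ∀ᵐ y ∂(P.map (restrictOut Δ)), ∀ᵐ x' ∂(Measure.pi fun _ : {i // i ∈ Δ} => Q),
      ∃ h : EReal, Tendsto (energyIncrement H Δ (glue Δ x' y)) atTop (𝓝 h) := by
  have hmS : MeasurableSet {y : {i // i ∉ Δ} → E d | ∀ i, y i ∈ S} := by
    rw [Set.ofPred_forall]
    exact MeasurableSet.iInter fun i => measurable_pi_apply i hS
  have hae : ∀ᵐ y ∂(P.map (restrictOut Δ)), (∀ i, y i ∈ S) ∧ IsTight Δ y := by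
    refine (ae_map_iff measurable_restrictOut.aemeasurable
      (hmS.inter measurableSet_isTight)).2 ?_
    filter_upwards [hPS, hPs] with x hxS hx
    exact ⟨fun i => hxS i, hx.isTight⟩
  filter_upwards [hae] with y hy
  filter_upwards [ae_pi_mem hQS] with x' hx'
  exact hq.exists_tendsto h3 hy.1 hy.2 hx'

variable [IsProbabilityMeasure P]

theorem HasWindowProb.measure_inter_eq (hP : HasWindowProb H Q S Δ P) (hH : IsHamiltonian H)
    (hS : MeasurableSet S) (hPS : ∀ᵐ x ∂P, ∀ i, x i ∈ S) {A : Set ({i // i ∈ Δ} → E d)}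
    {B : Set ({i // i ∉ Δ} → E d)} (hA : MeasurableSet A) (hB : MeasurableSet B)
    {g : ({i // i ∉ Δ} → E d) → ℝ≥0∞}
    (hg : ∀ᵐ x ∂P, restrictOut Δ x ∈ B →
      Tendsto (fun M : ℕ => windowProb Q (limitWeight H Δ) (window Δ S M) A (restrictOut Δ x))
        atTop (𝓝 (g (restrictOut Δ x)))) :
    P (restrictIn Δ ⁻¹' A ∩ restrictOut Δ ⁻¹' B) =
      ∫⁻ x in restrictOut Δ ⁻¹' B, g (restrictOut Δ x) ∂P := by
  have hT : Monotone fun M : ℕ => (restrictIn Δ ⁻¹' window Δ S M : Set (Field b)) :=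
    fun M N h => Set.preimage_mono (monotone_window (Nat.cast_le.2 h))
  have hPT : ∀ᵐ x ∂P, x ∈ ⋃ M : ℕ, (restrictIn Δ ⁻¹' window Δ S M : Set (Field b)) := by
    filter_upwards [hPS] with x hx
    rw [← Set.preimage_iUnion]
    exact mem_iUnion_window (x' := restrictIn Δ x) fun i => hx i
  refine tendsto_nhds_unique (tendsto_measure_inter_of_ae_mem_iUnion hT hPT _)
    ((tendsto_setLIntegral_inter_of_ae_mem_iUnion hT
      (fun M => measurable_restrictIn (measurableSet_window hS M)) hPT (measurable_restrictOut hB)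
      (fun M => (measurable_windowProb (measurable_limitWeight hH) _ A).comp
        measurable_restrictOut) (fun _ _ => windowProb_le_one _ _ _ _) hg).congr fun M => ?_)
  rw [Set.inter_right_comm]
  exact (hP M A B hA hB).symm

theorem HasWindowProb.ae_windowMass_ne_top (hP : HasWindowProb H Q S Δ P) (hH : IsHamiltonian H)
    (hS : MeasurableSet S) (hQS : ∀ᵐ v ∂Q, v ∈ S) (hPS : ∀ᵐ x ∂P, ∀ i, x i ∈ S) :
    ∀ᵐ x ∂P, windowMass Q (limitWeight H Δ) Set.univ (restrictOut Δ x) ≠ ∞ := by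
  set B : Set ({i // i ∉ Δ} → E d) := {y | windowMass Q (limitWeight H Δ) Set.univ y = ∞}
  have hB : MeasurableSet B :=
    measurable_windowMass (measurable_limitWeight hH) Set.univ (measurableSet_singleton ∞)
  have hnull : ∀ N : ℕ, P (restrictIn Δ ⁻¹' (window Δ S N) ∩ restrictOut Δ ⁻¹' B) = 0 := by
    intro N
    rw [hP.measure_inter_eq hH hS hPS (measurableSet_window hS N) hB (g := fun _ => 0)
      (.of_forall fun x hx => tendsto_windowProb_window_zero hS hQS _ hx N), lintegral_zero]
  filter_upwards [measure_eq_zero_iff_ae_notMem.1 (measure_iUnion_null hnull), hPS] with x hx hxS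
    htop
  obtain ⟨N, hN⟩ := Set.mem_iUnion.1 (mem_iUnion_window (x' := restrictIn Δ x) fun i => hxS i)
  exact hx (Set.mem_iUnion.2 ⟨N, hN, htop⟩)

/-- The specification as a kernel, as needed to identify it with a conditional distribution. -/
def specificationKernel (hH : IsHamiltonian H) (Q : Measure (E d)) [IsProbabilityMeasure Q]
    (Δ : Finset (Lat b)) : Kernel ({i // i ∉ Δ} → E d) ({i // i ∈ Δ} → E d) where
  toFun := specification H Q Δ
  measurable' := by
    refine Measure.measurable_of_measurable_coe _ fun A hA => ?_
    simp_rw [specification_apply _ hA]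
    exact measurable_windowProb (measurable_limitWeight hH) _ A

theorem isFiniteKernel_specificationKernel (hH : IsHamiltonian H) :
    IsFiniteKernel (specificationKernel hH Q Δ) :=
  ⟨1, ENNReal.one_lt_top, fun y => (specification_apply y MeasurableSet.univ).trans_le
    (windowProb_le_one _ _ _ _)⟩

theorem HasWindowProb.condDistrib_eq (hP : HasWindowProb H Q S Δ P) (hH : IsHamiltonian H)
    (hS : MeasurableSet S) (hQS : ∀ᵐ v ∂Q, v ∈ S) (hPS : ∀ᵐ x ∂P, ∀ i, x i ∈ S) :
    ∀ᵐ y ∂(P.map (restrictOut Δ)),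
      condDistrib (restrictIn Δ) (restrictOut Δ) P y = specification H Q Δ y := by
  have := isFiniteKernel_specificationKernel (Q := Q) (Δ := Δ) hH
  refine condDistrib_ae_eq_of_measure_eq_compProd (κ := specificationKernel hH Q Δ)
    (restrictOut Δ) measurable_restrictIn.aemeasurable ?_
  have hm : Measurable fun x : Field b => (restrictOut Δ x, restrictIn Δ x) :=
    measurable_restrictOut.prodMk measurable_restrictIn
  have := Measure.isProbabilityMeasure_map (μ := P) hm.aemeasurable
  have := Measure.isProbabilityMeasure_map (μ := P) (measurable_restrictOut (Δ := Δ)).aemeasurable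
  refine Measure.ext_prod fun {B A} hB hA => ?_
  rw [Measure.map_apply hm (hB.prod hA), Measure.compProd_apply_prod hB hA,
    setLIntegral_map hB (Kernel.measurable_coe _ hA) measurable_restrictOut]
  change P (restrictOut Δ ⁻¹' B ∩ restrictIn Δ ⁻¹' A) =
    ∫⁻ x in restrictOut Δ ⁻¹' B, specification H Q Δ (restrictOut Δ x) A ∂P
  simp_rw [specification_apply _ hA]
  rw [Set.inter_comm]
  refine hP.measure_inter_eq hH hS hPS hA hB ?_
  filter_upwards [hP.ae_windowMass_ne_top hH hS hQS hPS] with x hx _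
  exact tendsto_windowProb hS hQS _ hA hx

theorem exists_isFolner_tendstoLocally_averagedGibbs (b : Module.Basis (Fin d) ℝ (E d))
    (h1 : Stable H) (h2 : NonDegenerate b H) (h4 : TranslationInvariant H) :
    ∃ (P : ProbabilityMeasure (Field b)) (Λ : ℕ → Finset (Lat b)), IsFolner Λ ∧
      TendstoLocally (fun n => averagedGibbs H Q (Λ n)) P := by
  have hfree := isProbabilityMeasure_freeGibbs (Q := Q) h1 h2 h4
  obtain ⟨Λ, hΛ⟩ := exists_isFolner (Lat b)
  obtain ⟨P, φ, hφ, hP⟩ :=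
    (locallyEquicontinuous_averagedGibbs (Q := Q) h1 h2 h4 hΛ.nonempty).exists_tendstoLocally
      (νs := fun n => ⟨averagedGibbs H Q (Λ n), isProbabilityMeasure_averagedGibbs (hΛ.nonempty n)⟩)
  exact ⟨P, Λ ∘ φ, hΛ.comp hφ, hP⟩

theorem QuasiLocal.gibbsMeasures_nonempty (hq : QuasiLocal b H S) (hH : IsHamiltonian H)
    (h1 : Stable H) (h2 : NonDegenerate b H) (h3 : Hereditary H) (h4 : TranslationInvariant H)
    (hS : MeasurableSet S) (hQS : ∀ᵐ v ∂Q, v ∈ S) : (gibbsMeasures b H Q).Nonempty := by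
  have hfree := isProbabilityMeasure_freeGibbs (Q := Q) h1 h2 h4
  obtain ⟨P, Λ, hΛ, hP⟩ := exists_isFolner_tendstoLocally_averagedGibbs (Q := Q) b h1 h2 h4
  have hPS := hP.ae_forall_mem hS hQS
  have hinv := hP.map_shift hΛ
  have hdlr : ∀ Δ, HasWindowProb H Q S Δ P := fun Δ M A B hA hB =>
    hP.eq_windowProb hH h1 h2 h3 h4 hS hQS hq hΛ M hA hB
  exact ⟨P, hinv, fun Δ => hq.ae_exists_tendsto h3 hS hQS hPS (ae_isSparse hinv) Δ,
    fun Δ => (hdlr Δ).condDistrib_eq hH hS hQS hPS⟩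

end

/-! ### Finite range interactions are quasi-local -/

section

variable {d : ℕ} {H : Finset (E d) → EReal}

theorem isLocallyFinite_coe (γ : Finset (E d)) : IsLocallyFinite (γ : Set (E d)) :=
  fun _ _ => γ.finite_toSet.subset Set.inter_subset_left

theorem IsLocallyFinite.window_coe_subset {γ : Finset (E d)}
    (hγ : IsLocallyFinite (γ : Set (E d))) (n : ℕ) : hγ.window n ⊆ γ := fun v hv => by
  simp only [window, Set.Finite.mem_toFinset] at hv
  exact hv.1

theorem IsLocallyFinite.eventually_window_coe_eq {γ : Finset (E d)}
    (hγ : IsLocallyFinite (γ : Set (E d))) : ∀ᶠ n in atTop, hγ.window n = γ := by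
  have hcube : ∀ v : E d, ∀ᶠ n in atTop, v ∈ cube d n := fun v => eventually_all.2 fun k =>
    tendsto_natCast_atTop_atTop.eventually (eventually_ge_atTop |v k|)
  filter_upwards [(eventually_all_finset γ).2 fun v _ => hcube v] with n hn
  refine (hγ.window_coe_subset n).antisymm fun v hv => ?_
  simp only [window, Set.Finite.mem_toFinset]
  exact ⟨hv, hn v hv⟩

theorem IsLocalEnergy.eq_energyDiff {W : Set (E d)} {γ : Finset (E d)}
    {hγ : IsLocallyFinite (γ : Set (E d))} {h : EReal} (hh : IsLocalEnergy H W hγ h) :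
    h = energyDiff (H γ) (H (outside γ W)) := by
  refine tendsto_nhds_unique hh (tendsto_const_nhds.congr' ?_)
  filter_upwards [hγ.eventually_window_coe_eq] with n hn
  rw [hn]

theorem IsLocalEnergy.unique {W : Set (E d)} {γ γ' : Set (E d)} (hγγ' : γ = γ')
    {hγ : IsLocallyFinite γ} {hγ' : IsLocallyFinite γ'} {h h' : EReal}
    (hh : IsLocalEnergy H W hγ h) (hh' : IsLocalEnergy H W hγ' h') : h = h' := by
  subst hγγ'
  exact tendsto_nhds_unique hh hh'

theorem outside_subset_outside {γ γ' : Finset (E d)} (h : γ ⊆ γ') (W : Set (E d)) :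
    outside γ W ⊆ outside γ' W := by
  classical exact Finset.filter_subset_filter _ h

theorem FiniteRange.exists_energyDiff_eq (h5 : FiniteRange H) (h3 : Hereditary H) :
    ∃ R : ℝ, ∀ (W : Set (E d)) (γ γ' : Finset (E d)), Bornology.IsBounded W →
      H (outside γ W) ≠ ⊤ → H (outside γ' W) ≠ ⊤ →
      (γ : Set (E d)) ∩ (W + Metric.ball (0 : E d) R) =
        (γ' : Set (E d)) ∩ (W + Metric.ball (0 : E d) R) →
      energyDiff (H γ) (H (outside γ W)) = energyDiff (H γ') (H (outside γ' W)) := by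
  obtain ⟨R, -, h5⟩ := h5
  refine ⟨R, fun W γ γ' hW hγ hγ' heq => ?_⟩
  have hlocal : ∀ γ : Finset (E d), H (outside γ W) ≠ ⊤ → IsLocalEnergy H W
      ((isLocallyFinite_coe γ).inter (W + Metric.ball (0 : E d) R))
      (energyDiff (H γ) (H (outside γ W))) := fun γ hγ => by
    obtain ⟨h, hh, hh'⟩ := h5 W hW _ (isLocallyFinite_coe γ) fun n htop =>
      hγ (h3.mono (outside_subset_outside (IsLocallyFinite.window_coe_subset _ n) W) htop)
    rwa [← hh.eq_energyDiff]
  exact (hlocal γ hγ).unique heq (hlocal γ' hγ')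

variable {b : Module.Basis (Fin d) ℝ (E d)} {Δ Λ' Λ : Finset (Lat b)} {x : Field b}

open scoped Classical in
/-- The points indexed by `Δ` which differ from all points indexed by `Λ \ Δ`: since `points` is a
set, these are the points lost when `Δ` is removed from `Λ`. -/
def newPoints (Δ Λ : Finset (Lat b)) (x : Field b) : Finset (E d) :=
  points Δ x \ points (Λ \ Δ) x

open scoped Classical in
theorem points_eq_union_newPoints (hΔ : Δ ⊆ Λ) (x : Field b) :
    points Λ x = points (Λ \ Δ) x ∪ newPoints Δ Λ x := by
  rw [newPoints, Finset.union_sdiff_self_eq_union, points, points, points, ← Finset.image_union,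
    Finset.sdiff_union_of_subset hΔ]

open scoped Classical in
theorem outside_newPoints (hΔ : Δ ⊆ Λ) (x : Field b) :
    outside (points Λ x) (newPoints Δ Λ x) = points (Λ \ Δ) x := by
  ext v
  simp only [outside, points_eq_union_newPoints hΔ, newPoints, Finset.mem_filter, Finset.mem_union,
    Finset.mem_coe, Finset.mem_sdiff]
  tauto

theorem exists_norm_le_of_mem_points (Δ : Finset (Lat b)) (M : ℝ) :
    ∃ r : ℝ, ∀ x : Field b, (∀ i ∈ Δ, ‖x i‖ ≤ M) → ∀ v ∈ points Δ x, ‖v‖ ≤ r := by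
  classical
  refine ⟨∑ i ∈ Δ, ‖(i : E d)‖ + M, fun x hM v hv => ?_⟩
  obtain ⟨i, hi, rfl⟩ := Finset.mem_image.1 hv
  exact (norm_add_le _ _).trans (add_le_add (Finset.single_le_sum
    (f := fun i : Lat b => ‖(i : E d)‖) (fun _ _ => norm_nonneg _) hi) (hM i hi))

theorem mem_points_iff_of_norm_le {Γ' Γ : Finset (Lat b)} {R : ℝ} (hΓ : Γ' ⊆ Γ)
    (hfar : ∀ i ∈ Γ, i ∉ Γ' → R < ‖(i : E d) + x i‖) {v : E d} (hv : ‖v‖ ≤ R) :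
    v ∈ points Γ' x ↔ v ∈ points Γ x := by
  classical
  refine ⟨fun h => points_mono hΓ x h, fun h => ?_⟩
  obtain ⟨i, hi, rfl⟩ := Finset.mem_image.1 h
  by_cases hi' : i ∈ Γ'
  · exact Finset.mem_image_of_mem _ hi'
  · exact absurd (hfar i hi hi') (not_lt.2 hv)

theorem newPoints_eq {R : ℝ} (hΛ : Λ' ⊆ Λ) (hR : ∀ v ∈ points Δ x, ‖v‖ ≤ R)
    (hfar : ∀ i ∈ Λ, i ∉ Λ' → R < ‖(i : E d) + x i‖) :
    newPoints Δ Λ' x = newPoints Δ Λ x := by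
  classical
  ext v
  simp only [newPoints, Finset.mem_sdiff, and_congr_right_iff]
  refine fun hv => not_congr (mem_points_iff_of_norm_le (Finset.sdiff_subset_sdiff hΛ le_rfl)
    (fun i hi hi' => ?_) (hR v hv))
  rw [Finset.mem_sdiff] at hi hi'
  exact hfar i hi.1 fun h => hi' ⟨h, hi.2⟩

theorem FiniteRange.quasiLocal (h5 : FiniteRange H) (h3 : Hereditary H) :
    QuasiLocal b H Set.univ := by
  classical
  obtain ⟨r, hr⟩ := h5.exists_energyDiff_eq h3
  intro Δ M η hη
  obtain ⟨s, hs⟩ := exists_norm_le_of_mem_points Δ M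
  refine ⟨s + |r|, fun x _ hM Λ' Λ hΔ hΛ hE hfar => ?_⟩
  have hnew : newPoints Δ Λ' x = newPoints Δ Λ x :=
    newPoints_eq hΛ (fun v hv => (hs x hM v hv).trans (le_add_of_nonneg_right (abs_nonneg r))) hfar
  have hout := outside_newPoints (hΔ.trans hΛ) x
  have hout' := outside_newPoints hΔ x
  rw [hnew] at hout'
  have hE' : H (points (Λ' \ Δ) x) ≠ ⊤ := fun h =>
    hE (h3.mono (points_mono (Finset.sdiff_subset_sdiff hΛ le_rfl) x) h)
  have heq : increment H Δ Λ x = increment H Δ Λ' x := by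
    have hlocal := hr (newPoints Δ Λ x) (points Λ x) (points Λ' x)
      (newPoints Δ Λ x).finite_toSet.isBounded
    rw [hout, hout'] at hlocal
    refine hlocal hE hE' (Set.ext fun v => and_congr_left fun hv => ?_)
    obtain ⟨w, hw, u, hu, rfl⟩ := Set.mem_add.1 hv
    refine (mem_points_iff_of_norm_le hΛ hfar ((norm_add_le w u).trans (add_le_add
      (hs x hM w (Finset.mem_sdiff.1 hw).1) ?_))).symm
    exact (mem_ball_zero_iff.1 hu).le.trans (le_abs_self r)
  rw [heq]
  exact ⟨le_add_of_nonneg_right (EReal.coe_nonneg.2 hη.le),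
    le_add_of_nonneg_right (EReal.coe_nonneg.2 hη.le)⟩

end

/-! ### Lattice sums of radial functions -/

section

theorem lintegral_fun_norm_ne_top {F : Type*} [NormedAddCommGroup F] [NormedSpace ℝ F]
    [MeasurableSpace F] [BorelSpace F] [FiniteDimensional ℝ F] [Nontrivial F] (μ : Measure F)
    [μ.IsAddHaarMeasure] {ψ : ℝ → ℝ≥0∞} (hψ : Measurable ψ) (hfin : ∀ r, ψ r ≠ ∞)
    (hint : ∫⁻ r in Set.Ioi 0, ENNReal.ofReal (r ^ (Module.finrank ℝ F - 1)) * ψ r ≠ ∞) :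
    ∫⁻ u, ψ ‖u‖ ∂μ ≠ ∞ := by
  have hradial :
      IntegrableOn (fun r => r ^ (Module.finrank ℝ F - 1) • (ψ r).toReal) (Set.Ioi 0) := by
    refine (integrable_toReal_of_lintegral_ne_top (by fun_prop) hint).congr ?_
    filter_upwards [ae_restrict_mem measurableSet_Ioi] with r hr
    rw [ENNReal.toReal_mul, ENNReal.toReal_ofReal (pow_nonneg (le_of_lt hr) _), smul_eq_mul]
  have hnorm := (integrable_fun_norm_addHaar μ (f := fun r => (ψ r).toReal)).2 hradial
  simpa only [ENNReal.ofReal_toReal (hfin _)] using hnorm.lintegral_lt_top.ne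

theorem setLIntegral_Ioi_pow_mul_comp_sub_le (ψ : ℝ → ℝ≥0∞) (n : ℕ) {C T : ℝ} (hC : 0 ≤ C)
    (hT : C ≤ T) :
    ∫⁻ r in Set.Ioi (T + C), ENNReal.ofReal (r ^ n) * ψ (r - C) ≤
      ENNReal.ofReal (2 ^ n) * ∫⁻ r in Set.Ioi T, ENNReal.ofReal (r ^ n) * ψ r := by
  have hpre : (· + C) ⁻¹' Set.Ioi (T + C) = Set.Ioi T := by
    ext r
    simp
  rw [← (measurePreserving_add_right volume C).setLIntegral_comp_preimage_emb
      (measurableEmbedding_addRight C) _ (Set.Ioi (T + C)), hpre,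
    ← lintegral_const_mul' _ _ ENNReal.ofReal_ne_top]
  refine setLIntegral_mono' measurableSet_Ioi fun r hr => ?_
  have hCr : C < r := hT.trans_lt hr
  rw [add_sub_cancel_right, ← mul_assoc, ← ENNReal.ofReal_mul (by positivity), ← mul_pow]
  gcongr <;> linarith

theorem setLIntegral_Ioi_pow_mul_comp_sub_ne_top {ψ : ℝ → ℝ≥0∞} (hψ : Antitone ψ)
    (hfin : ∀ r, ψ r ≠ ∞) {n : ℕ} {ρ : ℝ}
    (hint : ∫⁻ r in Set.Ioi ρ, ENNReal.ofReal (r ^ n) * ψ r ≠ ∞) {C : ℝ} (hC : 0 ≤ C) :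
    ∫⁻ r in Set.Ioi 0, ENNReal.ofReal (r ^ n) * ψ (r - C) ≠ ∞ := by
  set T := max ρ C
  have hT : 0 ≤ T + C := add_nonneg (le_max_of_le_right hC) hC
  have hnear : ∫⁻ r in Set.Ioc 0 (T + C), ENNReal.ofReal (r ^ n) * ψ (r - C) < ∞ := calc
    _ ≤ ∫⁻ _ in Set.Ioc 0 (T + C), ENNReal.ofReal ((T + C) ^ n) * ψ (0 - C) := by
        refine setLIntegral_mono' measurableSet_Ioc fun r hr => ?_
        gcongr
        · exact hr.1.le
        · exact hr.2
        · exact hψ (by linarith [hr.1])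
    _ < ∞ := by
        rw [setLIntegral_const]
        exact ENNReal.mul_lt_top (ENNReal.mul_lt_top ENNReal.ofReal_lt_top (hfin _).lt_top)
          measure_Ioc_lt_top
  have hfar : ∫⁻ r in Set.Ioi (T + C), ENNReal.ofReal (r ^ n) * ψ (r - C) < ∞ :=
    (setLIntegral_Ioi_pow_mul_comp_sub_le ψ n hC (le_max_right ρ C)).trans_lt
      (ENNReal.mul_lt_top ENNReal.ofReal_lt_top ((lintegral_mono_set
        (Set.Ioi_subset_Ioi (le_max_left ρ C))).trans_lt hint.lt_top))
  rw [← Set.Ioc_union_Ioi_eq_Ioi hT]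
  exact ((lintegral_union_le _ _ _).trans_lt (ENNReal.add_lt_top.2 ⟨hnear, hfar⟩)).ne

variable {d : ℕ}

theorem tsum_lat_le_lintegral (b : Module.Basis (Fin d) ℝ (E d)) {ψ : ℝ → ℝ≥0∞}
    (hψ : Antitone ψ) :
    volume (ZSpan.fundamentalDomain b) * ∑' i : Lat b, ψ ‖(i : E d)‖ ≤
      ∫⁻ u : E d, ψ (‖u‖ - ∑ k, ‖b k‖) := by
  have hD := ZSpan.isAddFundamentalDomain b (volume : Measure (E d))
  have : VAddInvariantMeasure (Lat b) (E d) volume :=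
    inferInstanceAs (VAddInvariantMeasure (Lat b).toAddSubgroup (E d) volume)
  rw [hD.lintegral_eq_tsum'', ← ENNReal.tsum_mul_left]
  refine ENNReal.tsum_le_tsum fun i => ?_
  rw [mul_comm, ← setLIntegral_const]
  refine setLIntegral_mono' (ZSpan.fundamentalDomain_measurableSet b) fun u hu => hψ ?_
  have hu' : ‖u‖ ≤ ∑ k, ‖b k‖ := by
    rw [← ZSpan.fract_eq_self.2 hu]
    exact ZSpan.norm_fract_le b u
  have hadd : ‖i +ᵥ u‖ ≤ ‖(i : E d)‖ + ‖u‖ := norm_add_le _ _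
  linarith

theorem tsum_lat_ne_top (hd : 0 < d) (b : Module.Basis (Fin d) ℝ (E d)) {ψ : ℝ → ℝ≥0∞}
    (hψ : Antitone ψ) (hfin : ∀ r, ψ r ≠ ∞) {ρ : ℝ}
    (hint : ∫⁻ r in Set.Ioi ρ, ENNReal.ofReal (r ^ (d - 1)) * ψ r ≠ ∞) (C : ℝ) :
    ∑' i : Lat b, ψ (‖(i : E d)‖ - C) ≠ ∞ := by
  have : Nonempty (Fin d) := ⟨⟨0, hd⟩⟩
  set C' := |∑ k, ‖b k‖ + C|
  have hshift : Measurable fun r => ψ (r - C') := hψ.measurable.comp (measurable_id.sub_const _)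
  have hball : ∫⁻ u : E d, ψ (‖u‖ - C') ≠ ∞ := by
    refine lintegral_fun_norm_ne_top volume hshift (fun r => hfin _) ?_
    simp only [finrank_euclideanSpace, Fintype.card_fin]
    exact setLIntegral_Ioi_pow_mul_comp_sub_ne_top hψ hfin hint (abs_nonneg _)
  have hle : volume (ZSpan.fundamentalDomain b) * ∑' i : Lat b, ψ (‖(i : E d)‖ - C) ≤
      ∫⁻ u : E d, ψ (‖u‖ - C') :=
    (tsum_lat_le_lintegral b fun r s h => hψ (sub_le_sub_right h C)).trans
      (lintegral_mono fun u => hψ (by linarith [le_abs_self (∑ k, ‖b k‖ + C)]))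
  intro htop
  rw [htop, ENNReal.mul_top (ZSpan.measure_fundamentalDomain_ne_zero b), top_le_iff] at hle
  exact hball hle

end

/-! ### Summable pair interactions are quasi-local -/

section

theorem ereal_abs_le_abs_of_nonneg {u v : EReal} (hu : 0 ≤ u) (h : u ≤ v) : u.abs ≤ v.abs := by
  induction v using EReal.rec with
  | bot => exact absurd (hu.trans h) (by simp)
  | top => simp
  | coe v =>
    lift u to ℝ using ⟨(h.trans_lt (EReal.coe_lt_top v)).ne, (EReal.bot_lt_zero.trans_le hu).ne'⟩
    exact ENNReal.ofReal_le_ofReal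
      (abs_le_abs_of_nonneg (EReal.coe_nonneg.1 hu) (EReal.coe_le_coe_iff.1 h))

theorem ereal_abs_le_abs_of_nonpos {u v : EReal} (hv : v ≤ 0) (h : u ≤ v) : v.abs ≤ u.abs := by
  rw [← EReal.abs_neg v, ← EReal.abs_neg u]
  exact ereal_abs_le_abs_of_nonneg (EReal.neg_nonneg.2 hv) (EReal.neg_le_neg_iff.2 h)

theorem ereal_abs_add_le (u v : EReal) : (u + v).abs ≤ u.abs + v.abs := by
  induction u using EReal.rec with
  | bot => simp
  | top => simp
  | coe u =>
    induction v using EReal.rec with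
    | bot => simp
    | top => simp
    | coe v =>
      rw [← EReal.coe_add, EReal.abs_def, EReal.abs_def, EReal.abs_def,
        ← ENNReal.ofReal_add (abs_nonneg u) (abs_nonneg v)]
      exact ENNReal.ofReal_le_ofReal (abs_add_le u v)

theorem ereal_abs_sum_le {ι : Type*} (s : Finset ι) (f : ι → EReal) :
    (∑ k ∈ s, f k).abs ≤ ∑ k ∈ s, (f k).abs :=
  Finset.le_sum_of_subadditive EReal.abs EReal.abs_zero.le ereal_abs_add_le s f

theorem le_add_and_le_add_of_ereal_abs_le {v : EReal} {η : ℝ} (hη : 0 ≤ η)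
    (h : v.abs ≤ ENNReal.ofReal η) (u : EReal) : u + v ≤ u + η ∧ u ≤ u + v + η := by
  induction v using EReal.rec with
  | bot => simp at h
  | top => simp at h
  | coe v =>
    rw [EReal.abs_def, ENNReal.ofReal_le_ofReal_iff hη] at h
    obtain ⟨hlower, hupper⟩ := abs_le.1 h
    refine ⟨add_le_add le_rfl (EReal.coe_le_coe_iff.2 hupper), ?_⟩
    rw [add_assoc, ← EReal.coe_add]
    exact le_add_of_nonneg_right (EReal.coe_nonneg.2 (by linarith))

theorem setLIntegral_Ioi_pow_mul_eq_top {f : ℝ → ℝ≥0∞} {c : ℝ≥0∞} (hc : c ≠ 0) {s : ℝ}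
    (hf : ∀ r, s < r → c ≤ f r) (n : ℕ) (ε : ℝ) :
    ∫⁻ r in Set.Ioi ε, ENNReal.ofReal (r ^ n) * f r = ∞ := by
  set t := max (max s ε) 1
  refine top_le_iff.1 ?_
  calc ∞ = ∫⁻ _ in Set.Ioi t, c := by
        rw [setLIntegral_const, Real.volume_Ioi, ENNReal.mul_top hc]
    _ ≤ ∫⁻ r in Set.Ioi t, ENNReal.ofReal (r ^ n) * f r := by
        refine setLIntegral_mono' measurableSet_Ioi fun r hr => ?_
        have hr1 : 1 < r := (le_max_right _ _).trans_lt hr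
        have hrs : s < r := ((le_max_left _ _).trans (le_max_left _ _)).trans_lt hr
        rw [← one_mul c]
        gcongr
        · exact ENNReal.one_le_ofReal.2 (one_le_pow₀ hr1.le)
        · exact hf r hrs
    _ ≤ _ := lintegral_mono_set (Set.Ioi_subset_Ioi ((le_max_right _ _).trans (le_max_left _ _)))

theorem antitoneOn_abs_of_setLIntegral_ne_top {φ : ℝ → EReal} {r₀ : ℝ}
    (hφ : AntitoneOn φ (Set.Ioi r₀)) {n : ℕ} {ε : ℝ}
    (hint : ∫⁻ r in Set.Ioi ε, ENNReal.ofReal (r ^ n) * (φ r).abs ≠ ∞) :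
    AntitoneOn (fun r => (φ r).abs) (Set.Ioi r₀) := by
  have hpos : ∀ s ∈ Set.Ioi r₀, 0 ≤ φ s := by
    intro s hs
    by_contra! hneg
    refine hint (setLIntegral_Ioi_pow_mul_eq_top (c := (φ s).abs) (s := s) ?_ ?_ n ε)
    · exact fun h => hneg.ne (EReal.abs_eq_zero_iff.1 h)
    · exact fun r hr => ereal_abs_le_abs_of_nonpos hneg.le (hφ hs (lt_trans hs hr) hr.le)
  exact fun r hr s hs hrs => ereal_abs_le_abs_of_nonneg (hpos s hs) (hφ hr hs hrs)

theorem exists_antitone_majorant {φ : ℝ → EReal} {r₀ : ℝ}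
    (hφ : MonotoneOn φ (Set.Ioi r₀) ∨ AntitoneOn φ (Set.Ioi r₀)) {n : ℕ} {ε : ℝ}
    (hint : ∫⁻ r in Set.Ioi ε, ENNReal.ofReal (r ^ n) * (φ r).abs ≠ ∞) :
    ∃ (ψ : ℝ → ℝ≥0∞) (ρ : ℝ), Antitone ψ ∧ (∀ r, ψ r ≠ ∞) ∧ (∀ r, ρ < r → (φ r).abs ≤ ψ r) ∧
      ∫⁻ r in Set.Ioi ρ, ENNReal.ofReal (r ^ n) * ψ r ≠ ∞ := by
  have hanti : AntitoneOn (fun r => (φ r).abs) (Set.Ioi r₀) := by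
    rcases hφ with hφ | hφ
    · simpa only [EReal.abs_neg] using antitoneOn_abs_of_setLIntegral_ne_top (φ := fun r => -φ r)
        (fun r hr s hs hrs => EReal.neg_le_neg_iff.2 (hφ hr hs hrs)) (n := n) (ε := ε)
        (by simpa only [EReal.abs_neg] using hint)
    · exact antitoneOn_abs_of_setLIntegral_ne_top hφ hint
  obtain ⟨s, hs, hsfin⟩ : ∃ s, max r₀ ε < s ∧ (φ s).abs ≠ ∞ := by
    by_contra! h
    exact hint (setLIntegral_Ioi_pow_mul_eq_top ENNReal.top_ne_zero (fun r hr => (h r hr).ge) n ε)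
  have hmem : ∀ r, max r s ∈ Set.Ioi r₀ := fun r =>
    ((le_max_left _ _).trans_lt hs).trans_le (le_max_right _ _)
  refine ⟨fun r => (φ (max r s)).abs, s, fun r t h => ?_, fun r => ?_, fun r hr => ?_, ?_⟩
  · exact hanti (hmem r) (hmem t) (max_le_max h le_rfl)
  · exact ne_top_of_le_ne_top hsfin (hanti ((le_max_left _ _).trans_lt hs) (hmem r)
      (le_max_right _ _))
  · simp only [max_eq_left hr.le, le_refl]
  · rw [setLIntegral_congr_fun (g := fun r => ENNReal.ofReal (r ^ n) * (φ r).abs) measurableSet_Ioi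
      fun r hr => by simp only [max_eq_left (le_of_lt (Set.mem_Ioi.1 hr))]]
    exact ne_top_of_le_ne_top hint
      (lintegral_mono_set (Set.Ioi_subset_Ioi ((le_max_right r₀ ε).trans hs.le)))

theorem exists_forall_sum_le {ι : Type*} {f : ι → ℝ≥0∞} (hf : ∑' i, f i ≠ ∞) {δ : ℝ≥0∞}
    (hδ : δ ≠ 0) : ∃ s₀ : Finset ι, ∀ s : Finset ι, Disjoint s s₀ → ∑ i ∈ s, f i ≤ δ := by
  classical
  obtain ⟨s₀, hs₀⟩ := ((ENNReal.tendsto_tsum_compl_atTop_zero hf).eventually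
    (ge_mem_nhds (pos_iff_ne_zero.2 hδ))).exists
  refine ⟨s₀, fun s hs => le_trans ?_ hs₀⟩
  rw [← Finset.sum_subtype_of_mem f (p := (· ∉ s₀)) fun i hi => Finset.disjoint_left.1 hs hi]
  exact ENNReal.sum_le_tsum _

variable {d : ℕ} {φ : ℝ → EReal}

open scoped Classical in
/-- The energy of a finite configuration with pair potential `φ`. -/
def pairEnergy (φ : ℝ → EReal) (γ : Finset (E d)) : EReal :=
  ∑ p ∈ γ.sym2.filter (fun p => ¬ p.IsDiag), pairValue φ p

open scoped Classical in
theorem pairEnergy_insert {γ : Finset (E d)} {w : E d} (hw : w ∉ γ) :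
    pairEnergy φ (insert w γ) = pairEnergy φ γ + ∑ a ∈ γ, φ (dist w a) := by
  rw [pairEnergy, pairEnergy, Finset.sum_filter, Finset.sum_filter, ← Finset.cons_eq_insert w γ hw,
    Finset.sym2_cons, Finset.sum_disjUnion, Finset.sum_map, Finset.sum_cons, add_comm]
  congr 1
  have hdiag : (Sym2.mkEmbedding w w).IsDiag := rfl
  rw [if_neg (not_not.2 hdiag), zero_add]
  refine Finset.sum_congr rfl fun a ha => ?_
  have hoff : ¬ (Sym2.mkEmbedding w a).IsDiag := fun h => by
    obtain rfl : w = a := Sym2.mk_isDiag_iff.1 h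
    exact hw ha
  rw [if_pos hoff]
  rfl

open scoped Classical in
theorem pairEnergy_union {A W : Finset (E d)} (h : Disjoint A W) :
    pairEnergy φ (A ∪ W) =
      pairEnergy φ A + (pairEnergy φ W + ∑ w ∈ W, ∑ a ∈ A, φ (dist w a)) := by
  induction W using Finset.induction_on with
  | empty => simp [pairEnergy]
  | insert w W hw ih =>
    rw [Finset.disjoint_insert_right] at h
    rw [Finset.union_insert, pairEnergy_insert (by simp [h.1, hw]), ih h.2, pairEnergy_insert hw,
      Finset.sum_insert hw, Finset.sum_union h.2]
    abel

variable {b : Module.Basis (Fin d) ℝ (E d)} {Δ Λ' Λ : Finset (Lat b)} {x : Field b}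

open scoped Classical in
theorem increment_pairEnergy (hφ : ∀ γ : Finset (E d), pairEnergy φ γ ≠ ⊥) (hΔ : Δ ⊆ Λ)
    (hE : pairEnergy φ (points (Λ \ Δ) x) ≠ ⊤) :
    increment (pairEnergy φ) Δ Λ x = pairEnergy φ (newPoints Δ Λ x) +
      ∑ w ∈ newPoints Δ Λ x, ∑ a ∈ points (Λ \ Δ) x, φ (dist w a) := by
  rw [increment, energyDiff, if_neg fun h => hE h.2, points_eq_union_newPoints hΔ,
    pairEnergy_union (W := newPoints Δ Λ x) Finset.disjoint_sdiff]
  lift pairEnergy φ (points (Λ \ Δ) x) to ℝ using ⟨hE, hφ _⟩ with c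
  exact EReal.add_sub_cancel_left

open scoped Classical in
theorem increment_pairEnergy_eq_add (hφ : ∀ γ : Finset (E d), pairEnergy φ γ ≠ ⊥) (hΔ : Δ ⊆ Λ')
    (hΛ : Λ' ⊆ Λ) (hE' : pairEnergy φ (points (Λ' \ Δ) x) ≠ ⊤)
    (hE : pairEnergy φ (points (Λ \ Δ) x) ≠ ⊤) (hnew : newPoints Δ Λ' x = newPoints Δ Λ x) :
    increment (pairEnergy φ) Δ Λ x = increment (pairEnergy φ) Δ Λ' x +
      ∑ w ∈ newPoints Δ Λ x, ∑ a ∈ points (Λ \ Δ) x \ points (Λ' \ Δ) x, φ (dist w a) := by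
  rw [increment_pairEnergy hφ (hΔ.trans hΛ) hE, increment_pairEnergy hφ hΔ hE', hnew, add_assoc,
    ← Finset.sum_add_distrib]
  congr 1
  refine Finset.sum_congr rfl fun w _ => ?_
  rw [add_comm, Finset.sum_sdiff (points_mono (Finset.sdiff_subset_sdiff hΛ le_rfl) x)]

open scoped Classical in
theorem points_sdiff_sdiff_subset (Δ Λ' Λ : Finset (Lat b)) (x : Field b) :
    points (Λ \ Δ) x \ points (Λ' \ Δ) x ⊆ points (Λ \ Λ') x := by
  intro v hv
  obtain ⟨hv, hv'⟩ := Finset.mem_sdiff.1 hv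
  obtain ⟨i, hi, rfl⟩ := Finset.mem_image.1 hv
  obtain ⟨hi, hiΔ⟩ := Finset.mem_sdiff.1 hi
  exact Finset.mem_image_of_mem _ (Finset.mem_sdiff.2 ⟨hi, fun hi' =>
    hv' (Finset.mem_image_of_mem _ (Finset.mem_sdiff.2 ⟨hi', hiΔ⟩))⟩)

theorem exists_forall_sum_points_abs_le (hd : 0 < d) (b : Module.Basis (Fin d) ℝ (E d))
    {r₀ : ℝ} (hφ : MonotoneOn φ (Set.Ioi r₀) ∨ AntitoneOn φ (Set.Ioi r₀)) {ε : ℝ}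
    (hint : ∫⁻ r in Set.Ioi ε, ENNReal.ofReal (r ^ (d - 1)) * (φ r).abs ≠ ∞)
    (N s : ℝ) {δ : ℝ≥0∞} (hδ : δ ≠ 0) :
    ∃ R : ℝ, ∀ (Λ : Finset (Lat b)) (x : Field b), (∀ i ∈ Λ, ‖x i‖ ≤ N) →
      (∀ i ∈ Λ, R < ‖(i : E d) + x i‖) → ∀ w : E d, ‖w‖ ≤ s →
        ∑ a ∈ points Λ x, (φ (dist w a)).abs ≤ δ := by
  classical
  obtain ⟨ψ, ρ, hψ, hψfin, hφψ, hψint⟩ := exists_antitone_majorant hφ hint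
  obtain ⟨s₀, hs₀⟩ := exists_forall_sum_le (tsum_lat_ne_top hd b hψ hψfin hψint (N + s)) hδ
  refine ⟨max (s + ρ) (∑ i ∈ s₀, ‖(i : E d)‖ + N), fun Λ x hx hfar w hw => ?_⟩
  have hterm : ∀ i ∈ Λ, (φ (dist w ((i : E d) + x i))).abs ≤ ψ (‖(i : E d)‖ - (N + s)) := by
    intro i hi
    have hdist : ‖(i : E d) + x i‖ - ‖w‖ ≤ dist w ((i : E d) + x i) := by
      rw [dist_comm, dist_eq_norm]
      exact norm_sub_norm_le _ _
    have hi' : ‖(i : E d)‖ ≤ ‖(i : E d) + x i‖ + ‖x i‖ := by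
      simpa using norm_sub_le ((i : E d) + x i) (x i)
    refine (hφψ _ ?_).trans (hψ ?_)
    · linarith [(le_max_left _ _).trans_lt (hfar i hi)]
    · linarith [hx i hi]
  have hdisj : Disjoint Λ s₀ := by
    refine Finset.disjoint_left.2 fun i hi hi₀ => ?_
    have hle := Finset.single_le_sum (f := fun i : Lat b => ‖(i : E d)‖)
      (fun _ _ => norm_nonneg _) hi₀
    linarith [(le_max_right _ _).trans_lt (hfar i hi), norm_add_le (i : E d) (x i), hx i hi]
  calc ∑ a ∈ points Λ x, (φ (dist w a)).abs
      ≤ ∑ i ∈ Λ, (φ (dist w ((i : E d) + x i))).abs :=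
        Finset.sum_image_le_of_nonneg fun _ _ => bot_le
    _ ≤ ∑ i ∈ Λ, ψ (‖(i : E d)‖ - (N + s)) := Finset.sum_le_sum hterm
    _ ≤ δ := hs₀ Λ hdisj

theorem ereal_abs_sum_sum_le {ι κ : Type*} {A : Finset ι} {B : Finset κ} {f : ι → κ → EReal}
    {n : ℕ} (hA : A.card ≤ n) {c : ℝ≥0∞} (hf : ∀ a ∈ A, ∑ k ∈ B, (f a k).abs ≤ c / n) :
    (∑ a ∈ A, ∑ k ∈ B, f a k).abs ≤ c := calc
  _ ≤ ∑ a ∈ A, (∑ k ∈ B, f a k).abs := ereal_abs_sum_le _ _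
  _ ≤ ∑ _a ∈ A, c / n := Finset.sum_le_sum fun a ha => (ereal_abs_sum_le _ _).trans (hf a ha)
  _ ≤ n * (c / n) := by
    rw [Finset.sum_const, nsmul_eq_mul]
    gcongr
  _ ≤ c := ENNReal.mul_div_le

theorem SummablePairPotential.quasiLocal (hd : 0 < d) {H : Finset (E d) → EReal}
    (hH : IsHamiltonian H) (h5 : SummablePairPotential H) (h3 : Hereditary H) {S : Set (E d)}
    (hS : Bornology.IsBounded S) : QuasiLocal b H S := by
  classical
  obtain ⟨φ, -, ⟨r₀, hmono⟩, hHφ, ε, -, hint⟩ := h5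
  obtain rfl : H = pairEnergy φ := funext hHφ
  obtain ⟨N, hN⟩ := isBounded_iff_forall_norm_le.1 hS
  intro Δ M η hη
  obtain ⟨s, hs⟩ := exists_norm_le_of_mem_points Δ M
  have hδ : ENNReal.ofReal η / Δ.card ≠ 0 := by simp [ENNReal.div_eq_zero_iff, hη]
  obtain ⟨R, hR⟩ := exists_forall_sum_points_abs_le hd b hmono hint.ne N s hδ
  refine ⟨max s R, fun x hxS hM Λ' Λ hΔ hΛ hE hfar => ?_⟩
  have hnew : newPoints Δ Λ' x = newPoints Δ Λ x :=
    newPoints_eq hΛ (fun v hv => (hs x hM v hv).trans (le_max_left _ _)) hfar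
  have hE' : pairEnergy φ (points (Λ' \ Δ) x) ≠ ⊤ := fun h =>
    hE (h3.mono (points_mono (Finset.sdiff_subset_sdiff hΛ le_rfl) x) h)
  rw [increment_pairEnergy_eq_add hH.ne_bot hΔ hΛ hE' hE hnew]
  refine le_add_and_le_add_of_ereal_abs_le hη.le (ereal_abs_sum_sum_le
    ((Finset.card_le_card Finset.sdiff_subset).trans Finset.card_image_le) fun w hw => ?_) _
  refine (Finset.sum_le_sum_of_subset (points_sdiff_sdiff_subset Δ Λ' Λ x)).trans
    (hR _ x (fun i _ => hN _ (hxS i)) (fun i hi => ?_) w (hs x hM w (Finset.mem_sdiff.1 hw).1))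
  rw [Finset.mem_sdiff] at hi
  exact (le_max_right _ _).trans_lt (hfar i hi.1 hi.2)

end

/-! ### Gibbs perturbed lattices -/

section

variable {d : ℕ} {b : Module.Basis (Fin d) ℝ (E d)} {H : Finset (E d) → EReal} {Q : Measure (E d)}

theorem gibbsMeasures_nonempty (hd : 0 < d) [IsProbabilityMeasure Q] (hH : IsHamiltonian H)
    (h1 : Stable H) (h2 : NonDegenerate b H) (h3 : Hereditary H) (h4 : TranslationInvariant H)
    (h5 : FiniteRange H ∨ (SummablePairPotential H ∧ HasBoundedSupport Q)) :
    (gibbsMeasures b H Q).Nonempty := by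
  rcases h5 with h5 | ⟨h5, hQ⟩
  · exact (h5.quasiLocal h3).gibbsMeasures_nonempty hH h1 h2 h3 h4 MeasurableSet.univ
      (.of_forall Set.mem_univ)
  · exact (h5.quasiLocal hd hH h3 hQ).gibbsMeasures_nonempty hH h1 h2 h3 h4
      Measure.isClosed_support.measurableSet Measure.support_mem_ae

theorem gibbsPerturbedLattices_nonempty (h : (gibbsMeasures b H Q).Nonempty) :
    (gibbsPerturbedLattices b H Q).Nonempty := by
  obtain ⟨P, hP⟩ := h
  exact ⟨_, P, hP, isStationaryPointProcess_perturbedLattice hP.invariant measurable_fst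
    measurable_snd Measure.map_id, rfl⟩

theorem IsGibbsPerturbation.map_prodMk {S : Type*} [MeasurableSpace S] {μ : Measure S}
    {X : S → Field b} {U : S → E d} (h : IsGibbsPerturbation b H Q μ X U) :
    μ.map (fun s => (X s, U s)) = (μ.map X).prod (uniformD b) := by
  obtain ⟨P, -, hPX⟩ := h.gibbs
  have hμX : IsProbabilityMeasure (μ.map X) := hPX ▸ P.2
  have : IsProbabilityMeasure μ := Measure.isProbabilityMeasure_of_map X
  rw [(indepFun_iff_map_prod_eq_prod_map_map h.measurable_X.aemeasurable
    h.measurable_U.aemeasurable).1 h.indep, h.uniform]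

end

end GibbsLattice

end

theorem theorem1_general {d : ℕ} (hd : 0 < d)
    (b : Module.Basis (Fin d) ℝ (GibbsLattice.E d))
    (H : Finset (GibbsLattice.E d) → EReal) (hH : GibbsLattice.IsHamiltonian H)
    (Q : Measure (GibbsLattice.E d)) [IsProbabilityMeasure Q]
    (h1 : GibbsLattice.Stable H) (h2 : GibbsLattice.NonDegenerate b H)
    (h3 : GibbsLattice.Hereditary H) (h4 : GibbsLattice.TranslationInvariant H)
    (h5 : GibbsLattice.FiniteRange H ∨
      (GibbsLattice.SummablePairPotential H ∧ GibbsLattice.HasBoundedSupport Q)) :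
    (GibbsLattice.gibbsMeasures b H Q).Nonempty ∧
    (GibbsLattice.gibbsPerturbedLattices b H Q).Nonempty ∧
    ∀ (S : Type*) [MeasurableSpace S] (μ : Measure S)
      (X : S → GibbsLattice.Field b) (U : S → GibbsLattice.E d),
      GibbsLattice.IsGibbsPerturbation b H Q μ X U →
        GibbsLattice.IsStationaryPointProcess μ
          (fun s => GibbsLattice.perturbedLattice (X s) (U s)) ∧
        GibbsLattice.IsCondLaw μ (fun s => GibbsLattice.perturbedLattice (X s) (U s)) U
          (GibbsLattice.lawGiven μ X) ∧
        ∀ u : GibbsLattice.E d, ∀ k ∈ GibbsLattice.Lat b,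
          (GibbsLattice.lawGiven μ X u).map (fun γ => γ.translate k) =
            GibbsLattice.lawGiven μ X u := by
  have hne := GibbsLattice.gibbsMeasures_nonempty (b := b) hd hH h1 h2 h3 h4 h5
  refine ⟨hne, GibbsLattice.gibbsPerturbedLattices_nonempty hne, fun S _ μ X U h => ?_⟩
  obtain ⟨P, hP, hPX⟩ := h.gibbs
  have hXU := h.map_prodMk
  rw [hPX] at hXU
  exact ⟨GibbsLattice.isStationaryPointProcess_perturbedLattice hP.invariant h.measurable_X
      h.measurable_U hXU,
    GibbsLattice.isCondLaw_lawGiven h.measurable_X h.measurable_U hPX hXU,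
    fun u _ hk => GibbsLattice.lawGiven_map_translate h.measurable_X
      (by rw [hPX]; exact hP.invariant) u hk⟩

theorem theorem1 {d : ℕ} (hd : 0 < d)
    (b : Module.Basis (Fin d) ℝ (GibbsLattice.E d))
    (H : Finset (GibbsLattice.E d) → EReal) (hH : GibbsLattice.IsHamiltonian H)
    (Q : Measure (GibbsLattice.E d)) [IsProbabilityMeasure Q]
    (h1 : GibbsLattice.Stable H) (h2 : GibbsLattice.NonDegenerate b H)
    (h3 : GibbsLattice.Hereditary H) (h4 : GibbsLattice.TranslationInvariant H)
    (h5 : (GibbsLattice.FiniteRange H ∧ GibbsLattice.HasExpMoment Q 1) ∨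
      (GibbsLattice.SummablePairPotential H ∧ GibbsLattice.HasBoundedSupport Q)) :
    (GibbsLattice.gibbsMeasures b H Q).Nonempty ∧
    (GibbsLattice.gibbsPerturbedLattices b H Q).Nonempty ∧
    ∀ (S : Type*) [MeasurableSpace S] (μ : Measure S)
      (X : S → GibbsLattice.Field b) (U : S → GibbsLattice.E d),
      GibbsLattice.IsGibbsPerturbation b H Q μ X U →
        GibbsLattice.IsStationaryPointProcess μ
          (fun s => GibbsLattice.perturbedLattice (X s) (U s)) ∧
        GibbsLattice.IsCondLaw μ (fun s => GibbsLattice.perturbedLattice (X s) (U s)) U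
          (GibbsLattice.lawGiven μ X) ∧
        ∀ u : GibbsLattice.E d, ∀ k ∈ GibbsLattice.Lat b,
          (GibbsLattice.lawGiven μ X u).map (fun γ => γ.translate k) =
            GibbsLattice.lawGiven μ X u :=
  theorem1_general hd b H hH Q h1 h2 h3 h4 (h5.imp_left And.left)
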